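/- Theorem 3.1. Let $D\subset\mathbb C$ be a connected open set containing $0$ (for instance a disk about $0$, or $\mathbb C$), with coordinate $z$, and let $y:D\to S^6$ be a Willmore surface whose normalized potential (base point $0$) is $$\eta=\lambda^{-1}\begin{pmatrix}0&\hat B_1\\-\hat B_1^{t}I_{1,3}&0\end{pmatrix}dz,\qquad \hat B_1=\begin{pmatrix}h_{11}&ih_{11}&h_{12}&ih_{12}\\h_{21}&ih_{21}&h_{22}&ih_{22}\\h_{31}&ih_{31}&h_{32}&ih_{32}\\h_{41}&ih_{41}&h_{42}&ih_{42}\end{pmatrix},$$ where the $h_{jk}$ are meromorphic functions on $D$ and $I_{1,3}=\mathrm{diag}(-1,1,1,1)$. Then $y$ is totally isotropic, that is, $\langle \partial_z^mY,\partial_z^nY\rangle=0$ on $D$ for all $m,n\ge1$. Moreover, every point of $D$ has an open neighbourhood $U\subset D$ on which there are smooth sections $E_1,E_2$ of the complexified normal bundle $V^\perp_{\mathbb C}$ with $$\kappa,\ D_z\kappa,\ D_{\bar z}\kappa\in\mathrm{Span}_{\mathbb C}\{E_1,E_2\},\qquad \langle E_i,E_j\rangle=0,\quad \langle E_i,\bar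 E_j\rangle=\delta_{ij},\qquad D_zE_i,\ D_{\bar z}E_i\in\mathrm{Span}_{\mathbb C}\{E_1,E_2\}\qquad(i,j=1,2).$$ Here the following notions are used. * $\langle\cdot,\cdot\rangle$ is the complex bilinear extension of the Lorentzian metric $-x_0y_0+\sum_{j=1}^7x_jy_j$ of $\mathbb R^8_1$. For a smooth conformal immersion $y:D\to S^6$, $Y=e^{-\omega}(1,y)$ with $e^{2\omega}=2\langle y_z,y_{\bar z}\rangle$ is the canonical lift, $V_{\mathbb C}=\mathrm{Span}_{\mathbb C}\{Y,Y_z,Y_{\bar z},Y_{z\bar z}\}$, $V_{\mathbb C}^\perp$ is its orthogonal complement, and $D_z,D_{\bar z}$ denote the normal connection (differentiate, then project to $V^\perp_{\mathbb C}$). The Hopf differential $\kappa\in V^\perp_{\mathbb C}$ and the Schwarzian $s$ are defined by $Y_{zz}=-\frac s2Y+\kappa$. The immersion $y$ is a Willmore surface if $D_{\bar z}D_{\bar z}\kappa+\frac{\bar s}2\kappa=0$. * $SO^+(1,7)$ is the group of real $8\times8$ matrices $A$ with $A^tI_{1,7}A=I_{1,7}$, $\det A=1$ and positive upper left entry, where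 $I_{1,7}=\mathrm{diag}(-1,1,\dots,1)$, and $SO^+(1,7,\mathbb C)=\{A\in SL(8,\mathbb C):A^tI_{1,7}A=I_{1,7}\}$. Set $\sigma(A)=\Sigma A\Sigma^{-1}$ with $\Sigma=\mathrm{diag}(-I_4,I_4)$. A frame of $y$ is a smooth map $F:D\to SO^+(1,7)$ whose first four columns span $V$. Write $F^{-1}dF=\alpha_0+\alpha_1'+\alpha_1''$, where $\alpha_0$ consists of the two diagonal $4\times4$ blocks and $\alpha_1',\alpha_1''$ are the $(1,0)$- and $(0,1)$-part of the off-diagonal blocks. The extended frame is the solution $F(z,\lambda)$, $|\lambda|=1$, of $dF(z,\lambda)=F(z,\lambda)(\lambda^{-1}\alpha_1'+\alpha_0+\lambda\alpha_1'')$, $F(0,\lambda)=F(0)$. * A $1$-form $\eta=\lambda^{-1}\eta_{-1}(z)\,dz$ is the normalized potential of $y$ (with respect to the frame $F$) if, off a subset of $D\setminus\{0\}$ that is closed and discrete in $D$, there is a Birkhoff decomposition $F_-(z,\lambda)=F(0)^{-1}F(z,\lambda)F_+(z,\lambda)$, $|\lambda|=1$, with the following properties. $F_\pm(z,\cdot)$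 are loops in $SO^+(1,7,\mathbb C)$ twisted by $\sigma$, that is, $g(-\lambda)=\sigma(g(\lambda))$. $F_-(z,\cdot)$ extends continuously to $|\lambda|\ge1$ and holomorphically to $|\lambda|>1$ and $\infty$, with value $I$ at $\infty$. $F_+(z,\cdot)$ extends continuously to $|\lambda|\le1$ and holomorphically to $|\lambda|<1$, with value at $\lambda=0$ in $SO(1,3,\mathbb C)\times SO(4,\mathbb C)$. Finally, $F_-$ is meromorphic in $z\in D$ and holomorphic off the exceptional set, $F_-(0,\lambda)=I$, and $F_-^{-1}dF_-=\eta$. The theorem holds for every choice of the frame $F$. -/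

import Mathlib

open scoped ContDiff Topology Matrix

noncomputable section

namespace Willmore

-- Wirtinger derivatives of maps into a complex vector space.

/-- `∂f/∂z = (f_u - i f_v) / 2`, where `z = u + i v`. -/
def dz {E : Type*} [NormedAddCommGroup E] [NormedSpace ℂ E] (f : ℂ → E) (z : ℂ) : E :=
  (1 / 2 : ℂ) • (fderiv ℝ f z 1 - Complex.I • fderiv ℝ f z Complex.I)

/-- `∂f/∂z̄ = (f_u + i f_v) / 2`, where `z = u + i v`. -/
def dzbar {E : Type*} [NormedAddCommGroup E] [NormedSpace ℂ E] (f : ℂ → E) (z : ℂ) : E :=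
  (1 / 2 : ℂ) • (fderiv ℝ f z 1 + Complex.I • fderiv ℝ f z Complex.I)

-- Surfaces in the six-sphere, seen in the complexified Lorentz-Minkowski space.

/-- The complexification of the Lorentz-Minkowski space `ℝ^8_1`. -/
abbrev Vec : Type := Fin 8 → ℂ

/-- Complex `8 × 8` matrices. -/
abbrev Mat : Type := Matrix (Fin 8) (Fin 8) ℂ

/-- The complex bilinear extension `⟨x, y⟩ = -x₀ y₀ + x₁ y₁ + ⋯ + x₇ y₇` of the Lorentzian metric. -/
def lor (x y : Vec) : ℂ := -(x 0 * y 0) + ∑ j : Fin 7, x j.succ * y j.succ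

/-- A smooth conformal immersion `y : D → S^6`. -/
structure IsConformalImmersion (D : Set ℂ) (y : ℂ → EuclideanSpace ℝ (Fin 7)) : Prop where
  smooth : ContDiffOn ℝ ∞ y D
  mem_sphere : ∀ z ∈ D, y z ∈ Metric.sphere (0 : EuclideanSpace ℝ (Fin 7)) 1
  conformal : ∀ z ∈ D, ConformalAt y z

/-- `y` regarded as a map into `ℂ^7`. -/
def complexify (y : ℂ → EuclideanSpace ℝ (Fin 7)) (z : ℂ) : Fin 7 → ℂ := fun i => (y z i : ℂ)

/-- `e^{2ω} = 2⟨y_z, y_z̄⟩`. -/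
def expTwoOmega (y : ℂ → EuclideanSpace ℝ (Fin 7)) (z : ℂ) : ℝ :=
  (2 * (dz (complexify y) z ⬝ᵥ dzbar (complexify y) z)).re

/-- The canonical lift `Y = e^{-ω} (1, y)` into the forward light cone. -/
def lift (y : ℂ → EuclideanSpace ℝ (Fin 7)) (z : ℂ) : Vec :=
  (((Real.sqrt (expTwoOmega y z))⁻¹ : ℝ) : ℂ) • (Fin.cons 1 (complexify y z) : Vec)

/-- The fibre at `z` of the bundle `V_ℂ = Span {Y, Y_z, Y_z̄, Y_zz̄}` (the conformal Gauss map). -/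
def bundleV (y : ℂ → EuclideanSpace ℝ (Fin 7)) (z : ℂ) : Submodule ℂ Vec :=
  Submodule.span ℂ
    {lift y z, dz (lift y) z, dzbar (lift y) z, dzbar (dz (lift y)) z}

/-- The section `N` of `V` with `⟨N, Y⟩ = -1` and `⟨N, Y_z⟩ = ⟨N, Y_z̄⟩ = ⟨N, N⟩ = 0`. As
`⟨Y, Y_zz̄⟩ = -1/2`, it equals `2 Y_zz̄ + 2 ⟨Y_zz̄, Y_zz̄⟩ Y`. -/
def vecN (y : ℂ → EuclideanSpace ℝ (Fin 7)) (z : ℂ) : Vec :=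
  (2 : ℂ) • dzbar (dz (lift y)) z
    + (2 * lor (dzbar (dz (lift y)) z) (dzbar (dz (lift y)) z)) • lift y z

/-- The projection of `X` to the normal bundle `V_ℂ^⊥` along `V_ℂ`. The inner products of
`Y, Y_z, Y_z̄, N` all vanish, except for `⟨Y, N⟩ = -1` and `⟨Y_z, Y_z̄⟩ = 1/2`. -/
def normalPart (y : ℂ → EuclideanSpace ℝ (Fin 7)) (z : ℂ) (X : Vec) : Vec :=
  X + lor X (vecN y z) • lift y z + lor X (lift y z) • vecN y z
    - (2 * lor X (dzbar (lift y) z)) • dz (lift y) z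
    - (2 * lor X (dz (lift y) z)) • dzbar (lift y) z

/-- The normal connection `D_z`. -/
def Dz (y : ℂ → EuclideanSpace ℝ (Fin 7)) (ψ : ℂ → Vec) (z : ℂ) : Vec :=
  normalPart y z (dz ψ z)

/-- The normal connection `D_z̄`. -/
def Dzbar (y : ℂ → EuclideanSpace ℝ (Fin 7)) (ψ : ℂ → Vec) (z : ℂ) : Vec :=
  normalPart y z (dzbar ψ z)

/-- The conformal Hopf differential: the normal part of `Y_zz = -(s/2) Y + κ`. -/
def kappa (y : ℂ → EuclideanSpace ℝ (Fin 7)) (z : ℂ) : Vec :=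
  normalPart y z (dz (dz (lift y)) z)

/-- The Schwarzian `s`, where `Y_zz = -(s/2) Y + κ`, so that `⟨Y_zz, N⟩ = s/2`. -/
def schwarzian (y : ℂ → EuclideanSpace ℝ (Fin 7)) (z : ℂ) : ℂ :=
  2 * lor (dz (dz (lift y)) z) (vecN y z)

/-- A Willmore surface: a conformal immersion into `S^6` that satisfies the Willmore equation
`D_z̄ D_z̄ κ + (s̄/2) κ = 0`. -/
structure IsWillmore (D : Set ℂ) (y : ℂ → EuclideanSpace ℝ (Fin 7)) : Prop where
  immersion : IsConformalImmersion D y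
  willmore_eq : ∀ z ∈ D,
    Dzbar y (Dzbar y (kappa y)) z + (star (schwarzian y z) / 2) • kappa y z = 0

/-- Total isotropy: `⟨∂_z^m Y, ∂_z^n Y⟩ = 0` for all `m, n ≥ 1`. -/
def IsTotallyIsotropic (D : Set ℂ) (y : ℂ → EuclideanSpace ℝ (Fin 7)) : Prop :=
  ∀ m n : ℕ, 1 ≤ m → 1 ≤ n → ∀ z ∈ D, lor (dz^[m] (lift y) z) (dz^[n] (lift y) z) = 0

/-- A smooth isotropic frame `{E₁, E₂}` of the normal bundle `V_ℂ^⊥` over `U` whose span contains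
`κ, D_z κ, D_z̄ κ` and is invariant under the normal connection. -/
structure IsIsotropicNormalFrame (U : Set ℂ) (y : ℂ → EuclideanSpace ℝ (Fin 7))
    (E : Fin 2 → ℂ → Vec) : Prop where
  smooth : ∀ i, ContDiffOn ℝ ∞ (E i) U
  normal : ∀ z ∈ U, ∀ i, ∀ X ∈ bundleV y z, lor (E i z) X = 0
  kappa_mem : ∀ z ∈ U, kappa y z ∈ Submodule.span ℂ {E 0 z, E 1 z}
  Dz_kappa_mem : ∀ z ∈ U, Dz y (kappa y) z ∈ Submodule.span ℂ {E 0 z, E 1 z}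
  Dzbar_kappa_mem : ∀ z ∈ U, Dzbar y (kappa y) z ∈ Submodule.span ℂ {E 0 z, E 1 z}
  isotropic : ∀ z ∈ U, ∀ i j, lor (E i z) (E j z) = 0
  unitary : ∀ z ∈ U, ∀ i j, lor (E i z) (star (E j z)) = if i = j then 1 else 0
  Dz_mem : ∀ z ∈ U, ∀ i, Dz y (E i) z ∈ Submodule.span ℂ {E 0 z, E 1 z}
  Dzbar_mem : ∀ z ∈ U, ∀ i, Dzbar y (E i) z ∈ Submodule.span ℂ {E 0 z, E 1 z}

-- The groups, the involution and the Cartan decomposition.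

/-- `I_{1,3} = diag (-1, 1, 1, 1)`. -/
def I13 : Matrix (Fin 4) (Fin 4) ℂ := Matrix.diagonal fun i => if i = 0 then -1 else 1

/-- `I_{1,7} = diag (-1, 1, …, 1)`. -/
def I17 : Mat := Matrix.diagonal fun i => if i = 0 then -1 else 1

/-- `diag (-I_4, I_4)`; the involution is `σ(A) = sigmaD * A * sigmaD`. -/
def sigmaD : Mat := Matrix.diagonal fun i => if (i : ℕ) < 4 then -1 else 1

/-- The `8 × 8` matrix with the given `4 × 4` blocks. -/
def blocks (A B C E : Matrix (Fin 4) (Fin 4) ℂ) : Mat :=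
  (Matrix.fromBlocks A B C E).submatrix
    (finSumFinEquiv (m := 4) (n := 4)).symm (finSumFinEquiv (m := 4) (n := 4)).symm

/-- The complex group `SO^+(1,7,ℂ) = {X ∈ SL(8,ℂ) | Xᵗ I_{1,7} X = I_{1,7}}`. -/
def groupC : Set Mat := {A | Aᵀ * I17 * A = I17 ∧ A.det = 1}

/-- The real group `SO^+(1,7)`, as a set of complex matrices with real entries. -/
def groupR : Set Mat := {A | A ∈ groupC ∧ A.map star = A ∧ 0 < (A 0 0).re}

/-- `SO(1,3,ℂ) × SO(4,ℂ)`, the identity component of the fixed point group of `σ`. -/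
def groupKC0 : Set Mat :=
  {A | A ∈ groupC ∧ ∃ A₁ A₂ : Matrix (Fin 4) (Fin 4) ℂ,
    A₁.det = 1 ∧ A₂.det = 1 ∧ A = blocks A₁ 0 0 A₂}

/-- The component in `𝔨 ⊗ ℂ` (the diagonal blocks). -/
def kPart (A : Mat) : Mat := (1 / 2 : ℂ) • (A + sigmaD * A * sigmaD)

/-- The component in `𝔭 ⊗ ℂ` (the off-diagonal blocks). -/
def pPart (A : Mat) : Mat := (1 / 2 : ℂ) • (A - sigmaD * A * sigmaD)

/-- Entrywise `∂/∂z`. -/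
def matDz (F : ℂ → Mat) (z : ℂ) : Mat := Matrix.of fun i j => dz (fun w => F w i j) z

/-- Entrywise `∂/∂z̄`. -/
def matDzbar (F : ℂ → Mat) (z : ℂ) : Mat := Matrix.of fun i j => dzbar (fun w => F w i j) z

-- Frames, extended frames and the normalized potential.

/-- A frame `F : D → SO^+(1,7)` of the conformal Gauss map of `y`: the first four columns of `F(z)`
span the fibre of `V` at `z` (and so the last four span the normal space). -/
structure IsFrame (D : Set ℂ) (y : ℂ → EuclideanSpace ℝ (Fin 7)) (F : ℂ → Mat) : Prop where
  smooth : ∀ i j, ContDiffOn ℝ ∞ (fun z => F z i j) D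
  mem_group : ∀ z ∈ D, F z ∈ groupR
  span_eq : ∀ z ∈ D,
    Submodule.span ℂ (Set.range fun (j : Fin 4) (i : Fin 8) => F z i (Fin.castAdd 4 j))
      = bundleV y z

/-- The extended frame `F(z, lam)`, `|lam| = 1`, that belongs to a frame `F`: the solution of
`dF(z, lam) = F(z, lam) (lam⁻¹ α₁' + α₀ + lam α₁'')`, `F(0, lam) = F(0)`,
where `α = F⁻¹ dF = α₀ + α₁` is the Cartan decomposition of the Maurer-Cartan form. -/
structure IsExtendedFrame (D : Set ℂ) (F : ℂ → Mat) (Fl : ℂ → ℂ → Mat) : Prop where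
  smooth : ∀ lam : ℂ, ‖lam‖ = 1 → ∀ i j, ContDiffOn ℝ ∞ (fun z => Fl z lam i j) D
  init : ∀ lam : ℂ, ‖lam‖ = 1 → Fl 0 lam = F 0
  dz_eq : ∀ lam : ℂ, ‖lam‖ = 1 → ∀ z ∈ D, matDz (fun w => Fl w lam) z =
    Fl z lam * (lam⁻¹ • pPart ((F z)⁻¹ * matDz F z) + kPart ((F z)⁻¹ * matDz F z))
  dzbar_eq : ∀ lam : ℂ, ‖lam‖ = 1 → ∀ z ∈ D, matDzbar (fun w => Fl w lam) z =
    Fl z lam * (kPart ((F z)⁻¹ * matDzbar F z) + lam • pPart ((F z)⁻¹ * matDzbar F z))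

/-- The twisted loops in `SO^+(1,7,ℂ)` that extend holomorphically to `|lam| > 1` and to `∞`, with
the value `I` at `∞` (the group `Λ^-_* G^ℂ_σ`). -/
structure IsLoopMinus (g : ℂ → Mat) : Prop where
  continuousOn : ∀ i j, ContinuousOn (fun lam => g lam i j) {lam | 1 ≤ ‖lam‖}
  holomorphic : ∀ i j, DifferentiableOn ℂ (fun lam => g lam i j) {lam | 1 < ‖lam‖}
  at_infty : ∀ i j, Filter.Tendsto (fun lam => g lam i j) (Bornology.cobounded ℂ)
    (𝓝 ((1 : Mat) i j))
  mem_group : ∀ lam : ℂ, 1 ≤ ‖lam‖ → g lam ∈ groupC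
  twisted : ∀ lam : ℂ, 1 ≤ ‖lam‖ → g (-lam) = sigmaD * g lam * sigmaD

/-- The twisted loops in `SO^+(1,7,ℂ)` that extend holomorphically to `|lam| < 1`, with value at
`lam = 0` in the identity component of `K^ℂ` (the group `Λ^+_𝒞 G^ℂ_σ`). -/
structure IsLoopPlus (g : ℂ → Mat) : Prop where
  continuousOn : ∀ i j, ContinuousOn (fun lam => g lam i j) {lam | ‖lam‖ ≤ 1}
  holomorphic : ∀ i j, DifferentiableOn ℂ (fun lam => g lam i j) {lam | ‖lam‖ < 1}
  at_zero : g 0 ∈ groupKC0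
  mem_group : ∀ lam : ℂ, ‖lam‖ ≤ 1 → g lam ∈ groupC
  twisted : ∀ lam : ℂ, ‖lam‖ ≤ 1 → g (-lam) = sigmaD * g lam * sigmaD

/-- The Birkhoff decomposition `F_-(z, lam) = F(0)⁻¹ F(z, lam) F_+(z, lam)` of the normalized
extended frame, with `F_-` meromorphic in `z ∈ D`, and `F_-⁻¹ dF_- = lam⁻¹ η(z) dz`. The decomposition
exists off a set `P` that is discrete and closed in `D` and contains the poles of `F_-`. -/
structure IsBirkhoff (D P : Set ℂ) (F : ℂ → Mat) (Fl Fm Fp : ℂ → ℂ → Mat) (η : ℂ → Mat) :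
    Prop where
  discrete : ∀ z ∈ D, ∀ᶠ w in 𝓝[≠] z, w ∉ P
  zero_notMem : (0 : ℂ) ∉ P
  minus : ∀ z ∈ D \ P, IsLoopMinus (Fm z)
  plus : ∀ z ∈ D \ P, IsLoopPlus (Fp z)
  init : ∀ lam : ℂ, ‖lam‖ = 1 → Fm 0 lam = 1
  decomposition : ∀ z ∈ D \ P, ∀ lam : ℂ, ‖lam‖ = 1 → Fm z lam = (F 0)⁻¹ * Fl z lam * Fp z lam
  meromorphic : ∀ lam : ℂ, ‖lam‖ = 1 → ∀ i j, MeromorphicOn (fun z => Fm z lam i j) D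
  deriv_eq : ∀ lam : ℂ, ‖lam‖ = 1 → ∀ z ∈ D \ P, ∀ i j,
    HasDerivAt (fun w => Fm w lam i j) ((Fm z lam * (lam⁻¹ • η z)) i j) z

/-- `lam⁻¹ η dz` is a normalized potential, with base point `0`, of (the conformal Gauss map of) the
surface `y` on `D`. It is determined by `y` once the frame is fixed at the base point. -/
def IsNormalizedPotential (D : Set ℂ) (y : ℂ → EuclideanSpace ℝ (Fin 7)) (η : ℂ → Mat) : Prop :=
  ∃ (F : ℂ → Mat) (Fl Fm Fp : ℂ → ℂ → Mat) (P : Set ℂ),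
    IsFrame D y F ∧ IsExtendedFrame D F Fl ∧ IsBirkhoff D P F Fl Fm Fp η

/-- The `4 × 4` matrix `B̂₁` with rows `(h_{j1}, i h_{j1}, h_{j2}, i h_{j2})`. -/
def isoB (h : Fin 4 → Fin 2 → ℂ → ℂ) (z : ℂ) : Matrix (Fin 4) (Fin 4) ℂ :=
  Matrix.of fun j => ![h j 0 z, Complex.I * h j 0 z, h j 1 z, Complex.I * h j 1 z]

/-- The coefficient `η_{-1}`, with upper right block `B̂₁` and lower left block `-B̂₁ᵗ I_{1,3}`. -/
def isoPotential (h : Fin 4 → Fin 2 → ℂ → ℂ) (z : ℂ) : Mat :=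
  blocks 0 (isoB h z) (-((isoB h z)ᵀ * I13)) 0

end Willmore

end

/-!
The upper right block of the potential annihilates the isotropic plane `W` spanned by `e₄ + i e₅` and
`e₆ + i e₇` in the normal directions, and its lower left block acts on the tangential directions only.
So `F_-⁻¹ dF_- = η` gives `d(F_- w) = 0` for `w ∈ W`, that is, `F_-(z, lam) w = w` for all `z` and
`lam` (`IsBirkhoff.minus_mulVec`). By the Birkhoff decomposition, `F(z, lam) F_+(z, lam) w = F(0) w`.
Hence the loop `q = F_+(z, ·) w`, which extends holomorphically to the unit disk, solves the linear
system `dq = -(lam⁻¹ α₁' + α₀ + lam α₁'') q` (`IsBirkhoff.hasFDerivAt_plus`). Fourier coefficients of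
this system give, for `q₀ = F_+(z, 0) w`, the equations `α₁' q₀ = 0`, `∂_z̄ q₀ = -α₀'' q₀` and
`∂_z q₀ = -α₀' q₀ - α₁' q₁` for some `q₁` (`loop_value_at_zero`).

The plane `F_+(z, 0) W` is isotropic and lies in the normal space, since `F_+(z, 0)` is
block-diagonal. The normal part of `α₁' q₁` is orthogonal to this plane, as `α₁'` is skew and
annihilates the plane; a maximal isotropic plane is its own orthogonal complement, so this
normal part lies in it. Therefore the plane is parallel for the normal connection. In terms of the
Hermitian projector `Q` onto the plane this is the equation `dQ = [Q, α₀]` (`IsBirkhoff.isParallelProjector`). `F_+` is only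
known off the exceptional set, but `Q` has bounded entries, so `dQ` is bounded near an exceptional
point, and `Q` extends across it as a solution of the same equation
(`exists_parallelProjector_extension`); the equation also makes `Q` smooth.

As `α₁'` annihilates the plane, by skewness it maps the tangential directions into the plane. So `κ`,
the normal part of `Y_zz`, is a section of the parallel plane bundle, and so are `D_z κ` and `D_z̄ κ`.
The Gram-Schmidt process applied to two columns of `Q` gives `E₁, E₂`
(`isIsotropicNormalFrame_of_projector`).

Finally, `Y_zz = -(s/2) Y + κ` and the orthogonality of `E_i` to the isotropic plane that contains `κ`
show that the isotropic bundle spanned by `Y, Y_z, E₁, E₂` is invariant under `∂_z`, and it contains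
all `∂_z^m Y`. This is total isotropy (`isTotallyIsotropic_of_frame`).
-/

open scoped ContDiff Topology Matrix

noncomputable section

namespace Willmore

/-! ### Wirtinger calculus -/

section Wirtinger

variable {E : Type*} [NormedAddCommGroup E] [NormedSpace ℂ E]

/-- The real-linear map `v ↦ v • a + v̄ • b`, that is, the real derivative of a map whose Wirtinger
derivatives are `a` and `b`. -/
def wirt (a b : E) : ℂ →L[ℝ] E :=
  (ContinuousLinearMap.id ℝ ℂ).smulRight a + (Complex.conjCLE : ℂ →L[ℝ] ℂ).smulRight b

@[simp] lemma wirt_apply (a b : E) (v : ℂ) : wirt a b v = v • a + (starRingEnd ℂ v) • b := by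
  simp [wirt]

lemma norm_wirt_le (a b : E) : ‖wirt a b‖ ≤ ‖a‖ + ‖b‖ := by
  refine ContinuousLinearMap.opNorm_le_bound _ (by positivity) fun v => ?_
  rw [wirt_apply]
  refine (norm_add_le _ _).trans ?_
  rw [norm_smul, norm_smul, RCLike.norm_conj, add_mul, mul_comm ‖v‖, mul_comm ‖v‖]

lemma isBoundedLinearMap_wirt :
    IsBoundedLinearMap ℝ fun p : E × E => wirt p.1 p.2 where
  map_add p p' := by
    refine ContinuousLinearMap.ext fun v => ?_
    simp only [wirt_apply, Prod.fst_add, Prod.snd_add, add_apply]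
    module
  map_smul c p := by
    refine ContinuousLinearMap.ext fun v => ?_
    simp only [wirt_apply, Prod.smul_fst, Prod.smul_snd, smul_apply, smul_add, smul_comm c]
  bound := ⟨2, two_pos, fun p => (norm_wirt_le _ _).trans (by
    rw [two_mul]; exact add_le_add (norm_fst_le p) (norm_snd_le p))⟩

lemma dz_of_hasFDerivAt {f : ℂ → E} {a b : E} {z : ℂ} (h : HasFDerivAt f (wirt a b) z) :
    dz f z = a := by
  have e : Complex.I • Complex.I • (a - b) = -(a - b) := by
    rw [smul_smul, Complex.I_mul_I, neg_one_smul]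
  rw [dz, h.fderiv]
  simp only [wirt_apply, one_smul, map_one, Complex.conj_I, neg_smul]
  rw [← sub_eq_add_neg, ← smul_sub, e]
  rw [show a + b - -(a - b) = (2 : ℂ) • a by rw [two_smul]; abel, smul_smul]
  norm_num

lemma dzbar_of_hasFDerivAt {f : ℂ → E} {a b : E} {z : ℂ} (h : HasFDerivAt f (wirt a b) z) :
    dzbar f z = b := by
  have e : Complex.I • Complex.I • (a - b) = -(a - b) := by
    rw [smul_smul, Complex.I_mul_I, neg_one_smul]
  rw [dzbar, h.fderiv]
  simp only [wirt_apply, one_smul, map_one, Complex.conj_I, neg_smul]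
  rw [← sub_eq_add_neg, ← smul_sub, e]
  rw [show a + b + -(a - b) = (2 : ℂ) • b by rw [two_smul]; abel, smul_smul]
  norm_num

lemma fderiv_eq_wirt (f : ℂ → E) (z : ℂ) : fderiv ℝ f z = wirt (dz f z) (dzbar f z) := by
  have h1 : fderiv ℝ f z 1 = dz f z + dzbar f z := by
    rw [dz, dzbar, ← smul_add, sub_add_add_cancel, ← two_smul ℂ, smul_smul]
    norm_num
  have h2 : fderiv ℝ f z Complex.I = Complex.I • (dz f z - dzbar f z) := by
    rw [dz, dzbar, show ∀ X Y : E, Complex.I • ((1 / 2 : ℂ) • (X - Complex.I • Y)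
      - (1 / 2 : ℂ) • (X + Complex.I • Y)) = -(Complex.I * Complex.I) • Y by intros; module]
    simp
  ext v
  have hv : v = v.re • (1 : ℂ) + v.im • Complex.I := by
    simp
  conv_lhs => rw [hv, map_add, map_smul, map_smul, h1, h2]
  rw [wirt_apply, ← Complex.coe_smul, ← Complex.coe_smul]
  conv_rhs => rw [← Complex.re_add_im v]
  simp only [map_add, map_mul, Complex.conj_ofReal, Complex.conj_I]
  module

lemma hasFDerivAt_wirt {f : ℂ → E} {z : ℂ} (h : DifferentiableAt ℝ f z) :
    HasFDerivAt f (wirt (dz f z) (dzbar f z)) z := by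
  rw [← fderiv_eq_wirt]; exact h.hasFDerivAt

lemma wirt_injective {a b a' b' : E} (h : wirt a b = wirt a' b') : a = a' ∧ b = b' := by
  have h1 : HasFDerivAt (wirt a b) (wirt a b) 0 := (wirt a b).hasFDerivAt
  have h2 : HasFDerivAt (wirt a b) (wirt a' b') 0 := by rw [← h]; exact h1
  exact ⟨(dz_of_hasFDerivAt h1).symm.trans (dz_of_hasFDerivAt h2),
    (dzbar_of_hasFDerivAt h1).symm.trans (dzbar_of_hasFDerivAt h2)⟩

lemma contDiffOn_dz {f : ℂ → E} {U : Set ℂ} (hU : IsOpen U) (h : ContDiffOn ℝ ∞ f U) :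
    ContDiffOn ℝ ∞ (dz f) U := by
  have h1 := ((contDiffOn_infty_iff_fderiv_of_isOpen hU).1 h).2
  exact ((h1.clm_apply contDiffOn_const).sub
    ((h1.clm_apply contDiffOn_const).const_smul Complex.I)).const_smul (1 / 2 : ℂ)

lemma contDiffOn_dzbar {f : ℂ → E} {U : Set ℂ} (hU : IsOpen U) (h : ContDiffOn ℝ ∞ f U) :
    ContDiffOn ℝ ∞ (dzbar f) U := by
  have h1 := ((contDiffOn_infty_iff_fderiv_of_isOpen hU).1 h).2
  exact ((h1.clm_apply contDiffOn_const).add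
    ((h1.clm_apply contDiffOn_const).const_smul Complex.I)).const_smul (1 / 2 : ℂ)

lemma ContDiffOn.hasFDerivAt_wirt {f : ℂ → E} {U : Set ℂ} (hU : IsOpen U)
    (h : ContDiffOn ℝ ∞ f U) {z : ℂ} (hz : z ∈ U) :
    HasFDerivAt f (wirt (dz f z) (dzbar f z)) z :=
  Willmore.hasFDerivAt_wirt
    ((h.contDiffAt (hU.mem_nhds hz)).differentiableAt (by simp))

lemma dz_dzbar_comm {f : ℂ → E} {U : Set ℂ} (hU : IsOpen U) (h : ContDiffOn ℝ ∞ f U) {z : ℂ}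
    (hz : z ∈ U) : dz (dzbar f) z = dzbar (dz f) z := by
  have h1 := ((contDiffOn_infty_iff_fderiv_of_isOpen hU).1 h).2
  have h2 : DifferentiableAt ℝ (fderiv ℝ f) z :=
    (h1.contDiffAt (hU.mem_nhds hz)).differentiableAt (by simp)
  have hs : fderiv ℝ (fderiv ℝ f) z 1 Complex.I = fderiv ℝ (fderiv ℝ f) z Complex.I 1 :=
    (h.contDiffAt (hU.mem_nhds hz))
      |>.isSymmSndFDerivAt (by simpa using ENat.LEInfty.out) 1 Complex.I
  have key : ∀ (c : ℂ) (v : ℂ), fderiv ℝ (fun w => (1 / 2 : ℂ) •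
      (fderiv ℝ f w 1 + c • fderiv ℝ f w Complex.I)) z v = (1 / 2 : ℂ) •
      (fderiv ℝ (fderiv ℝ f) z v 1 + c • fderiv ℝ (fderiv ℝ f) z v Complex.I) := by
    intro c v
    have e : ∀ u : ℂ, HasFDerivAt (fun w => fderiv ℝ f w u)
        ((ContinuousLinearMap.apply ℝ E u).comp (fderiv ℝ (fderiv ℝ f) z)) z := fun u =>
      (ContinuousLinearMap.apply ℝ E u).hasFDerivAt.comp z h2.hasFDerivAt
    have := ((e 1).add ((e Complex.I).const_smul c)).const_smul (1 / 2 : ℂ)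
    have e2 : fderiv ℝ (fun w => (1 / 2 : ℂ) •
      (fderiv ℝ f w 1 + c • fderiv ℝ f w Complex.I)) z = _ := this.fderiv
    rw [e2]
    simp
  have k1 : ∀ v, fderiv ℝ (dzbar f) z v = _ := key Complex.I
  have k2 : ∀ v, fderiv ℝ (dz f) z v = (1 / 2 : ℂ) • (fderiv ℝ (fderiv ℝ f) z v 1 +
      (-Complex.I) • fderiv ℝ (fderiv ℝ f) z v Complex.I) := by
    have e : dz f = fun w => (1 / 2 : ℂ) •
        (fderiv ℝ f w 1 + (-Complex.I) • fderiv ℝ f w Complex.I) := by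
      ext1 w; rw [dz, neg_smul, sub_eq_add_neg]
    rw [e]; exact key (-Complex.I)
  rw [dz, dzbar, k1, k1, k2, k2, hs]
  module

end Wirtinger

section Components

variable {ι : Type*} [Fintype ι]

lemma hasFDerivAt_wirt_pi {f : ℂ → ι → ℂ} {a b : ι → ℂ} {z : ℂ} :
    HasFDerivAt f (wirt a b) z ↔ ∀ i, HasFDerivAt (fun w => f w i) (wirt (a i) (b i)) z := by
  rw [hasFDerivAt_pi']
  refine forall_congr' fun i => ?_
  have : (ContinuousLinearMap.proj i).comp (wirt a b) = (wirt (a i) (b i) : ℂ →L[ℝ] ℂ) := by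
    ext
    simp
  rw [this]

lemma wirt_mul {f g : ℂ → ℂ} {a b a' b' z : ℂ} (hf : HasFDerivAt f (wirt a b) z)
    (hg : HasFDerivAt g (wirt a' b') z) :
    HasFDerivAt (fun w => f w * g w) (wirt (a * g z + f z * a') (b * g z + f z * b')) z := by
  have h := hf.mul hg
  refine h.congr_fderiv ?_
  ext v; simp; ring

lemma wirt_const {E : Type*} [NormedAddCommGroup E] [NormedSpace ℂ E] (c : E) (z : ℂ) :
    HasFDerivAt (fun _ : ℂ => c) (wirt (0 : E) 0) z := by
  refine (hasFDerivAt_const c z).congr_fderiv ?_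
  ext v; simp

lemma wirt_sum {κ : Type*} (s : Finset κ) {f : κ → ℂ → ℂ} {a b : κ → ℂ} {z : ℂ}
    (h : ∀ k ∈ s, HasFDerivAt (f k) (wirt (a k) (b k)) z) :
    HasFDerivAt (fun w => ∑ k ∈ s, f k w) (wirt (∑ k ∈ s, a k) (∑ k ∈ s, b k)) z := by
  refine (HasFDerivAt.fun_sum h).congr_fderiv ?_
  ext v; simp [Finset.sum_add_distrib, Finset.mul_sum]

lemma wirt_star {f : ℂ → ℂ} {a b z : ℂ} (hf : HasFDerivAt f (wirt a b) z) :
    HasFDerivAt (fun w => star (f w)) (wirt (star b) (star a)) z := by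
  refine ((Complex.conjCLE : ℂ →L[ℝ] ℂ).hasFDerivAt.comp z hf).congr_fderiv ?_
  ext v; simp; ring

end Components

/-- The matrix-valued map `M` has the entrywise Wirtinger derivatives `A` and `B` at `z`. -/
def HasWirt {m n : ℕ} (M : ℂ → Matrix (Fin m) (Fin n) ℂ) (A B : Matrix (Fin m) (Fin n) ℂ)
    (z : ℂ) : Prop :=
  ∀ i j, HasFDerivAt (fun w => M w i j) (wirt (A i j) (B i j)) z

section MatrixCalculus

variable {l m n : ℕ} {M : ℂ → Matrix (Fin l) (Fin m) ℂ} {A B : Matrix (Fin l) (Fin m) ℂ} {z : ℂ}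

lemma HasWirt.unique {A' B' : Matrix (Fin l) (Fin m) ℂ} (h : HasWirt M A B z)
    (h' : HasWirt M A' B' z) : A = A' ∧ B = B' := by
  constructor <;> ext i j
  · exact (wirt_injective ((h i j).unique (h' i j))).1
  · exact (wirt_injective ((h i j).unique (h' i j))).2

lemma HasWirt.congr {M' : ℂ → Matrix (Fin l) (Fin m) ℂ} (h : HasWirt M A B z)
    (e : M' =ᶠ[𝓝 z] M) : HasWirt M' A B z := fun i j =>
  (h i j).congr_of_eventuallyEq (e.mono fun w hw => by simp only [hw])

lemma HasWirt.mul {N : ℂ → Matrix (Fin m) (Fin n) ℂ} {A' B' : Matrix (Fin m) (Fin n) ℂ}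
    (h : HasWirt M A B z) (h' : HasWirt N A' B' z) :
    HasWirt (fun w => M w * N w) (A * N z + M z * A') (B * N z + M z * B') z := by
  intro i j
  simp only [Matrix.mul_apply, Matrix.add_apply, ← Finset.sum_add_distrib]
  exact wirt_sum _ fun k _ => wirt_mul (h i k) (h' k j)

lemma HasWirt.const (C : Matrix (Fin l) (Fin m) ℂ) (z : ℂ) : HasWirt (fun _ => C) 0 0 z :=
  fun i j => wirt_const (C i j) z

lemma HasWirt.const_mul (C : Matrix (Fin n) (Fin l) ℂ) (h : HasWirt M A B z) :
    HasWirt (fun w => C * M w) (C * A) (C * B) z := by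
  simpa using (HasWirt.const C z).mul h

lemma HasWirt.mul_const (h : HasWirt M A B z) (C : Matrix (Fin m) (Fin n) ℂ) :
    HasWirt (fun w => M w * C) (A * C) (B * C) z := by
  simpa using h.mul (HasWirt.const C z)

lemma HasWirt.transpose (h : HasWirt M A B z) : HasWirt (fun w => (M w)ᵀ) Aᵀ Bᵀ z :=
  fun i j => h j i

lemma HasWirt.map_star (h : HasWirt M A B z) :
    HasWirt (fun w => (M w).map star) (B.map star) (A.map star) z :=
  fun i j => wirt_star (h i j)

lemma HasWirt.conjTranspose (h : HasWirt M A B z) :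
    HasWirt (fun w => (M w)ᴴ) Bᴴ Aᴴ z := fun i j => wirt_star (h j i)

lemma HasWirt.mulVec {v : ℂ → Fin m → ℂ} {a b : Fin m → ℂ} (h : HasWirt M A B z)
    (hv : HasFDerivAt v (wirt a b) z) :
    HasFDerivAt (fun w => M w *ᵥ v w) (wirt (A *ᵥ v z + M z *ᵥ a) (B *ᵥ v z + M z *ᵥ b)) z := by
  rw [hasFDerivAt_wirt_pi] at hv ⊢
  intro i
  simp only [Matrix.mulVec, dotProduct, Pi.add_apply, ← Finset.sum_add_distrib]
  exact wirt_sum _ fun k _ => wirt_mul (h i k) (hv k)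

lemma hasWirt_of_contDiffOn {M : ℂ → Mat} {U : Set ℂ} (hU : IsOpen U)
    (h : ∀ i j, ContDiffOn ℝ ∞ (fun w => M w i j) U) (hz : z ∈ U) :
    HasWirt M (Willmore.matDz M z) (Willmore.matDzbar M z) z := fun i j =>
  ContDiffOn.hasFDerivAt_wirt hU (h i j) hz

end MatrixCalculus

section Lorentz

lemma lor_add_left (x x' y : Vec) : lor (x + x') y = lor x y + lor x' y := by
  simp only [lor, Pi.add_apply, add_mul, Finset.sum_add_distrib]; ring

lemma lor_smul_left (c : ℂ) (x y : Vec) : lor (c • x) y = c * lor x y := by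
  simp only [lor, Pi.smul_apply, smul_eq_mul, mul_add, Finset.mul_sum, mul_assoc, mul_neg]

lemma lor_comm (x y : Vec) : lor x y = lor y x := by
  simp only [lor, mul_comm]

lemma lor_add_right (x y y' : Vec) : lor x (y + y') = lor x y + lor x y' := by
  rw [lor_comm, lor_add_left, lor_comm y, lor_comm y']

lemma lor_smul_right (c : ℂ) (x y : Vec) : lor x (c • y) = c * lor x y := by
  rw [lor_comm, lor_smul_left, lor_comm]

lemma lor_sub_left (x x' y : Vec) : lor (x - x') y = lor x y - lor x' y := by
  rw [sub_eq_add_neg, ← neg_one_smul ℂ, lor_add_left, lor_smul_left]; ring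

lemma lor_sub_right (x y y' : Vec) : lor x (y - y') = lor x y - lor x y' := by
  rw [lor_comm, lor_sub_left, lor_comm y, lor_comm y']

@[simp] lemma lor_zero_left (y : Vec) : lor 0 y = 0 := by simp [lor]

@[simp] lemma lor_zero_right (y : Vec) : lor y 0 = 0 := by simp [lor]

lemma lor_eq_dotProduct (x y : Vec) : lor x y = x ⬝ᵥ (I17 *ᵥ y) := by
  simp [lor, I17, dotProduct, Matrix.mulVec_diagonal, Fin.sum_univ_succ]

lemma wirt_lor {f g : ℂ → Vec} {a b a' b' : Vec} {z : ℂ} (hf : HasFDerivAt f (wirt a b) z)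
    (hg : HasFDerivAt g (wirt a' b') z) :
    HasFDerivAt (fun w => lor (f w) (g w))
      (wirt (lor a (g z) + lor (f z) a') (lor b (g z) + lor (f z) b')) z := by
  have hg' : HasFDerivAt (fun w => I17 *ᵥ g w) (wirt (I17 *ᵥ a') (I17 *ᵥ b')) z := by
    simpa using (HasWirt.const I17 z).mulVec hg
  rw [hasFDerivAt_wirt_pi] at hf hg'
  simp only [lor_eq_dotProduct, dotProduct, ← Finset.sum_add_distrib]
  exact wirt_sum _ fun i _ => wirt_mul (hf i) (hg' i)

lemma contDiffOn_lor {f g : ℂ → Vec} {U : Set ℂ} (hf : ContDiffOn ℝ ∞ f U)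
    (hg : ContDiffOn ℝ ∞ g U) : ContDiffOn ℝ ∞ (fun z => lor (f z) (g z)) U := by
  rw [contDiffOn_pi] at hf hg
  exact ((hf 0).mul (hg 0)).neg.add (ContDiffOn.sum fun i _ => (hf i.succ).mul (hg i.succ))

end Lorentz

/-! ### The canonical lift and the normal projection -/

section Lift

variable {D : Set ℂ} {y : ℂ → EuclideanSpace ℝ (Fin 7)} {z : ℂ}

lemma contDiffOn_complexify (h : IsConformalImmersion D y) :
    ContDiffOn ℝ ∞ (complexify y) D := by
  rw [contDiffOn_pi]
  intro i
  have h1 : ContDiffOn ℝ ∞ (fun w => y w i) D :=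
    (EuclideanSpace.proj (𝕜 := ℝ) i).contDiff.comp_contDiffOn h.smooth
  exact Complex.ofRealCLM.contDiff.comp_contDiffOn h1

lemma fderiv_complexify (h : DifferentiableAt ℝ y z) (v : ℂ) (i : Fin 7) :
    fderiv ℝ (complexify y) z v i = ((fderiv ℝ y z v i : ℝ) : ℂ) := by
  have h1 : ∀ i, HasFDerivAt (fun w => complexify y w i)
      (Complex.ofRealCLM.comp ((EuclideanSpace.proj (𝕜 := ℝ) i).comp (fderiv ℝ y z))) z :=
    fun i => Complex.ofRealCLM.hasFDerivAt.comp z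
      ((EuclideanSpace.proj (𝕜 := ℝ) i).hasFDerivAt.comp z h.hasFDerivAt)
  have h2 := (hasFDerivAt_pi.2 h1).fderiv
  have h3 : fderiv ℝ (complexify y) z = _ := h2
  rw [h3]
  simp

lemma dotProduct_ofReal (a b : EuclideanSpace ℝ (Fin 7)) :
    (fun i => (a i : ℂ)) ⬝ᵥ (fun i => (b i : ℂ)) = ((inner ℝ a b : ℝ) : ℂ) := by
  simp [dotProduct, PiLp.inner_apply, mul_comm]

/-- For a conformal immersion the real derivatives `y_u`, `y_v` are orthogonal and of the same
positive length; in complex terms `⟨y_z, y_z⟩ = 0 < ⟨y_z, y_z̄⟩`. -/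
lemma conformal_dotProducts (h : IsConformalImmersion D y) (hz : z ∈ D) :
    dz (complexify y) z ⬝ᵥ dz (complexify y) z = 0 ∧
    dzbar (complexify y) z ⬝ᵥ dzbar (complexify y) z = 0 ∧
    0 < expTwoOmega y z ∧
    dz (complexify y) z ⬝ᵥ dzbar (complexify y) z = (expTwoOmega y z / 2 : ℝ) := by
  obtain ⟨f', hf, c, hc, li, rfl⟩ := h.conformal z hz
  have hv : ∀ v, fderiv ℝ (complexify y) z v = fun i => (((c • li v) i : ℝ) : ℂ) := by
    intro v; ext i; rw [fderiv_complexify hf.differentiableAt, hf.fderiv]; rfl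
  have hin : ∀ v w, (fderiv ℝ (complexify y) z v) ⬝ᵥ (fderiv ℝ (complexify y) z w)
      = ((c * c * inner ℝ v w : ℝ) : ℂ) := by
    intro v w
    rw [hv, hv, dotProduct_ofReal, inner_smul_left, inner_smul_right, li.inner_map_map]
    simp [mul_assoc]
  have h11 := hin 1 1
  have h1I := hin 1 Complex.I
  have hI1 := hin Complex.I 1
  have hII := hin Complex.I Complex.I
  simp [Complex.inner] at h11 h1I hI1 hII
  have e : dz (complexify y) z ⬝ᵥ dzbar (complexify y) z = ((c * c / 2 : ℝ) : ℂ) := by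
    simp only [dz, dzbar, smul_dotProduct, dotProduct_smul, sub_dotProduct, dotProduct_add,
      h11, h1I, hI1, hII, smul_eq_mul]
    push_cast
    linear_combination (-(c : ℂ) * c / 4) * Complex.I_mul_I
  have e' : expTwoOmega y z = c * c := by
    rw [expTwoOmega, e, ← Complex.ofReal_ofNat, ← Complex.ofReal_mul, Complex.ofReal_re]; ring
  refine ⟨?_, ?_, ?_, ?_⟩
  · simp only [dz, smul_dotProduct, dotProduct_smul, sub_dotProduct, dotProduct_sub,
      h11, h1I, hI1, hII, smul_eq_mul]
    linear_combination ((c : ℂ) * c / 4) * Complex.I_mul_I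
  · simp only [dzbar, smul_dotProduct, dotProduct_smul, add_dotProduct, dotProduct_add,
      h11, h1I, hI1, hII, smul_eq_mul]
    linear_combination ((c : ℂ) * c / 4) * Complex.I_mul_I
  · rw [e']; exact mul_self_pos.2 hc
  · rw [e, e']

lemma contDiffOn_expTwoOmega (hD : IsOpen D) (h : IsConformalImmersion D y) :
    ContDiffOn ℝ ∞ (expTwoOmega y) D := by
  have h1 := contDiffOn_pi.1 (contDiffOn_dz hD (contDiffOn_complexify h))
  have h2 := contDiffOn_pi.1 (contDiffOn_dzbar hD (contDiffOn_complexify h))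
  have h3 : ContDiffOn ℝ ∞ (fun z => 2 * (dz (complexify y) z ⬝ᵥ dzbar (complexify y) z)) D :=
    contDiffOn_const.mul (ContDiffOn.sum fun i _ => (h1 i).mul (h2 i))
  exact Complex.reCLM.contDiff.comp_contDiffOn h3

/-- The conformal factor `e^{-ω}`, as a complex number. -/
def conformalFactor (y : ℂ → EuclideanSpace ℝ (Fin 7)) (z : ℂ) : ℂ :=
  (((Real.sqrt (expTwoOmega y z))⁻¹ : ℝ) : ℂ)

lemma contDiffOn_conformalFactor (hD : IsOpen D) (h : IsConformalImmersion D y) :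
    ContDiffOn ℝ ∞ (conformalFactor y) D := by
  have hpos : ∀ z ∈ D, 0 < expTwoOmega y z := fun z hz => (conformal_dotProducts h hz).2.2.1
  have h1 : ContDiffOn ℝ ∞ (fun z => (Real.sqrt (expTwoOmega y z))⁻¹) D :=
    ((contDiffOn_expTwoOmega hD h).sqrt fun z hz => (hpos z hz).ne').inv
      fun z hz => (Real.sqrt_pos.2 (hpos z hz)).ne'
  exact Complex.ofRealCLM.contDiff.comp_contDiffOn h1

lemma conformalFactor_sq (h : IsConformalImmersion D y) (hz : z ∈ D) :
    conformalFactor y z * conformalFactor y z * (expTwoOmega y z : ℂ) = 1 := by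
  have hpos : 0 < expTwoOmega y z := (conformal_dotProducts h hz).2.2.1
  rw [conformalFactor, ← Complex.ofReal_mul, ← Complex.ofReal_mul, ← mul_inv,
    Real.mul_self_sqrt hpos.le, inv_mul_cancel₀ hpos.ne', Complex.ofReal_one]

/-- The vector `(a, f)`. -/
def consVec (a : ℂ) (f : Fin 7 → ℂ) : Vec := Fin.cons a f

lemma lift_eq (y : ℂ → EuclideanSpace ℝ (Fin 7)) (z : ℂ) :
    lift y z = conformalFactor y z • consVec 1 (complexify y z) := rfl

lemma lor_cons (a b : ℂ) (f g : Fin 7 → ℂ) :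
    lor (consVec a f) (consVec b g) = -(a * b) + f ⬝ᵥ g := by
  simp [lor, dotProduct, consVec]

lemma hasFDerivAt_lift (hD : IsOpen D) (h : IsConformalImmersion D y) (hz : z ∈ D) :
    HasFDerivAt (lift y) (wirt
      (dz (conformalFactor y) z • (consVec 1 (complexify y z))
        + conformalFactor y z • consVec 0 (dz (complexify y) z))
      (dzbar (conformalFactor y) z • (consVec 1 (complexify y z))
        + conformalFactor y z • consVec 0 (dzbar (complexify y) z))) z := by
  have h1 := ContDiffOn.hasFDerivAt_wirt hD (contDiffOn_conformalFactor hD h) hz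
  have h2 := hasFDerivAt_wirt_pi.1
    (ContDiffOn.hasFDerivAt_wirt hD (contDiffOn_complexify h) hz)
  rw [hasFDerivAt_wirt_pi]
  intro i
  refine wirt_mul h1 (g := fun w => (consVec 1 (complexify y w)) i) ?_
  refine Fin.cases ?_ (fun j => ?_) i
  · simpa [consVec] using wirt_const (1 : ℂ) z
  · simpa [consVec] using h2 j

lemma contDiffOn_lift (hD : IsOpen D) (h : IsConformalImmersion D y) :
    ContDiffOn ℝ ∞ (lift y) D := by
  rw [contDiffOn_pi]
  intro i
  refine (contDiffOn_conformalFactor hD h).mul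
    (g := fun w => (consVec 1 (complexify y w)) i) ?_
  refine Fin.cases ?_ (fun j => ?_) i
  · simpa [consVec] using contDiffOn_const
  · simpa [consVec] using contDiffOn_pi.1 (contDiffOn_complexify h) j

lemma complexify_dotProduct_self (h : IsConformalImmersion D y) (hz : z ∈ D) :
    complexify y z ⬝ᵥ complexify y z = 1 := by
  have h1 : complexify y z = fun i => ((y z i : ℝ) : ℂ) := rfl
  have h2 : ‖y z‖ = 1 := by simpa using h.mem_sphere z hz
  rw [h1, dotProduct_ofReal, real_inner_self_eq_norm_sq, h2]
  simp

lemma complexify_dotProduct_deriv (hD : IsOpen D) (h : IsConformalImmersion D y) (hz : z ∈ D) :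
    complexify y z ⬝ᵥ dz (complexify y) z = 0 ∧
      complexify y z ⬝ᵥ dzbar (complexify y) z = 0 := by
  have h1 := hasFDerivAt_wirt_pi.1
    (ContDiffOn.hasFDerivAt_wirt hD (contDiffOn_complexify h) hz)
  have h2 := wirt_sum Finset.univ fun i _ => wirt_mul (h1 i) (h1 i)
  have h3 : (fun w => ∑ i, complexify y w i * complexify y w i) =ᶠ[𝓝 z] fun _ => (1 : ℂ) :=
    (hD.mem_nhds hz |> Filter.eventually_of_mem) fun w hw => complexify_dotProduct_self h hw
  obtain ⟨h4, h5⟩ := wirt_injective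
    (h2.unique ((wirt_const (1 : ℂ) z).congr_of_eventuallyEq h3))
  have h6 : ∀ a : Fin 7 → ℂ, ∑ i, (a i * complexify y z i + complexify y z i * a i)
      = 2 * (complexify y z ⬝ᵥ a) := fun a => by
    rw [dotProduct, Finset.mul_sum]
    exact Finset.sum_congr rfl fun i _ => by ring
  rw [h6] at h4 h5
  exact ⟨by simpa using h4, by simpa using h5⟩

lemma lor_lift_lift (h : IsConformalImmersion D y) (hz : z ∈ D) :
    lor (lift y z) (lift y z) = 0 := by
  rw [lift_eq, lor_smul_left, lor_smul_right, lor_cons, complexify_dotProduct_self h hz]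
  ring

/-- The canonical lift is normalized by `⟨Y_z, Y_z⟩ = 0` and `⟨Y_z, Y_z̄⟩ = 1/2`. -/
lemma lor_deriv_lift (hD : IsOpen D) (h : IsConformalImmersion D y) (hz : z ∈ D) :
    lor (dz (lift y) z) (dz (lift y) z) = 0 ∧
    lor (dzbar (lift y) z) (dzbar (lift y) z) = 0 ∧
    lor (dz (lift y) z) (dzbar (lift y) z) = 1 / 2 := by
  have h1 := hasFDerivAt_lift hD h hz
  obtain ⟨h2, h3, -, h4⟩ := conformal_dotProducts h hz
  obtain ⟨h5, h6⟩ := complexify_dotProduct_deriv hD h hz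
  have h8 : dz (complexify y) z ⬝ᵥ complexify y z = 0 := by rw [dotProduct_comm, h5]
  have h9 : dzbar (complexify y) z ⬝ᵥ complexify y z = 0 := by rw [dotProduct_comm, h6]
  have h7 := complexify_dotProduct_self h hz
  rw [dz_of_hasFDerivAt h1, dzbar_of_hasFDerivAt h1]
  simp only [lor_add_left, lor_add_right, lor_smul_left, lor_smul_right, lor_cons, h2, h3, h4,
    h5, h6, h7, h8, h9]
  refine ⟨by ring, by ring, ?_⟩
  push_cast
  linear_combination (1 / 2) * conformalFactor_sq h hz

/-- The product rule for two maps whose inner product is constant. -/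
lemma lor_const_deriv {U : Set ℂ} (hU : IsOpen U) {f g : ℂ → Vec} (hf : ContDiffOn ℝ ∞ f U)
    (hg : ContDiffOn ℝ ∞ g U) {c : ℂ} (hc : ∀ w ∈ U, lor (f w) (g w) = c) (hz : z ∈ U) :
    lor (dz f z) (g z) + lor (f z) (dz g z) = 0 ∧
      lor (dzbar f z) (g z) + lor (f z) (dzbar g z) = 0 := by
  have h1 := wirt_lor (ContDiffOn.hasFDerivAt_wirt hU hf hz)
    (ContDiffOn.hasFDerivAt_wirt hU hg hz)
  have h2 : (fun w => lor (f w) (g w)) =ᶠ[𝓝 z] fun _ => c :=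
    Filter.eventually_of_mem (hU.mem_nhds hz) hc
  exact wirt_injective (h1.unique ((wirt_const c z).congr_of_eventuallyEq h2))

/-- The inner products of `Y, Y_z, Y_z̄, Y_zz̄, Y_zz`. In the field names, `z` and `b` stand for the
derivatives with respect to `z` and `z̄`. -/
structure LiftProducts (y : ℂ → EuclideanSpace ℝ (Fin 7)) (z : ℂ) : Prop where
  YY : lor (lift y z) (lift y z) = 0
  YYz : lor (lift y z) (dz (lift y) z) = 0
  YYb : lor (lift y z) (dzbar (lift y) z) = 0
  YYzb : lor (lift y z) (dzbar (dz (lift y)) z) = -(1 / 2)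
  YzYz : lor (dz (lift y) z) (dz (lift y) z) = 0
  YzYb : lor (dz (lift y) z) (dzbar (lift y) z) = 1 / 2
  YbYb : lor (dzbar (lift y) z) (dzbar (lift y) z) = 0
  YzYzb : lor (dz (lift y) z) (dzbar (dz (lift y)) z) = 0
  YbYzb : lor (dzbar (lift y) z) (dzbar (dz (lift y)) z) = 0
  YYzz : lor (lift y z) (dz (dz (lift y)) z) = 0
  YzYzz : lor (dz (lift y) z) (dz (dz (lift y)) z) = 0
  YbYzz : lor (dzbar (lift y) z) (dz (dz (lift y)) z) = 0

lemma liftProducts (hD : IsOpen D) (h : IsConformalImmersion D y) (hz : z ∈ D) :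
    LiftProducts y z := by
  have c0 := contDiffOn_lift hD h
  have c1 := contDiffOn_dz hD c0
  have c2 := contDiffOn_dzbar hD c0
  have a : ∀ w ∈ D, lor (lift y w) (dz (lift y) w) = 0 ∧ lor (lift y w) (dzbar (lift y) w) = 0 := by
    intro w hw
    obtain ⟨h1, h2⟩ := lor_const_deriv hD c0 c0 (fun w hw => lor_lift_lift h hw) hw
    rw [lor_comm] at h1 h2
    exact ⟨by linear_combination h1 / 2, by linear_combination h2 / 2⟩
  obtain ⟨b1, b2, b3⟩ := lor_deriv_lift hD h hz
  have e1 := lor_const_deriv hD c0 c1 (fun w hw => (a w hw).1) hz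
  have e2 := lor_const_deriv hD c1 c1 (fun w hw => (lor_deriv_lift hD h hw).1) hz
  have e3 := lor_const_deriv hD c2 c2 (fun w hw => (lor_deriv_lift hD h hw).2.1) hz
  have e4 := lor_const_deriv hD c1 c2 (fun w hw => (lor_deriv_lift hD h hw).2.2) hz
  rw [dz_dzbar_comm hD c0 hz] at e3 e4
  have f1 := lor_comm (dzbar (lift y) z) (dz (lift y) z)
  have f2 := lor_comm (dzbar (dz (lift y)) z) (dz (lift y) z)
  have f3 := lor_comm (dzbar (dz (lift y)) z) (dzbar (lift y) z)
  have f4 := lor_comm (dz (dz (lift y)) z) (dz (lift y) z)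
  have f5 := lor_comm (dz (dz (lift y)) z) (dzbar (lift y) z)
  have g1 : lor (dz (lift y) z) (dzbar (dz (lift y)) z) = 0 := by
    linear_combination e2.2 / 2 - f2 / 2
  exact ⟨lor_lift_lift h hz, (a z hz).1, (a z hz).2, by linear_combination e1.2 - f1 - b3, b1, b3,
    b2, g1, by linear_combination e3.1 / 2 - f3 / 2, by linear_combination e1.1 - b1,
    by linear_combination e2.1 / 2 - f4 / 2, by linear_combination e4.1 - f5 - g1⟩

end Lift

section NormalPart

variable {y : ℂ → EuclideanSpace ℝ (Fin 7)} {z : ℂ}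

lemma normalPart_add (X X' : Vec) :
    normalPart y z (X + X') = normalPart y z X + normalPart y z X' := by
  simp only [normalPart, lor_add_left]; module

lemma normalPart_smul (c : ℂ) (X : Vec) :
    normalPart y z (c • X) = c • normalPart y z X := by
  simp only [normalPart, lor_smul_left]; module

lemma normalPart_eq_zero (h : LiftProducts y z) {X : Vec} (hX : X ∈ bundleV y z) :
    normalPart y z X = 0 := by
  obtain ⟨h1, h2, h3, h4, h5, h6, h7, h8, h9, -, -, -⟩ := h
  have k2 := lor_comm (dz (lift y) z) (lift y z)
  have k3 := lor_comm (dzbar (lift y) z) (lift y z)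
  have k4 := lor_comm (dzbar (dz (lift y)) z) (lift y z)
  have k6 := lor_comm (dzbar (lift y) z) (dz (lift y) z)
  have k8 := lor_comm (dzbar (dz (lift y)) z) (dz (lift y) z)
  have k9 := lor_comm (dzbar (dz (lift y)) z) (dzbar (lift y) z)
  rw [h2] at k2; rw [h3] at k3; rw [h4] at k4; rw [h6] at k6; rw [h8] at k8; rw [h9] at k9
  induction hX using Submodule.span_induction with
  | mem x hx =>
    simp only [Set.mem_insert_iff, Set.mem_singleton_iff] at hx
    rcases hx with rfl | rfl | rfl | rfl <;>
      simp only [normalPart, vecN, lor_add_right, lor_smul_right, h1, h2, h3, h4, h5, h6, h7, h8,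
        h9, k2, k3, k4, k6, k8, k9] <;> module
  | zero => simp [normalPart]
  | add x x' _ _ hx hx' => rw [normalPart_add, hx, hx', add_zero]
  | smul c x _ hx => rw [normalPart_smul, hx, smul_zero]

lemma lift_mem_bundleV : lift y z ∈ bundleV y z := Submodule.subset_span (by simp)
lemma dz_lift_mem_bundleV : dz (lift y) z ∈ bundleV y z := Submodule.subset_span (by simp)
lemma dzbar_lift_mem_bundleV : dzbar (lift y) z ∈ bundleV y z := Submodule.subset_span (by simp)
lemma dzbar_dz_lift_mem_bundleV : dzbar (dz (lift y)) z ∈ bundleV y z :=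
  Submodule.subset_span (by simp)

lemma vecN_mem_bundleV : vecN y z ∈ bundleV y z :=
  Submodule.add_mem _ (Submodule.smul_mem _ _ dzbar_dz_lift_mem_bundleV)
    (Submodule.smul_mem _ _ lift_mem_bundleV)

lemma normalPart_eq_self {X : Vec} (hX : ∀ v ∈ bundleV y z, lor X v = 0) :
    normalPart y z X = X := by
  simp [normalPart, hX _ lift_mem_bundleV, hX _ dz_lift_mem_bundleV, hX _ dzbar_lift_mem_bundleV,
    hX _ vecN_mem_bundleV]

/-- The structure equation `Y_zz = -(s/2) Y + κ`. -/
lemma dz_dz_lift (h : LiftProducts y z) :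
    dz (dz (lift y)) z = (-(schwarzian y z / 2)) • lift y z + kappa y z := by
  have h1 := lor_comm (dz (dz (lift y)) z) (lift y z)
  have h2 := lor_comm (dz (dz (lift y)) z) (dz (lift y) z)
  have h3 := lor_comm (dz (dz (lift y)) z) (dzbar (lift y) z)
  rw [h.YYzz] at h1; rw [h.YzYzz] at h2; rw [h.YbYzz] at h3
  rw [kappa, normalPart, schwarzian, h1, h2, h3]
  module

lemma contDiffOn_kappa {D : Set ℂ} (hD : IsOpen D) (h : IsConformalImmersion D y) :
    ContDiffOn ℝ ∞ (kappa y) D := by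
  have c0 := contDiffOn_lift hD h
  have c1 := contDiffOn_dz hD c0
  have c2 := contDiffOn_dzbar hD c0
  have c11 := contDiffOn_dz hD c1
  have c12 := contDiffOn_dzbar hD c1
  have cN : ContDiffOn ℝ ∞ (vecN y) D :=
    (c12.const_smul (2 : ℂ)).add ((contDiffOn_const.mul (contDiffOn_lor c12 c12)).smul c0)
  exact (((c11.add ((contDiffOn_lor c11 cN).smul c0)).add ((contDiffOn_lor c11 c0).smul cN)).sub
    ((contDiffOn_const.mul (contDiffOn_lor c11 c2)).smul c1)).sub
    ((contDiffOn_const.mul (contDiffOn_lor c11 c1)).smul c2)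

end NormalPart

/-! ### Frames and the Maurer-Cartan form -/

/-- The coordinate projection of `ℂ⁸` to the last four coordinates (the normal directions of a
frame). -/
def qN : Mat := Matrix.diagonal fun i => if (i : ℕ) < 4 then 0 else 1

/-- The coordinate projection of `ℂ⁸` to the first four coordinates (the directions of `V`). -/
def qV : Mat := Matrix.diagonal fun i => if (i : ℕ) < 4 then 1 else 0

section Projections

lemma qN_add_qV : qN + qV = 1 := by
  rw [qN, qV, Matrix.diagonal_add, ← Matrix.diagonal_one]
  congr 1; ext i; split_ifs <;> simp

@[simp] lemma qN_mul_qN : qN * qN = qN := by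
  rw [qN, Matrix.diagonal_mul_diagonal]
  congr 1; ext i; split_ifs <;> simp

@[simp] lemma qN_mul_qV : qN * qV = 0 := by
  rw [qN, qV, Matrix.diagonal_mul_diagonal, ← Matrix.diagonal_zero]
  congr 1; ext i; split_ifs <;> simp

@[simp] lemma qV_mul_qN : qV * qN = 0 := by
  rw [qN, qV, Matrix.diagonal_mul_diagonal, ← Matrix.diagonal_zero]
  congr 1; ext i; split_ifs <;> simp

@[simp] lemma I17_mul_I17 : I17 * I17 = 1 := by
  rw [I17, Matrix.diagonal_mul_diagonal, ← Matrix.diagonal_one]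
  congr 1; ext i; split_ifs <;> simp

@[simp] lemma qN_mul_I17 : qN * I17 = qN := by
  rw [qN, I17, Matrix.diagonal_mul_diagonal]
  congr 1; ext i; fin_cases i <;> simp

@[simp] lemma I17_mul_qN : I17 * qN = qN := by
  rw [qN, I17, Matrix.diagonal_mul_diagonal]
  congr 1; ext i; fin_cases i <;> simp

lemma I17_mul_qV : I17 * qV = qV * I17 := by
  rw [qV, I17, Matrix.diagonal_mul_diagonal, Matrix.diagonal_mul_diagonal]
  congr 1; ext i; ring

@[simp] lemma qN_transpose : qNᵀ = qN := Matrix.diagonal_transpose _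
@[simp] lemma qV_transpose : qVᵀ = qV := Matrix.diagonal_transpose _
@[simp] lemma I17_transpose : I17ᵀ = I17 := Matrix.diagonal_transpose _

@[simp] lemma qN_conjTranspose : qNᴴ = qN := by
  rw [qN, Matrix.diagonal_conjTranspose]; congr 1; ext i
  simp only [Pi.star_apply]; split_ifs <;> simp

lemma trace_qN : qN.trace = 4 := by
  simp [qN, Matrix.trace, Fin.sum_univ_succ]; norm_num

lemma kPart_eq (A : Mat) : kPart A = qN * A * qN + qV * A * qV := by
  ext i j
  simp only [kPart, sigmaD, qN, qV, Matrix.smul_apply, Matrix.add_apply, Matrix.mul_diagonal,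
    Matrix.diagonal_mul, smul_eq_mul]
  split_ifs <;> ring

lemma pPart_eq (A : Mat) : pPart A = qN * A * qV + qV * A * qN := by
  ext i j
  simp only [pPart, sigmaD, qN, qV, Matrix.smul_apply, Matrix.add_apply, Matrix.sub_apply,
    Matrix.mul_diagonal, Matrix.diagonal_mul, smul_eq_mul]
  split_ifs <;> ring

end Projections

section Group

variable {A B : Mat}

lemma groupC_left_inv (h : A ∈ groupC) : I17 * Aᵀ * I17 * A = 1 := by
  have := h.1
  calc I17 * Aᵀ * I17 * A = I17 * (Aᵀ * I17 * A) := by simp only [mul_assoc]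
    _ = 1 := by rw [this, I17_mul_I17]

lemma groupC_inv (h : A ∈ groupC) : A⁻¹ = I17 * Aᵀ * I17 :=
  Matrix.inv_eq_left_inv (groupC_left_inv h)

lemma groupC_mul_inv (h : A ∈ groupC) : A * A⁻¹ = 1 :=
  Matrix.mul_nonsing_inv _ (by rw [h.2]; exact isUnit_one)

lemma groupC_inv_mul (h : A ∈ groupC) : A⁻¹ * A = 1 :=
  Matrix.nonsing_inv_mul _ (by rw [h.2]; exact isUnit_one)

lemma lor_mulVec (h : A ∈ groupC) (x x' : Vec) : lor (A *ᵥ x) (A *ᵥ x') = lor x x' := by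
  rw [lor_eq_dotProduct, lor_eq_dotProduct, ← Matrix.vecMul_transpose,
    ← Matrix.dotProduct_mulVec, Matrix.mulVec_mulVec, Matrix.mulVec_mulVec, h.1]

lemma groupC_mul (hA : A ∈ groupC) (hB : B ∈ groupC) : A * B ∈ groupC := by
  refine ⟨?_, by rw [Matrix.det_mul, hA.2, hB.2, one_mul]⟩
  rw [Matrix.transpose_mul]
  calc Bᵀ * Aᵀ * I17 * (A * B) = Bᵀ * (Aᵀ * I17 * A) * B := by simp only [mul_assoc]
    _ = I17 := by rw [hA.1, hB.1]

lemma groupC_inv_mem (hA : A ∈ groupC) : A⁻¹ ∈ groupC := by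
  refine ⟨?_, by rw [Matrix.det_nonsing_inv, hA.2, Ring.inverse_one]⟩
  have h1 := groupC_mul_inv hA
  have h2 : A⁻¹ᵀ * Aᵀ = 1 := by rw [← Matrix.transpose_mul, h1, Matrix.transpose_one]
  calc A⁻¹ᵀ * I17 * A⁻¹ = A⁻¹ᵀ * (Aᵀ * I17 * A) * A⁻¹ := by rw [hA.1]
    _ = (A⁻¹ᵀ * Aᵀ) * I17 * (A * A⁻¹) := by simp only [mul_assoc]
    _ = I17 := by rw [h1, h2, one_mul, mul_one]

end Group

/-- The `dz`-coefficient `F⁻¹ F_z` of the Maurer-Cartan form. -/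
def mcZ (F : ℂ → Mat) (z : ℂ) : Mat := (F z)⁻¹ * matDz F z

/-- The `dz̄`-coefficient `F⁻¹ F_z̄` of the Maurer-Cartan form. -/
def mcB (F : ℂ → Mat) (z : ℂ) : Mat := (F z)⁻¹ * matDzbar F z

section Frame

variable {D : Set ℂ} {y : ℂ → EuclideanSpace ℝ (Fin 7)} {F : ℂ → Mat} {z : ℂ}

lemma IsFrame.groupC (h : IsFrame D y F) (hz : z ∈ D) : F z ∈ Willmore.groupC :=
  (h.mem_group z hz).1

lemma IsFrame.hasWirt (hD : IsOpen D) (h : IsFrame D y F) (hz : z ∈ D) :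
    HasWirt F (F z * mcZ F z) (F z * mcB F z) z := by
  rw [mcZ, mcB, ← mul_assoc, ← mul_assoc, groupC_mul_inv (h.groupC hz), one_mul, one_mul]
  exact hasWirt_of_contDiffOn hD h.smooth hz

/-- The Maurer-Cartan form takes values in `𝔰𝔬(1,7,ℂ)`. -/
lemma IsFrame.mc_skew (hD : IsOpen D) (h : IsFrame D y F) (hz : z ∈ D) :
    (mcZ F z)ᵀ * I17 + I17 * mcZ F z = 0 ∧ (mcB F z)ᵀ * I17 + I17 * mcB F z = 0 := by
  have h1 := h.hasWirt hD hz
  have h2 := (h1.transpose.mul_const I17).mul h1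
  have h3 : (fun w => (F w)ᵀ * I17 * F w) =ᶠ[𝓝 z] fun _ => I17 :=
    Filter.eventually_of_mem (hD.mem_nhds hz) fun w hw => (h.groupC hw).1
  obtain ⟨h4, h5⟩ := h2.unique ((HasWirt.const I17 z).congr h3)
  have h6 := (h.groupC hz).1
  have key : ∀ A : Mat, (F z * A)ᵀ * I17 * F z + (F z)ᵀ * I17 * (F z * A)
      = Aᵀ * I17 + I17 * A := fun A => by
    rw [Matrix.transpose_mul]
    calc _ = Aᵀ * ((F z)ᵀ * I17 * F z) + ((F z)ᵀ * I17 * F z) * A := by simp only [mul_assoc]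
      _ = _ := by rw [h6]
  rw [key] at h4 h5
  exact ⟨h4, h5⟩

lemma transpose_eq_of_skew {A : Mat} (h : Aᵀ * I17 + I17 * A = 0) : Aᵀ = -(I17 * A * I17) := by
  have h1 : Aᵀ * I17 = -(I17 * A) := eq_neg_of_add_eq_zero_left h
  calc Aᵀ = Aᵀ * I17 * I17 := by rw [mul_assoc, I17_mul_I17, mul_one]
    _ = _ := by rw [h1, neg_mul]

lemma I17_map_star : I17.map star = I17 := by
  rw [I17, Matrix.diagonal_map (by simp)]; congr 1; ext i
  split_ifs <;> simp

lemma map_star_mul (A B : Mat) : (A * B).map star = A.map star * B.map star := by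
  ext i j; simp [Matrix.mul_apply]

lemma IsFrame.mc_conj (hD : IsOpen D) (h : IsFrame D y F) (hz : z ∈ D) :
    (mcZ F z).map star = mcB F z := by
  have h1 := h.hasWirt hD hz
  have hr : (fun w => (F w).map star) =ᶠ[𝓝 z] F :=
    Filter.eventually_of_mem (hD.mem_nhds hz) fun w hw => (h.mem_group w hw).2.1
  have h2 := (h1.congr hr).unique h1.map_star
  have h3 : (F z).map star = F z := (h.mem_group z hz).2.1
  have h4 : F z * mcB F z = F z * (mcZ F z).map star := by
    rw [h2.2, map_star_mul, h3]
  have h5 := congrArg (fun M => (F z)⁻¹ * M) h4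
  simp only [← mul_assoc, groupC_inv_mul (h.groupC hz), one_mul] at h5
  exact h5.symm

lemma contDiffOn_mul {U : Set ℂ} {l m n : ℕ} {M : ℂ → Matrix (Fin l) (Fin m) ℂ}
    {N : ℂ → Matrix (Fin m) (Fin n) ℂ} {k : WithTop ℕ∞}
    (hM : ∀ i j, ContDiffOn ℝ k (fun w => M w i j) U)
    (hN : ∀ i j, ContDiffOn ℝ k (fun w => N w i j) U) :
    ∀ i j, ContDiffOn ℝ k (fun w => (M w * N w) i j) U := fun i j => by
  simp only [Matrix.mul_apply]
  exact ContDiffOn.sum fun s _ => (hM i s).mul (hN s j)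

lemma IsFrame.contDiffOn_inv (h : IsFrame D y F) :
    ∀ i j, ContDiffOn ℝ ∞ (fun w => (F w)⁻¹ i j) D := by
  have h1 : ∀ i j, ContDiffOn ℝ ∞ (fun w => (I17 * (F w)ᵀ * I17) i j) D :=
    contDiffOn_mul (contDiffOn_mul (fun _ _ => contDiffOn_const) fun i j => h.smooth j i)
      fun _ _ => contDiffOn_const
  exact fun i j => (h1 i j).congr fun w hw => by rw [groupC_inv (h.groupC hw)]

lemma IsFrame.contDiffOn_mcZ (hD : IsOpen D) (h : IsFrame D y F) :
    ∀ i j, ContDiffOn ℝ ∞ (fun w => mcZ F w i j) D :=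
  contDiffOn_mul h.contDiffOn_inv fun i j => contDiffOn_dz hD (h.smooth i j)

lemma IsFrame.contDiffOn_mcB (hD : IsOpen D) (h : IsFrame D y F) :
    ∀ i j, ContDiffOn ℝ ∞ (fun w => mcB F w i j) D :=
  contDiffOn_mul h.contDiffOn_inv fun i j => contDiffOn_dzbar hD (h.smooth i j)

lemma qV_mulVec_apply (x : Vec) (i : Fin 8) : (qV *ᵥ x) i = if (i : ℕ) < 4 then x i else 0 := by
  rw [qV, Matrix.mulVec_diagonal]; split_ifs <;> simp

lemma qN_mulVec_apply (x : Vec) (i : Fin 8) : (qN *ᵥ x) i = if (i : ℕ) < 4 then 0 else x i := by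
  rw [qN, Matrix.mulVec_diagonal]; split_ifs <;> simp

lemma IsFrame.mulVec_qV_mem (h : IsFrame D y F) (hz : z ∈ D) (x : Vec) :
    F z *ᵥ (qV *ᵥ x) ∈ bundleV y z := by
  rw [← h.span_eq z hz]
  have : F z *ᵥ (qV *ᵥ x) = ∑ j : Fin 4, x (Fin.castAdd 4 j) •
      fun i : Fin 8 => F z i (Fin.castAdd 4 j) := by
    ext i
    rw [Matrix.mulVec, dotProduct, Fin.sum_univ_add (a := 4) (b := 4)]
    simp [qV_mulVec_apply, mul_comm]
  rw [this]
  exact Submodule.sum_mem _ fun j _ => Submodule.smul_mem _ _ (Submodule.subset_span ⟨j, rfl⟩)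

lemma IsFrame.lor_qN_bundleV (h : IsFrame D y F) (hz : z ∈ D) (x : Vec) {X : Vec}
    (hX : X ∈ bundleV y z) : lor (F z *ᵥ (qN *ᵥ x)) X = 0 := by
  rw [← h.span_eq z hz] at hX
  induction hX using Submodule.span_induction with
  | mem v hv =>
    obtain ⟨j, rfl⟩ := hv
    have : (fun i : Fin 8 => F z i (Fin.castAdd 4 j))
        = F z *ᵥ Pi.single (Fin.castAdd 4 j) 1 := by
      ext i; simp
    simp only [this, lor_mulVec (h.groupC hz), lor_eq_dotProduct, I17, dotProduct,
      Matrix.mulVec_diagonal]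
    refine Finset.sum_eq_zero fun i _ => ?_
    rw [qN_mulVec_apply]
    by_cases h1 : (i : ℕ) < 4
    · simp [h1]
    · have h2 : i ≠ Fin.castAdd 4 j := by
        rintro rfl; exact h1 (by simp [j.isLt])
      rw [Pi.single_eq_of_ne h2, mul_zero, mul_zero]
  | zero => simp
  | add v v' _ _ hv hv' => rw [lor_add_right, hv, hv', add_zero]
  | smul c v _ hv => rw [lor_smul_right, hv, mul_zero]

/-- In a frame, the normal projection is the projection to the last four coordinates. -/
lemma IsFrame.normalPart_mulVec (h : IsFrame D y F) (hL : LiftProducts y z) (hz : z ∈ D)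
    (x : Vec) : normalPart y z (F z *ᵥ x) = F z *ᵥ (qN *ᵥ x) := by
  have h1 : x = qN *ᵥ x + qV *ᵥ x := by rw [← Matrix.add_mulVec, qN_add_qV, Matrix.one_mulVec]
  conv_lhs => rw [h1, Matrix.mulVec_add, normalPart_add]
  rw [normalPart_eq_zero hL (h.mulVec_qV_mem hz x), add_zero,
    normalPart_eq_self fun v hv => h.lor_qN_bundleV hz x hv]

/-- The frame coordinates of a vector of `V` have no normal component. -/
lemma mem_frame_of_mem_bundleV (h : IsFrame D y F) (hL : LiftProducts y z) (hz : z ∈ D) {X : Vec}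
    (hX : X ∈ bundleV y z) : qN *ᵥ ((F z)⁻¹ *ᵥ X) = 0 := by
  have h1 := h.normalPart_mulVec hL hz ((F z)⁻¹ *ᵥ X)
  rw [Matrix.mulVec_mulVec, groupC_mul_inv (h.groupC hz), Matrix.one_mulVec,
    normalPart_eq_zero hL hX] at h1
  have h2 := congrArg (fun v => (F z)⁻¹ *ᵥ v) h1
  simp only [Matrix.mulVec_mulVec, Matrix.mulVec_zero] at h2
  rw [← mul_assoc, groupC_inv_mul (h.groupC hz), one_mul] at h2
  rw [Matrix.mulVec_mulVec]; exact h2.symm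

end Frame

/-! ### Fourier coefficients of a family of loops -/

section Fourier

variable {z₁ : ℂ} {r : ℝ}

/-- Differentiation of a weighted circle integral with respect to a parameter. -/
lemma hasFDerivAt_circleIntegral {q qa qb : ℂ → ℂ → Vec} {g : ℂ → ℂ} {C : ℝ} {z : ℂ}
    (hz : z ∈ Metric.ball z₁ r) (hg : ContinuousOn g (Metric.sphere 0 1))
    (hq : ∀ w ∈ Metric.ball z₁ r, ContinuousOn (q w) (Metric.sphere 0 1))
    (hqa : ContinuousOn (qa z) (Metric.sphere 0 1))
    (hqb : ContinuousOn (qb z) (Metric.sphere 0 1))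
    (hC : ∀ w ∈ Metric.ball z₁ r, ∀ lam : ℂ, ‖lam‖ = 1 → ‖qa w lam‖ ≤ C ∧ ‖qb w lam‖ ≤ C)
    (hd : ∀ w ∈ Metric.ball z₁ r, ∀ lam : ℂ, ‖lam‖ = 1 →
      HasFDerivAt (fun x => q x lam) (wirt (qa w lam) (qb w lam)) w) :
    HasFDerivAt (fun w => ∮ lam in C(0, 1), g lam • q w lam)
      (wirt (∮ lam in C(0, 1), g lam • qa z lam) (∮ lam in C(0, 1), g lam • qb z lam)) z := by
  have hcm : ∀ θ : ℝ, circleMap 0 1 θ ∈ Metric.sphere (0 : ℂ) 1 := fun θ =>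
    circleMap_mem_sphere 0 zero_le_one θ
  have hn : ∀ θ : ℝ, ‖circleMap 0 1 θ‖ = 1 := fun θ => by simp
  have hcont : ∀ f : ℂ → Vec, ContinuousOn f (Metric.sphere 0 1) →
      Continuous fun θ : ℝ => deriv (circleMap 0 1) θ • (g (circleMap 0 1 θ) •
        f (circleMap 0 1 θ)) := fun f hf => by
    simp only [deriv_circleMap]
    exact ((continuous_circleMap 0 1).mul continuous_const).smul
      ((hg.comp_continuous (continuous_circleMap 0 1) hcm).smul
        (hf.comp_continuous (continuous_circleMap 0 1) hcm))
  have hcontw : ∀ f f' : ℂ → Vec, ContinuousOn f (Metric.sphere 0 1) →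
      ContinuousOn f' (Metric.sphere 0 1) → Continuous fun θ : ℝ => wirt
        (deriv (circleMap 0 1) θ • (g (circleMap 0 1 θ) • f (circleMap 0 1 θ)))
        (deriv (circleMap 0 1) θ • (g (circleMap 0 1 θ) • f' (circleMap 0 1 θ))) :=
    fun f f' hf hf' => isBoundedLinearMap_wirt.continuous.comp
      ((hcont f hf).prodMk (hcont f' hf'))
  obtain ⟨G, hG⟩ := (isCompact_sphere (0 : ℂ) 1).exists_bound_of_continuousOn hg
  have key := intervalIntegral.hasFDerivAt_integral_of_dominated_of_fderiv_le (𝕜 := ℝ)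
    (μ := MeasureTheory.volume) (a := 0) (b := 2 * Real.pi)
    (F := fun w (θ : ℝ) => deriv (circleMap 0 1) θ • (g (circleMap 0 1 θ) • q w (circleMap 0 1 θ)))
    (F' := fun w (θ : ℝ) => wirt
      (deriv (circleMap 0 1) θ • (g (circleMap 0 1 θ) • qa w (circleMap 0 1 θ)))
      (deriv (circleMap 0 1) θ • (g (circleMap 0 1 θ) • qb w (circleMap 0 1 θ))))
    (bound := fun _ => G * C + G * C) (x₀ := z) (s := Metric.ball z₁ r)
    (Metric.isOpen_ball.mem_nhds hz)
    (Filter.eventually_of_mem (Metric.isOpen_ball.mem_nhds hz) fun w hw =>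
      (hcont _ (hq w hw)).aestronglyMeasurable)
    ((hcont _ (hq z hz)).intervalIntegrable _ _) ?_ ?_ (intervalIntegrable_const)
    ?_
  · refine key.congr_fderiv ?_
    refine ContinuousLinearMap.ext fun v => ?_
    have e1 := (hcont _ hqa).intervalIntegrable (μ := MeasureTheory.volume) 0 (2 * Real.pi)
    have e2 := (hcont _ hqb).intervalIntegrable (μ := MeasureTheory.volume) 0 (2 * Real.pi)
    rw [ContinuousLinearMap.intervalIntegral_apply
      ((hcontw _ _ hqa hqb).intervalIntegrable _ _)]
    simp only [wirt_apply]
    rw [circleIntegral, circleIntegral, ← intervalIntegral.integral_smul,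
      ← intervalIntegral.integral_smul, ← intervalIntegral.integral_add]
    · exact e1.smul v
    · exact e2.smul (starRingEnd ℂ v)
  · exact (hcontw _ _ hqa hqb).aestronglyMeasurable
  · refine Filter.Eventually.of_forall fun θ _ w hw' => (norm_wirt_le _ _).trans ?_
    simp only [norm_smul, deriv_circleMap, norm_mul, hn, Complex.norm_I, mul_one, one_mul]
    have h1 := hC w hw' _ (hn θ)
    have h2 := hG _ (hcm θ)
    have h3 : 0 ≤ G := (norm_nonneg _).trans h2
    gcongr
    exacts [h1.1, h1.2]
  · refine Filter.Eventually.of_forall fun θ _ w hw' => ?_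
    have h1 := ((hd w hw' _ (hn θ)).const_smul (g (circleMap 0 1 θ))).const_smul
      (deriv (circleMap 0 1) θ)
    refine h1.congr_fderiv ?_
    refine ContinuousLinearMap.ext fun v => ?_
    simp only [smul_apply, wirt_apply]
    module

lemma circleIntegral_mulVec {f : ℂ → Vec} (hf : ContinuousOn f (Metric.sphere 0 1)) (M : Mat) :
    ∮ lam in C(0, 1), M *ᵥ f lam = M *ᵥ ∮ lam in C(0, 1), f lam := by
  have h1 : CircleIntegrable f 0 1 := hf.circleIntegrable zero_le_one
  have h2 := (LinearMap.toContinuousLinearMap M.mulVecLin).intervalIntegral_comp_comm h1.out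
  simpa [circleIntegral, Matrix.mulVec_smul] using h2

/-- The sum of the absolute values of the entries. -/
def entrySum (M : Mat) : ℝ := ∑ i, ∑ j, ‖M i j‖

lemma norm_mulVec_le (M : Mat) (x : Vec) : ‖M *ᵥ x‖ ≤ entrySum M * ‖x‖ := by
  refine (pi_norm_le_iff_of_nonneg ?_).2 fun i => ?_
  · unfold entrySum; positivity
  calc ‖(M *ᵥ x) i‖ ≤ ∑ j, ‖M i j * x j‖ := norm_sum_le (E := ℂ) _ _
    _ ≤ ∑ j, ‖M i j‖ * ‖x‖ := Finset.sum_le_sum fun j _ => by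
        rw [norm_mul]; gcongr; exact norm_le_pi_norm x j
    _ = (∑ j, ‖M i j‖) * ‖x‖ := by rw [Finset.sum_mul]
    _ ≤ entrySum M * ‖x‖ := by
        gcongr
        exact Finset.single_le_sum (f := fun i => ∑ j, ‖M i j‖)
          (fun _ _ => by positivity) (Finset.mem_univ i)

lemma entrySum_bounded {U : Set ℂ} (hU : IsCompact U) {A : ℂ → Mat}
    (hA : ∀ i j, ContinuousOn (fun w => A w i j) U) : ∃ C, 0 ≤ C ∧ ∀ w ∈ U, entrySum (A w) ≤ C := by
  have h1 : ContinuousOn (fun w => entrySum (A w)) U :=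
    continuousOn_finsetSum _ fun i _ => continuousOn_finsetSum _ fun j _ => (hA i j).norm
  obtain ⟨C, hC⟩ := hU.exists_bound_of_continuousOn h1
  exact ⟨max C 0, le_max_right _ _, fun w hw =>
    ((Real.le_norm_self _).trans (hC w hw)).trans (le_max_left _ _)⟩

/-- A solution of a linear system of first order on a ball is bounded in terms of its value at the
centre (Gronwall's inequality along rays). -/
lemma norm_le_of_linear_system {f fa fb : ℂ → Vec} {K : ℝ}
    (hf : ∀ w ∈ Metric.ball z₁ r, HasFDerivAt f (wirt (fa w) (fb w)) w)
    (hK : ∀ w ∈ Metric.ball z₁ r, ‖fa w‖ ≤ K * ‖f w‖ ∧ ‖fb w‖ ≤ K * ‖f w‖)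
    {z : ℂ} (hz : z ∈ Metric.ball z₁ r) :
    ‖f z‖ ≤ ‖f z₁‖ * Real.exp (2 * K * r) := by
  have hr : 0 < r := Metric.pos_of_mem_ball hz
  have hzr : ‖z - z₁‖ ≤ r := by rw [← dist_eq_norm]; exact (Metric.mem_ball.1 hz).le
  have hγ : ∀ t ∈ Set.Icc (0 : ℝ) 1, z₁ + (t : ℂ) * (z - z₁) ∈ Metric.ball z₁ r := by
    intro t ht
    rw [Metric.mem_ball, dist_eq_norm, add_sub_cancel_left, norm_mul, Complex.norm_real,
      Real.norm_of_nonneg ht.1]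
    calc t * ‖z - z₁‖ ≤ 1 * ‖z - z₁‖ := by gcongr; exact ht.2
      _ < r := by rw [one_mul, ← dist_eq_norm]; exact hz
  have hγd : ∀ t : ℝ, HasDerivAt (fun t : ℝ => z₁ + (t : ℂ) * (z - z₁)) (z - z₁) t := by
    intro t
    simpa using ((Complex.ofRealCLM.hasDerivAt (x := t)).mul_const (z - z₁)).const_add z₁
  have hd : ∀ t ∈ Set.Icc (0 : ℝ) 1, HasDerivAt (fun t : ℝ => f (z₁ + (t : ℂ) * (z - z₁)))
      (wirt (fa (z₁ + (t : ℂ) * (z - z₁))) (fb (z₁ + (t : ℂ) * (z - z₁))) (z - z₁)) t :=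
    fun t ht => (hf _ (hγ t ht)).comp_hasDerivAt t (hγd t)
  have h := norm_le_gronwallBound_of_norm_deriv_right_le (δ := ‖f z₁‖) (K := 2 * K * r) (ε := 0)
    (a := 0) (b := 1) (fun t ht => (hd t ht).continuousAt.continuousWithinAt)
    (fun t ht => (hd t (Set.Ico_subset_Icc_self ht)).hasDerivWithinAt) (by simp)
    (fun t ht => by
      obtain ⟨h1, h2⟩ := hK _ (hγ t (Set.Ico_subset_Icc_self ht))
      rw [wirt_apply]
      refine (norm_add_le _ _).trans ?_
      rw [norm_smul, norm_smul, RCLike.norm_conj]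
      calc _ ≤ r * (K * ‖f (z₁ + (t : ℂ) * (z - z₁))‖) + r * (K * ‖f (z₁ + (t : ℂ) * (z - z₁))‖) := by
            gcongr
        _ = _ := by ring) 1 (by simp)
  simpa [gronwallBound_ε0] using h

end Fourier

section Fourier

variable {z₁ : ℂ} {r : ℝ}

lemma circleIntegral_neg_add_mulVec {f h : ℂ → Vec} (hf : ContinuousOn f (Metric.sphere 0 1))
    (hh : ContinuousOn h (Metric.sphere 0 1)) (M N : Mat) :
    ∮ lam in C(0, 1), -(M *ᵥ f lam + N *ᵥ h lam)
      = -(M *ᵥ (∮ lam in C(0, 1), f lam) + N *ᵥ ∮ lam in C(0, 1), h lam) := by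
  have hM : ∀ (M : Mat) {f : ℂ → Vec}, ContinuousOn f (Metric.sphere 0 1) →
      CircleIntegrable (fun lam => M *ᵥ f lam) 0 1 := fun M f hf =>
    ((LinearMap.toContinuousLinearMap M.mulVecLin).continuous.comp_continuousOn
      hf).circleIntegrable zero_le_one
  have h1 := circleIntegral.integral_smul (-1 : ℂ) (fun lam => M *ᵥ f lam + N *ᵥ h lam) 0 1
  simp only [neg_one_smul] at h1
  rw [h1, circleIntegral.integral_add (hM M hf) (hM N hh), circleIntegral_mulVec hf,
    circleIntegral_mulVec hh]

/-- Suppose that the loops `q(w, ·)` extend holomorphically to the unit disk and that `w ↦ q(w, lam)`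
solves `dq = -(lam⁻¹ α₁' + α₀ + lam α₁'') q`. Comparing Fourier coefficients, the value at `lam = 0`
is annihilated by `α₁'`, and it satisfies `∂_z̄ q₀ = -α₀'' q₀` and `∂_z q₀ = -α₀' q₀ - α₁' q₁`. -/
lemma loop_value_at_zero {q : ℂ → ℂ → Vec} {A B : ℂ → Mat} {K : ℝ}
    (hKA : ∀ w ∈ Metric.ball z₁ r, entrySum (pPart (A w)) + entrySum (kPart (A w)) ≤ K)
    (hKB : ∀ w ∈ Metric.ball z₁ r, entrySum (pPart (B w)) + entrySum (kPart (B w)) ≤ K)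
    (hc : ∀ w ∈ Metric.ball z₁ r, DiffContOnCl ℂ (q w) (Metric.ball 0 1))
    (hd : ∀ w ∈ Metric.ball z₁ r, ∀ lam : ℂ, ‖lam‖ = 1 → HasFDerivAt (fun x => q x lam)
      (wirt (-(pPart (A w) *ᵥ (lam⁻¹ • q w lam) + kPart (A w) *ᵥ q w lam))
        (-(pPart (B w) *ᵥ (lam • q w lam) + kPart (B w) *ᵥ q w lam))) w)
    {z : ℂ} (hz : z ∈ Metric.ball z₁ r) :
    pPart (A z) *ᵥ q z 0 = 0 ∧ ∃ c : Vec, HasFDerivAt (fun w => q w 0)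
      (wirt (-(pPart (A z) *ᵥ c + kPart (A z) *ᵥ q z 0)) (-(kPart (B z) *ᵥ q z 0))) z := by
  have hz₁ : z₁ ∈ Metric.ball z₁ r := Metric.mem_ball_self (Metric.pos_of_mem_ball hz)
  have hq : ∀ w ∈ Metric.ball z₁ r, ContinuousOn (q w) (Metric.sphere 0 1) := fun w hw =>
    (hc w hw).continuousOn_ball.mono Metric.sphere_subset_closedBall
  have hbd : ∀ (p k : Mat) (c : ℂ) (x : Vec), ‖c‖ = 1 → entrySum p + entrySum k ≤ K →
      ‖-(p *ᵥ (c • x) + k *ᵥ x)‖ ≤ K * ‖x‖ := by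
    intro p k c x hc' hpk
    rw [norm_neg]
    refine (norm_add_le _ _).trans ?_
    refine (add_le_add (norm_mulVec_le _ _) (norm_mulVec_le _ _)).trans ?_
    rw [norm_smul, hc', one_mul, ← add_mul]
    gcongr
  have hK0 : 0 ≤ K := by
    refine le_trans ?_ (hKA z hz)
    unfold entrySum; positivity
  obtain ⟨C₀, hC₀⟩ := (isCompact_sphere (0 : ℂ) 1).exists_bound_of_continuousOn (hq z₁ hz₁)
  have hbound : ∀ w ∈ Metric.ball z₁ r, ∀ lam : ℂ, ‖lam‖ = 1 →
      ‖q w lam‖ ≤ C₀ * Real.exp (2 * K * r) := by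
    intro w hw lam hl
    refine (norm_le_of_linear_system (K := K) (fun x hx => hd x hx lam hl) (fun x hx => ⟨hbd _ _ _ _
      (by rw [norm_inv, hl, inv_one]) (hKA x hx), hbd _ _ _ _ hl (hKB x hx)⟩) hw).trans ?_
    gcongr
    exact hC₀ lam (by simpa using hl)
  have hsm : ∀ {g : ℂ → ℂ}, ContinuousOn g (Metric.sphere 0 1) → ∀ w ∈ Metric.ball z₁ r,
      ContinuousOn (fun lam => g lam • q w lam) (Metric.sphere 0 1) := fun hg w hw =>
    hg.smul (hq w hw)
  have hinv : ContinuousOn (fun lam : ℂ => lam⁻¹) (Metric.sphere 0 1) :=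
    continuousOn_id.inv₀ fun x hx => by
      rintro rfl; simp at hx
  have hmv : ∀ (M : Mat) {f : ℂ → Vec}, ContinuousOn f (Metric.sphere 0 1) →
      ContinuousOn (fun lam => M *ᵥ f lam) (Metric.sphere 0 1) := fun M f hf =>
    (LinearMap.toContinuousLinearMap M.mulVecLin).continuous.comp_continuousOn hf
  have key : ∀ {g : ℂ → ℂ}, ContinuousOn g (Metric.sphere 0 1) →
      HasFDerivAt (fun w => ∮ lam in C(0, 1), g lam • q w lam) (wirt
        (-(pPart (A z) *ᵥ (∮ lam in C(0, 1), (g lam * lam⁻¹) • q z lam)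
          + kPart (A z) *ᵥ ∮ lam in C(0, 1), g lam • q z lam))
        (-(pPart (B z) *ᵥ (∮ lam in C(0, 1), (g lam * lam) • q z lam)
          + kPart (B z) *ᵥ ∮ lam in C(0, 1), g lam • q z lam))) z := by
    intro g hg
    have h1 := hasFDerivAt_circleIntegral (C := K * (C₀ * Real.exp (2 * K * r))) hz hg hq
      (((hmv _ (hsm hinv z hz)).add (hmv _ (hq z hz))).neg)
      (((hmv _ (hsm continuousOn_id z hz)).add (hmv _ (hq z hz))).neg)
      (fun w hw lam hl => ⟨(hbd _ _ _ _ (by rw [norm_inv, hl, inv_one]) (hKA w hw)).trans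
          (mul_le_mul_of_nonneg_left (hbound w hw lam hl) hK0),
        (hbd _ _ _ _ hl (hKB w hw)).trans
          (mul_le_mul_of_nonneg_left (hbound w hw lam hl) hK0)⟩) hd
    have hg1 : ContinuousOn (fun lam => g lam * lam⁻¹) (Metric.sphere 0 1) := hg.mul hinv
    have hg2 : ContinuousOn (fun lam => g lam * lam) (Metric.sphere 0 1) := hg.mul continuousOn_id
    rw [← circleIntegral_neg_add_mulVec (hsm hg1 z hz) (hsm hg z hz),
      ← circleIntegral_neg_add_mulVec (hsm hg2 z hz) (hsm hg z hz)]
    convert h1 using 5 <;>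
      simp only [smul_neg, smul_add, Matrix.mulVec_smul, smul_smul]
  have i0 : ∀ w ∈ Metric.ball z₁ r,
      ∮ lam in C(0, 1), lam⁻¹ • q w lam = (2 * Real.pi * Complex.I : ℂ) • q w 0 := by
    intro w hw
    simpa using (hc w hw).circleIntegral_sub_inv_smul (w := 0) (by simp)
  have i1 : ∀ w ∈ Metric.ball z₁ r, ∮ lam in C(0, 1), (1 : ℂ) • q w lam = 0 := by
    intro w hw
    simpa using (hc w hw).circleIntegral_eq_zero zero_le_one
  have hnhds := Metric.isOpen_ball.mem_nhds hz
  have hpi : (2 * Real.pi * Complex.I : ℂ) ≠ 0 := Complex.two_pi_I_ne_zero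
  constructor
  -- the coefficient of `lam⁻¹` of `q` vanishes identically, and so does its `z`-derivative
  · have h1 := key (g := fun _ => 1) continuousOn_const
    have h2 : (fun w => ∮ lam in C(0, 1), (1 : ℂ) • q w lam) =ᶠ[𝓝 z] fun _ => (0 : Vec) :=
      Filter.eventually_of_mem hnhds i1
    have h3 := (wirt_injective
      (h1.unique ((wirt_const (0 : Vec) z).congr_of_eventuallyEq h2))).1
    simp only [one_mul] at h3
    rw [i0 z hz, i1 z hz, Matrix.mulVec_zero, add_zero, neg_eq_zero, Matrix.mulVec_smul] at h3
    exact (smul_eq_zero.1 h3).resolve_left hpi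
  -- the coefficient of `lam⁰` of `q` is its value at `lam = 0`
  · have h1 := key (g := fun lam => lam⁻¹) hinv
    have h2 : (fun w => q w 0) =ᶠ[𝓝 z] fun w => (2 * Real.pi * Complex.I : ℂ)⁻¹ •
        ∮ lam in C(0, 1), lam⁻¹ • q w lam :=
      Filter.eventually_of_mem hnhds fun w hw => by
        simp only [i0 w hw, smul_smul, inv_mul_cancel₀ hpi, one_smul]
    refine ⟨(2 * Real.pi * Complex.I : ℂ)⁻¹ • ∮ lam in C(0, 1), (lam⁻¹ * lam⁻¹) • q z lam, ?_⟩
    refine ((h1.const_smul ((2 * Real.pi * Complex.I : ℂ)⁻¹)).congr_of_eventuallyEq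
      h2).congr_fderiv ?_
    have i3 : ∮ lam in C(0, 1), (lam⁻¹ * lam : ℂ) • q z lam = 0 := by
      rw [← i1 z hz]
      refine circleIntegral.integral_congr zero_le_one fun lam hl => ?_
      have : lam ≠ 0 := by rintro rfl; simp at hl
      simp only [inv_mul_cancel₀ this]
    rw [i0 z hz, i3]
    refine ContinuousLinearMap.ext fun v => ?_
    simp only [smul_apply, wirt_apply, Matrix.mulVec_smul, Matrix.mulVec_zero, zero_add]
    generalize (2 * Real.pi * Complex.I : ℂ) = c at hpi ⊢
    match_scalars <;> field_simp

end Fourier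

/-! ### The isotropic plane carried by the plus loop -/

/-- The basis `e₄ + i e₅`, `e₆ + i e₇` of the isotropic plane that the potential annihilates. -/
def isoW : Fin 2 → Vec :=
  ![![0, 0, 0, 0, 1, Complex.I, 0, 0], ![0, 0, 0, 0, 0, 0, 1, Complex.I]]

section Blocks

variable (A B C E : Matrix (Fin 4) (Fin 4) ℂ)

lemma blocks_castAdd_castAdd (i j : Fin 4) :
    blocks A B C E (Fin.castAdd 4 i) (Fin.castAdd 4 j) = A i j := by
  rw [blocks, Matrix.submatrix_apply, finSumFinEquiv_symm_apply_castAdd,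
    finSumFinEquiv_symm_apply_castAdd]
  rfl

lemma blocks_castAdd_natAdd (i j : Fin 4) :
    blocks A B C E (Fin.castAdd 4 i) (Fin.natAdd 4 j) = B i j := by
  rw [blocks, Matrix.submatrix_apply, finSumFinEquiv_symm_apply_castAdd]
  rw [finSumFinEquiv_symm_apply_natAdd]
  rfl

lemma blocks_natAdd_castAdd (i j : Fin 4) :
    blocks A B C E (Fin.natAdd 4 i) (Fin.castAdd 4 j) = C i j := by
  rw [blocks, Matrix.submatrix_apply, finSumFinEquiv_symm_apply_natAdd]
  rw [finSumFinEquiv_symm_apply_castAdd]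
  rfl

lemma blocks_natAdd_natAdd (i j : Fin 4) :
    blocks A B C E (Fin.natAdd 4 i) (Fin.natAdd 4 j) = E i j := by
  rw [blocks, Matrix.submatrix_apply, finSumFinEquiv_symm_apply_natAdd,
    finSumFinEquiv_symm_apply_natAdd]
  rfl

lemma qN_comm_blocks : qN * blocks A 0 0 E = blocks A 0 0 E * qN := by
  ext i j
  simp only [qN, Matrix.diagonal_mul, Matrix.mul_diagonal]
  refine Fin.addCases (m := 4) (n := 4) (fun i => ?_) (fun i => ?_) i <;>
    refine Fin.addCases (m := 4) (n := 4) (fun j => ?_) (fun j => ?_) j <;>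
    simp only [blocks_castAdd_castAdd, blocks_castAdd_natAdd, blocks_natAdd_castAdd,
      blocks_natAdd_natAdd, Fin.val_castAdd, Fin.val_natAdd, Fin.is_lt, if_true, Matrix.zero_apply,
      add_lt_iff_neg_left, not_lt_zero, if_false, zero_mul, mul_zero, one_mul, mul_one]

lemma isoPotential_mulVec_isoW (h : Fin 4 → Fin 2 → ℂ → ℂ) (z : ℂ) (j : Fin 2) :
    isoPotential h z *ᵥ isoW j = 0 := by
  have hw : ∀ k : Fin 4, isoW j (Fin.castAdd 4 k) = 0 := by
    intro k; fin_cases j <;> fin_cases k <;> rfl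
  ext i
  rw [Matrix.mulVec, dotProduct, Fin.sum_univ_add (a := 4) (b := 4)]
  simp only [hw, mul_zero, Finset.sum_const_zero, zero_add, Pi.zero_apply]
  refine Fin.addCases (m := 4) (n := 4) (fun i => ?_) (fun i => ?_) i
  · simp only [isoPotential, blocks_castAdd_natAdd]
    fin_cases j <;>
      simp [Fin.sum_univ_succ, isoB, isoW, Fin.natAdd] <;>
      linear_combination (h i _ z) * Complex.I_mul_I
  · simp only [isoPotential, blocks_natAdd_natAdd, Matrix.zero_apply, zero_mul,
      Finset.sum_const_zero]

end Blocks

section Birkhoff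

variable {D P : Set ℂ} {y : ℂ → EuclideanSpace ℝ (Fin 7)} {F : ℂ → Mat} {Fl Fm Fp : ℂ → ℂ → Mat}
  {η : ℂ → Mat} {h : Fin 4 → Fin 2 → ℂ → ℂ} {z : ℂ}

lemma IsBirkhoff.eventually_mem (hD : IsOpen D) (hB : IsBirkhoff D P F Fl Fm Fp η)
    (hz : z ∈ D \ P) : ∀ᶠ w in 𝓝 z, w ∈ D \ P := by
  have h1 := hB.discrete z hz.1
  rw [eventually_nhdsWithin_iff] at h1
  filter_upwards [h1, hD.mem_nhds hz.1] with w hw hwD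
  refine ⟨hwD, ?_⟩
  by_cases e : w = z
  · rw [e]; exact hz.2
  · exact hw e

/-- A constant vector annihilated by the potential is fixed by `F_-`, by uniqueness of meromorphic
continuation from the base point. -/
lemma IsBirkhoff.minus_mulVec (hD : IsOpen D) (hDc : IsPreconnected D) (h0 : (0 : ℂ) ∈ D)
    (hB : IsBirkhoff D P F Fl Fm Fp η) {x : Vec} (hx : ∀ z, η z *ᵥ x = 0) {lam : ℂ}
    (hl : ‖lam‖ = 1) (hz : z ∈ D \ P) : Fm z lam *ᵥ x = x := by
  ext i
  set f : ℂ → ℂ := fun w => ∑ k, Fm w lam i k * x k - x i with hf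
  have hmer : MeromorphicOn f D := fun w hw => by
    have : MeromorphicAt (fun w => ∑ k, Fm w lam i k * x k) w :=
      MeromorphicAt.fun_sum fun k _ => (hB.meromorphic lam hl i k w hw).mul (MeromorphicAt.const _ _)
    exact this.sub (MeromorphicAt.const _ _)
  have hder : ∀ w ∈ D \ P, HasDerivAt f 0 w := fun w hw => by
    have h1 : HasDerivAt f (∑ k, (Fm w lam * (lam⁻¹ • η w)) i k * x k) w :=
      (HasDerivAt.fun_sum fun k _ => (hB.deriv_eq lam hl w hw i k).mul_const (x k)).sub_const _
    have h2 : (∑ k, (Fm w lam * (lam⁻¹ • η w)) i k * x k)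
        = ((Fm w lam * (lam⁻¹ • η w)) *ᵥ x) i := rfl
    rw [h2, ← Matrix.mulVec_mulVec, Matrix.smul_mulVec, hx, smul_zero, Matrix.mulVec_zero] at h1
    exact h1
  have h0' : (0 : ℂ) ∈ D \ P := ⟨h0, hB.zero_notMem⟩
  have hf0 : f 0 = 0 := by
    simp [hf, hB.init lam hl, Matrix.one_apply]
  have hnear : ∀ᶠ w in 𝓝 (0 : ℂ), f w = 0 := by
    obtain ⟨r, hr, hball⟩ := Metric.eventually_nhds_iff_ball.1 (hB.eventually_mem hD h0')
    refine Filter.eventually_of_mem (Metric.ball_mem_nhds 0 hr) fun w hw => ?_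
    rw [← hf0]
    exact Metric.isOpen_ball.is_const_of_deriv_eq_zero (convex_ball 0 r).isPreconnected
      (fun v hv => (hder v (hball v hv)).differentiableAt.differentiableWithinAt)
      (fun v hv => (hder v (hball v hv)).deriv) hw (Metric.mem_ball_self hr)
  have htop : meromorphicOrderAt f z = ⊤ := by
    by_contra hne
    exact hmer.meromorphicOrderAt_ne_top_of_isPreconnected hDc hz.1 h0 hne
      (meromorphicOrderAt_eq_top_iff.2 (hnear.filter_mono nhdsWithin_le_nhds))
  have h3 : Filter.Tendsto f (𝓝[≠] z) (𝓝 (f z)) :=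
    (hder z hz).continuousAt.tendsto.mono_left nhdsWithin_le_nhds
  have h4 : Filter.Tendsto f (𝓝[≠] z) (𝓝 0) :=
    tendsto_const_nhds.congr' ((meromorphicOrderAt_eq_top_iff.1 htop).mono fun w hw => hw.symm)
  have h5 : f z = 0 := tendsto_nhds_unique h3 h4
  exact sub_eq_zero.1 h5

lemma IsBirkhoff.extended_mem (hF : F 0 ∈ groupC) (hB : IsBirkhoff D P F Fl Fm Fp η)
    (hz : z ∈ D \ P) {lam : ℂ} (hl : ‖lam‖ = 1) : Fl z lam ∈ groupC := by
  have hm := (hB.minus z hz).mem_group lam hl.ge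
  have hp := (hB.plus z hz).mem_group lam hl.le
  have h1 : Fl z lam = F 0 * Fm z lam * (Fp z lam)⁻¹ := by
    rw [hB.decomposition z hz lam hl, ← mul_assoc, ← mul_assoc, groupC_mul_inv hF, one_mul,
      mul_assoc, groupC_mul_inv hp, mul_one]
  rw [h1]
  exact groupC_mul (groupC_mul hF hm) (groupC_inv_mem hp)

/-- On a fixed vector of `F_-`, the plus loop satisfies the linear system inverse to that of the
extended frame. -/
lemma IsBirkhoff.hasFDerivAt_plus (hD : IsOpen D) (hDc : IsPreconnected D) (h0 : (0 : ℂ) ∈ D)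
    (hF : F 0 ∈ groupC) (hE : IsExtendedFrame D F Fl)
    (hB : IsBirkhoff D P F Fl Fm Fp η) {x : Vec} (hx : ∀ z, η z *ᵥ x = 0) {lam : ℂ}
    (hl : ‖lam‖ = 1) (hz : z ∈ D \ P) :
    HasFDerivAt (fun w => Fp w lam *ᵥ x)
      (wirt (-(pPart (mcZ F z) *ᵥ (lam⁻¹ • Fp z lam *ᵥ x) + kPart (mcZ F z) *ᵥ (Fp z lam *ᵥ x)))
        (-(pPart (mcB F z) *ᵥ (lam • Fp z lam *ᵥ x) + kPart (mcB F z) *ᵥ (Fp z lam *ᵥ x)))) z := by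
  have hnear := hB.eventually_mem hD hz
  have hfix : ∀ w ∈ D \ P, Fl w lam *ᵥ (Fp w lam *ᵥ x) = F 0 *ᵥ x := by
    intro w hw
    have h1 := hB.minus_mulVec hD hDc h0 hx hl hw
    rw [hB.decomposition w hw lam hl] at h1
    have h2 := congrArg (fun v => F 0 *ᵥ v) h1
    simp only [Matrix.mulVec_mulVec, ← mul_assoc, groupC_mul_inv hF, one_mul] at h2
    rw [Matrix.mulVec_mulVec]; exact h2
  have hFl := hasWirt_of_contDiffOn hD (hE.smooth lam hl) hz.1
  rw [hE.dz_eq lam hl z hz.1, hE.dzbar_eq lam hl z hz.1] at hFl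
  change HasWirt _ (Fl z lam * (lam⁻¹ • pPart (mcZ F z) + kPart (mcZ F z)))
    (Fl z lam * (kPart (mcB F z) + lam • pPart (mcB F z))) z at hFl
  have heq : (fun w => Fp w lam *ᵥ x)
      =ᶠ[𝓝 z] fun w => (I17 * (Fl w lam)ᵀ * I17) *ᵥ (F 0 *ᵥ x) := by
    filter_upwards [hnear] with w hw
    rw [← hfix w hw, Matrix.mulVec_mulVec, groupC_left_inv (hB.extended_mem hF hw hl),
      Matrix.one_mulVec]
  obtain ⟨a, b, hab⟩ : ∃ a b, HasFDerivAt (fun w => Fp w lam *ᵥ x) (wirt a b) z :=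
    ⟨_, _, (((hFl.transpose.const_mul I17).mul_const I17).mulVec
      (wirt_const (F 0 *ᵥ x) z)).congr_of_eventuallyEq heq⟩
  have h1 := hFl.mulVec hab
  have h2 : (fun w => Fl w lam *ᵥ (Fp w lam *ᵥ x)) =ᶠ[𝓝 z] fun _ => F 0 *ᵥ x :=
    hnear.mono hfix
  obtain ⟨h3, h4⟩ := wirt_injective
    (h1.unique ((wirt_const (F 0 *ᵥ x) z).congr_of_eventuallyEq h2))
  have hinj : ∀ X : Mat, ∀ c : Vec,
      (Fl z lam * X) *ᵥ (Fp z lam *ᵥ x) + Fl z lam *ᵥ c = 0 → c = -(X *ᵥ (Fp z lam *ᵥ x)) := by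
    intro X c hc
    rw [← Matrix.mulVec_mulVec, ← Matrix.mulVec_add] at hc
    have h5 := congrArg (fun v => (Fl z lam)⁻¹ *ᵥ v) hc
    simp only [Matrix.mulVec_mulVec, groupC_inv_mul (hB.extended_mem hF hz hl),
      Matrix.one_mulVec, Matrix.mulVec_zero] at h5
    rw [Matrix.mulVec_mulVec]
    exact (neg_eq_of_add_eq_zero_right h5).symm
  rw [hinj _ _ h3, hinj _ _ h4] at hab
  refine hab.congr_fderiv ?_
  congr 2
  · rw [Matrix.add_mulVec, Matrix.smul_mulVec, Matrix.mulVec_smul]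
  · rw [Matrix.add_mulVec, Matrix.smul_mulVec, Matrix.mulVec_smul, add_comm]

/-- The value at `lam = 0` of the plus loop, applied to a vector annihilated by the potential. -/
lemma IsBirkhoff.plus_at_zero (hD : IsOpen D) (hDc : IsPreconnected D) (h0 : (0 : ℂ) ∈ D)
    (hFr : IsFrame D y F) (hE : IsExtendedFrame D F Fl)
    (hB : IsBirkhoff D P F Fl Fm Fp η) {x : Vec} (hx : ∀ z, η z *ᵥ x = 0) (hz : z ∈ D \ P) :
    pPart (mcZ F z) *ᵥ (Fp z 0 *ᵥ x) = 0 ∧ ∃ c : Vec, HasFDerivAt (fun w => Fp w 0 *ᵥ x)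
      (wirt (-(pPart (mcZ F z) *ᵥ c + kPart (mcZ F z) *ᵥ (Fp z 0 *ᵥ x)))
        (-(kPart (mcB F z) *ᵥ (Fp z 0 *ᵥ x)))) z := by
  obtain ⟨r, hr, hball⟩ := Metric.nhds_basis_closedBall.mem_iff.1 (hB.eventually_mem hD hz)
  have hcpt : IsCompact (Metric.closedBall z r) := isCompact_closedBall z r
  have hZ : ∀ i j, ContinuousOn (fun w => mcZ F w i j) (Metric.closedBall z r) := fun i j =>
    (hFr.contDiffOn_mcZ hD i j).continuousOn.mono fun w hw => (hball hw).1
  have hB' : ∀ i j, ContinuousOn (fun w => mcB F w i j) (Metric.closedBall z r) := fun i j =>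
    (hFr.contDiffOn_mcB hD i j).continuousOn.mono fun w hw => (hball hw).1
  have hk : ∀ {A : ℂ → Mat}, (∀ i j, ContinuousOn (fun w => A w i j) (Metric.closedBall z r)) →
      ∃ K, ∀ w ∈ Metric.ball z r, entrySum (pPart (A w)) + entrySum (kPart (A w)) ≤ K := by
    intro A hA
    have e : ∀ i j, ∃ c : ℂ, ∀ w, (sigmaD * A w * sigmaD) i j = c * A w i j := fun i j =>
      ⟨(if (i : ℕ) < 4 then -1 else 1) * (if (j : ℕ) < 4 then -1 else 1), fun w => by
        simp only [sigmaD, Matrix.mul_diagonal, Matrix.diagonal_mul]; ring⟩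
    have h1 : ∀ i j, ContinuousOn (fun w => pPart (A w) i j) (Metric.closedBall z r) := by
      intro i j
      obtain ⟨c, hc⟩ := e i j
      simp only [pPart, Matrix.smul_apply, Matrix.sub_apply, hc, smul_eq_mul]
      exact continuousOn_const.mul ((hA i j).sub (continuousOn_const.mul (hA i j)))
    have h2 : ∀ i j, ContinuousOn (fun w => kPart (A w) i j) (Metric.closedBall z r) := by
      intro i j
      obtain ⟨c, hc⟩ := e i j
      simp only [kPart, Matrix.smul_apply, Matrix.add_apply, hc, smul_eq_mul]
      exact continuousOn_const.mul ((hA i j).add (continuousOn_const.mul (hA i j)))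
    obtain ⟨C₁, -, hC₁⟩ := entrySum_bounded hcpt h1
    obtain ⟨C₂, -, hC₂⟩ := entrySum_bounded hcpt h2
    exact ⟨C₁ + C₂, fun w hw => add_le_add (hC₁ w (Metric.ball_subset_closedBall hw))
      (hC₂ w (Metric.ball_subset_closedBall hw))⟩
  obtain ⟨K₁, hK₁⟩ := hk hZ
  obtain ⟨K₂, hK₂⟩ := hk hB'
  refine loop_value_at_zero (q := fun w lam => Fp w lam *ᵥ x) (A := mcZ F) (B := mcB F)
    (K := max K₁ K₂) (fun w hw => (hK₁ w hw).trans (le_max_left _ _))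
    (fun w hw => (hK₂ w hw).trans (le_max_right _ _)) (fun w hw => ?_)
    (fun w hw lam hl => hB.hasFDerivAt_plus hD hDc h0 (hFr.groupC h0) hE hx hl
      (hball (Metric.ball_subset_closedBall hw))) (Metric.mem_ball_self hr)
  have hp := hB.plus w (hball (Metric.ball_subset_closedBall hw))
  have h1 : ∀ i, DifferentiableOn ℂ (fun lam => (Fp w lam *ᵥ x) i) (Metric.ball 0 1) := fun i => by
    simp only [Matrix.mulVec, dotProduct]
    exact DifferentiableOn.fun_sum fun k _ => ((hp.holomorphic i k).mono fun v hv => by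
      simpa using hv).mul_const _
  have h2 : ∀ i, ContinuousOn (fun lam => (Fp w lam *ᵥ x) i) (Metric.closedBall 0 1) := fun i => by
    simp only [Matrix.mulVec, dotProduct]
    exact continuousOn_finsetSum _ fun k _ => ((hp.continuousOn i k).mono fun v hv => by
      simpa using hv).mul continuousOn_const
  refine ⟨differentiableOn_pi.2 h1, ?_⟩
  rw [closure_ball _ one_ne_zero]
  exact continuousOn_pi.2 h2

end Birkhoff

/-! ### The parallel projector onto an isotropic plane of the normal bundle -/

/-- In the coordinates of a frame `F`, the matrix `Q z` is the Hermitian projector onto an isotropic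
plane of the normal space at `z` that is annihilated by the off-diagonal part of `F⁻¹ F_z`, and `Q`
is parallel at `z` with respect to the normal connection. -/
structure IsParallelProjector (F : ℂ → Mat) (Q : ℂ → Mat) (z : ℂ) : Prop where
  herm : (Q z)ᴴ = Q z
  idem : Q z * Q z = Q z
  trace : (Q z).trace = 2
  iso : Q z * (Q z)ᵀ = 0
  normal : qN * Q z = Q z
  kill : qV * mcZ F z * Q z = 0
  deriv : HasWirt Q (Q z * mcZ F z * qN - qN * mcZ F z * Q z)
    (Q z * mcB F z * qN - qN * mcB F z * Q z) z

/-- The derivative of the inverse of a `2 × 2` matrix. -/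
lemma hasWirt_inv {G : ℂ → Matrix (Fin 2) (Fin 2) ℂ} {A B : Matrix (Fin 2) (Fin 2) ℂ} {z : ℂ}
    (h : HasWirt G A B z) (hdet : (G z).det ≠ 0) :
    HasWirt (fun w => (G w)⁻¹) (-((G z)⁻¹ * A * (G z)⁻¹)) (-((G z)⁻¹ * B * (G z)⁻¹)) z := by
  have hd : ∀ i j, DifferentiableAt ℝ (fun w => G w i j) z := fun i j =>
    (h i j).differentiableAt
  have hdd : DifferentiableAt ℝ (fun w => (G w).det) z := by
    simp only [Matrix.det_fin_two]
    exact ((hd 0 0).mul (hd 1 1)).sub ((hd 0 1).mul (hd 1 0))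
  have hadj : ∀ i j, DifferentiableAt ℝ (fun w => (G w).adjugate i j) z := by
    intro i j
    simp only [Matrix.adjugate_fin_two]
    fin_cases i <;> fin_cases j <;> simp
    exacts [hd 1 1, hd 0 1, hd 1 0, hd 0 0]
  have hinv : ∀ i j, DifferentiableAt ℝ (fun w => (G w)⁻¹ i j) z := by
    intro i j
    simp only [Matrix.inv_def, Ring.inverse_eq_inv', Matrix.smul_apply, smul_eq_mul]
    exact (hdd.inv hdet).mul (hadj i j)
  obtain ⟨a, b, hab⟩ : ∃ a b, HasWirt (fun w => (G w)⁻¹) a b z :=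
    ⟨Matrix.of fun i j => dz (fun w => (G w)⁻¹ i j) z,
      Matrix.of fun i j => dzbar (fun w => (G w)⁻¹ i j) z, fun i j => hasFDerivAt_wirt (hinv i j)⟩
  have h1 := h.mul hab
  have h2 : (fun w => G w * (G w)⁻¹) =ᶠ[𝓝 z] fun _ => 1 := by
    filter_upwards [hdd.continuousAt.eventually_ne hdet] with w hw
    exact Matrix.mul_nonsing_inv _ (isUnit_iff_ne_zero.2 hw)
  obtain ⟨h3, h4⟩ := h1.unique ((HasWirt.const 1 z).congr h2)
  have key : ∀ X Y : Matrix (Fin 2) (Fin 2) ℂ, X * (G z)⁻¹ + G z * Y = 0 →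
      Y = -((G z)⁻¹ * X * (G z)⁻¹) := by
    intro X Y hXY
    have h5 := congrArg (fun M => (G z)⁻¹ * M) hXY
    simp only [mul_add, mul_zero, ← mul_assoc,
      Matrix.nonsing_inv_mul _ (isUnit_iff_ne_zero.2 hdet), one_mul] at h5
    exact (neg_eq_of_add_eq_zero_right h5).symm
  rw [← key _ _ h3, ← key _ _ h4]
  exact hab

/-- The projector `M (Mᴴ M)⁻¹ Mᴴ` onto the column space of `M`. -/
def colProj (M : Matrix (Fin 8) (Fin 2) ℂ) : Mat := M * (Mᴴ * M)⁻¹ * Mᴴ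

/-- If the columns of `M` span an isotropic plane of normal vectors, annihilated by the
off-diagonal part of `F⁻¹ F_z` and invariant under the normal connection, then the projector onto
that plane is parallel. -/
lemma isParallelProjector_colProj {F : ℂ → Mat} {M : ℂ → Matrix (Fin 8) (Fin 2) ℂ} {z : ℂ}
    {Y : Matrix (Fin 2) (Fin 2) ℂ} (hconj : (mcZ F z).map star = mcB F z)
    (hA : (mcZ F z)ᵀ * I17 + I17 * mcZ F z = 0) (hB : (mcB F z)ᵀ * I17 + I17 * mcB F z = 0)
    (hdet : ((M z)ᴴ * M z).det ≠ 0) (hN : qN * M z = M z) (hiso : (M z)ᵀ * M z = 0)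
    (hkill : qV * mcZ F z * M z = 0)
    (hd : HasWirt M (-(qN * mcZ F z * M z) + M z * Y) (-(qN * mcB F z * M z)) z) :
    IsParallelProjector F (fun w => colProj (M w)) z := by
  set A := mcZ F z
  set B := mcB F z
  set m := M z with hm
  set G := mᴴ * m with hG
  have hunit : IsUnit G.det := isUnit_iff_ne_zero.2 hdet
  have hGG : G⁻¹ * G = 1 := Matrix.nonsing_inv_mul _ hunit
  have hGG' : G * G⁻¹ = 1 := Matrix.mul_nonsing_inv _ hunit
  have hGh : Gᴴ = G := by rw [hG, Matrix.conjTranspose_mul, Matrix.conjTranspose_conjTranspose]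
  have hmN : mᴴ * qN = mᴴ := by
    have := congrArg Matrix.conjTranspose hN
    rwa [Matrix.conjTranspose_mul, qN_conjTranspose] at this
  have hmI : mᴴ * I17 = mᴴ := by
    rw [← hmN, Matrix.mul_assoc, qN_mul_I17]
  have hBh : Bᴴ = -(I17 * A * I17) := by
    rw [← transpose_eq_of_skew hA, ← hconj]
    ext i j; simp
  have hAh : Aᴴ = -(I17 * B * I17) := by
    rw [← transpose_eq_of_skew hB, ← hconj]
    rfl
  have e1 : (-(qN * B * m))ᴴ = mᴴ * A * qN := by
    rw [Matrix.conjTranspose_neg, Matrix.conjTranspose_mul, Matrix.conjTranspose_mul,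
      qN_conjTranspose, hBh, Matrix.neg_mul, Matrix.mul_neg, neg_neg]
    calc mᴴ * (I17 * A * I17 * qN) = (mᴴ * I17) * A * (I17 * qN) := by simp only [Matrix.mul_assoc]
      _ = _ := by rw [hmI, I17_mul_qN]
  have e2 : (-(qN * A * m) + m * Y)ᴴ = mᴴ * B * qN + Yᴴ * mᴴ := by
    rw [Matrix.conjTranspose_add, Matrix.conjTranspose_neg, Matrix.conjTranspose_mul,
      Matrix.conjTranspose_mul, qN_conjTranspose, hAh, Matrix.neg_mul, Matrix.mul_neg, neg_neg,
      Matrix.conjTranspose_mul]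
    congr 1
    calc mᴴ * (I17 * B * I17 * qN) = (mᴴ * I17) * B * (I17 * qN) := by simp only [Matrix.mul_assoc]
      _ = _ := by rw [hmI, I17_mul_qN]
  have hdH := hd.conjTranspose
  rw [e1, e2] at hdH
  have hdG := hdH.mul hd
  have g1 : mᴴ * A * qN * m + mᴴ * (-(qN * A * m) + m * Y) = G * Y := by
    rw [Matrix.mul_add, Matrix.mul_neg, Matrix.mul_assoc _ qN, hN, ← Matrix.mul_assoc mᴴ (qN * A),
      ← Matrix.mul_assoc mᴴ qN, hmN, ← Matrix.mul_assoc mᴴ m]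
    abel
  have g2 : (mᴴ * B * qN + Yᴴ * mᴴ) * m + mᴴ * (-(qN * B * m)) = Yᴴ * G := by
    rw [Matrix.add_mul, Matrix.mul_neg, Matrix.mul_assoc _ qN, hN, ← Matrix.mul_assoc mᴴ (qN * B),
      ← Matrix.mul_assoc mᴴ qN, hmN, Matrix.mul_assoc Yᴴ]
    abel
  rw [← hm, g1, g2] at hdG
  have hdI := hasWirt_inv hdG hdet
  rw [← hm, ← hG] at hdI
  have hQ := (hd.mul hdI).mul hdH
  have k1 : G⁻¹ * (G * Y) * G⁻¹ = Y * G⁻¹ := by rw [← Matrix.mul_assoc, hGG, Matrix.one_mul]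
  have k2 : G⁻¹ * (Yᴴ * G) * G⁻¹ = G⁻¹ * Yᴴ := by
    rw [Matrix.mul_assoc, Matrix.mul_assoc, hGG', Matrix.mul_one]
  rw [← hm, ← hG, k1, k2] at hQ
  have hQz : colProj m = m * G⁻¹ * mᴴ := rfl
  constructor
  · change (colProj m)ᴴ = colProj m
    rw [hQz, Matrix.conjTranspose_mul, Matrix.conjTranspose_mul, Matrix.conjTranspose_conjTranspose,
      Matrix.conjTranspose_nonsing_inv, hGh, Matrix.mul_assoc]
  · change colProj m * colProj m = colProj m
    rw [hQz]
    calc m * G⁻¹ * mᴴ * (m * G⁻¹ * mᴴ) = m * (G⁻¹ * (mᴴ * m)) * G⁻¹ * mᴴ := by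
          simp only [Matrix.mul_assoc]
      _ = _ := by rw [← hG, hGG, Matrix.mul_one]
  · change (colProj m).trace = 2
    rw [hQz, Matrix.trace_mul_comm, ← Matrix.mul_assoc, ← hG, hGG', Matrix.trace_one]
    simp
  · change colProj m * (colProj m)ᵀ = 0
    have h1 : mᴴ * mᴴᵀ = 0 := by
      have := congrArg Matrix.conjTranspose hiso
      rw [Matrix.conjTranspose_mul, Matrix.conjTranspose_zero] at this
      exact this
    rw [hQz, Matrix.transpose_mul]
    calc m * G⁻¹ * mᴴ * (mᴴᵀ * (m * G⁻¹)ᵀ) = m * G⁻¹ * (mᴴ * mᴴᵀ) * (m * G⁻¹)ᵀ := by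
          simp only [Matrix.mul_assoc]
      _ = 0 := by rw [h1, Matrix.mul_zero, Matrix.zero_mul]
  · change qN * colProj m = colProj m
    rw [hQz, ← Matrix.mul_assoc, ← Matrix.mul_assoc, hN]
  · change qV * A * colProj m = 0
    rw [hQz, ← Matrix.mul_assoc, ← Matrix.mul_assoc, hkill, Matrix.zero_mul, Matrix.zero_mul]
  · change HasWirt _ (colProj m * A * qN - qN * A * colProj m)
      (colProj m * B * qN - qN * B * colProj m) z
    have l1 : ((-(qN * A * m) + m * Y) * G⁻¹ + m * -(Y * G⁻¹)) * mᴴ + m * G⁻¹ * (mᴴ * A * qN)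
        = colProj m * A * qN - qN * A * colProj m := by
      rw [hQz]
      simp only [Matrix.add_mul, Matrix.mul_neg, Matrix.neg_mul, Matrix.mul_assoc]
      abel
    have l2 : (-(qN * B * m) * G⁻¹ + m * -(G⁻¹ * Yᴴ)) * mᴴ + m * G⁻¹ * (mᴴ * B * qN + Yᴴ * mᴴ)
        = colProj m * B * qN - qN * B * colProj m := by
      rw [hQz]
      simp only [Matrix.add_mul, Matrix.mul_add, Matrix.mul_neg, Matrix.neg_mul, Matrix.mul_assoc]
      abel
    rw [l1, l2] at hQ
    exact hQ

/-- The matrix with columns `isoW`. -/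
def isoMat : Matrix (Fin 8) (Fin 2) ℂ := Matrix.of fun i j => isoW j i

lemma qN_mul_isoMat : qN * isoMat = isoMat := by
  ext i j
  rw [qN, Matrix.diagonal_mul]
  fin_cases i <;> fin_cases j <;> simp [isoMat, isoW]

lemma isoMat_transpose_mul : isoMatᵀ * isoMat = 0 := by
  ext i j
  rw [Matrix.mul_apply]
  fin_cases i <;> fin_cases j <;> simp [isoMat, isoW, Fin.sum_univ_succ]

/-- The plane spanned by the columns of `isoMat` is maximal isotropic in the normal directions. -/
lemma eq_isoMat_mul {X : Matrix (Fin 8) (Fin 2) ℂ} (hN : qN * X = X) (hX : isoMatᵀ * X = 0) :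
    X = isoMat * Matrix.of ![X 4, X 6] := by
  have h1 : ∀ i j, X i j = if (i : ℕ) < 4 then 0 else X i j := by
    intro i j
    conv_lhs => rw [← hN, qN, Matrix.diagonal_mul]
    split_ifs <;> simp
  have h2 : ∀ i j, (isoMatᵀ * X) i j = 0 := fun i j => by rw [hX]; rfl
  have h3 : ∀ j, X 5 j = Complex.I * X 4 j := by
    intro j
    have := h2 0 j
    rw [Matrix.mul_apply] at this
    simp [isoMat, isoW, Fin.sum_univ_succ] at this
    have e : X 4 j + Complex.I * X 5 j = 0 := this
    linear_combination -Complex.I * e + X 5 j * Complex.I_mul_I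
  have h4 : ∀ j, X 7 j = Complex.I * X 6 j := by
    intro j
    have := h2 1 j
    rw [Matrix.mul_apply] at this
    simp [isoMat, isoW, Fin.sum_univ_succ] at this
    have e : X 6 j + Complex.I * X 7 j = 0 := this
    linear_combination -Complex.I * e + X 7 j * Complex.I_mul_I
  ext i j
  rw [Matrix.mul_apply, Fin.sum_univ_two, h1]
  fin_cases i <;> simp [isoMat, isoW, h3, h4]

lemma isoMat_mulVec_injective : Function.Injective isoMat.mulVec := by
  intro v w h
  have h4 := congrFun h 4
  have h6 := congrFun h 6
  simp [Matrix.mulVec, dotProduct, isoMat, isoW] at h4 h6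
  ext j
  fin_cases j
  · exact h4
  · exact h6

section Birkhoff

variable {D P : Set ℂ} {y : ℂ → EuclideanSpace ℝ (Fin 7)} {F : ℂ → Mat} {Fl Fm Fp : ℂ → ℂ → Mat}
  {h : Fin 4 → Fin 2 → ℂ → ℂ} {z : ℂ}

/-- Off the exceptional set, the plus loop at `lam = 0` carries the isotropic plane annihilated by
the potential to a parallel isotropic plane. -/
lemma IsBirkhoff.isParallelProjector (hD : IsOpen D) (hDc : IsPreconnected D) (h0 : (0 : ℂ) ∈ D)
    (hFr : IsFrame D y F) (hE : IsExtendedFrame D F Fl)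
    (hB : IsBirkhoff D P F Fl Fm Fp (isoPotential h)) (hz : z ∈ D \ P) :
    IsParallelProjector F (fun w => colProj (Fp w 0 * isoMat)) z := by
  have hKN : ∀ w ∈ D \ P, qN * Fp w 0 = Fp w 0 * qN := by
    intro w hw
    obtain ⟨-, A₁, A₂, -, -, he⟩ := (hB.plus w hw).at_zero
    rw [he, qN_comm_blocks]
  have hMN : ∀ w ∈ D \ P, qN * (Fp w 0 * isoMat) = Fp w 0 * isoMat := by
    intro w hw
    rw [← Matrix.mul_assoc, hKN w hw, Matrix.mul_assoc, qN_mul_isoMat]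
  have hK : Fp z 0 ∈ groupC := (hB.plus z hz).at_zero.1
  set K := Fp z 0 with hKdef
  set A := mcZ F z with hAdef
  set B := mcB F z with hBdef
  set m := K * isoMat with hm
  have hmN : qN * m = m := hMN z hz
  have hmV : qV * m = 0 := by rw [← hmN, ← Matrix.mul_assoc, qV_mul_qN, Matrix.zero_mul]
  have hmI : I17 * m = m := by rw [← hmN, ← Matrix.mul_assoc, I17_mul_qN]
  obtain ⟨hskA, hskB⟩ := hFr.mc_skew hD hz.1
  have hpl := fun j => hB.plus_at_zero hD hDc h0 hFr hE
    (fun z => isoPotential_mulVec_isoW h z j) hz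
  choose hp0 c hc using hpl
  set C : Matrix (Fin 8) (Fin 2) ℂ := Matrix.of fun i j => c j i with hC
  have hcol : ∀ (N : Mat) (i : Fin 8) (j : Fin 2), (N * isoMat) i j = (N *ᵥ isoW j) i :=
    fun N i j => rfl
  have hpm : pPart A * m = 0 := by
    ext i j
    rw [hm, ← Matrix.mul_assoc, hcol, ← Matrix.mulVec_mulVec]
    exact congrFun (hp0 j) i
  have hkill : qV * A * m = 0 := by
    rw [pPart_eq, Matrix.add_mul, Matrix.mul_assoc _ qV, hmV, Matrix.mul_zero, zero_add,
      Matrix.mul_assoc _ qN, hmN] at hpm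
    exact hpm
  have hkm : ∀ X : Mat, kPart X * m = qN * X * m := by
    intro X
    rw [kPart_eq, Matrix.add_mul, Matrix.mul_assoc _ qN, hmN, Matrix.mul_assoc _ qV, hmV,
      Matrix.mul_zero, add_zero]
  have hd0 : HasWirt (fun w => Fp w 0 * isoMat) (-(pPart A * C + kPart A * m)) (-(kPart B * m))
      z := by
    intro i j
    have h1 := hasFDerivAt_wirt_pi.1 (hc j) i
    simp only [Matrix.mulVec_mulVec] at h1
    rw [hm, ← Matrix.mul_assoc, ← Matrix.mul_assoc]
    exact h1
  have hd1 : HasWirt (fun w => Fp w 0 * isoMat) (qN * -(pPart A * C + kPart A * m))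
      (qN * -(kPart B * m)) z :=
    (hd0.const_mul qN).congr ((hB.eventually_mem hD hz).mono fun w hw => (hMN w hw).symm)
  set U := qN * A * qV * C with hU
  have r1 : qN * -(pPart A * C + kPart A * m) = -(qN * A * m) - U := by
    rw [hkm, pPart_eq, Matrix.mul_neg, Matrix.mul_add, Matrix.add_mul, Matrix.mul_add, hU]
    simp only [← Matrix.mul_assoc, qN_mul_qN, qN_mul_qV, Matrix.zero_mul]
    abel
  have r2 : qN * -(kPart B * m) = -(qN * B * m) := by
    rw [hkm, Matrix.mul_neg]
    simp only [← Matrix.mul_assoc, qN_mul_qN]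
  rw [r1, r2] at hd1
  -- `U` is normal and orthogonal to the isotropic plane, hence takes values in it
  have hUN : qN * U = U := by
    rw [hU]; simp only [← Matrix.mul_assoc, qN_mul_qN]
  have hKinv : qN * K⁻¹ = K⁻¹ * qN := by
    have h1 : qN * K = K * qN := hKN z hz
    calc qN * K⁻¹ = K⁻¹ * (K * qN) * K⁻¹ := by
          rw [← mul_assoc, groupC_inv_mul hK, one_mul]
      _ = K⁻¹ * qN * (K * K⁻¹) := by rw [← h1]; simp only [mul_assoc]
      _ = K⁻¹ * qN := by rw [groupC_mul_inv hK, mul_one]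
  have hmU : mᵀ * U = 0 := by
    have t1 : mᵀ * qN = mᵀ := by
      have := congrArg Matrix.transpose hmN
      rwa [Matrix.transpose_mul, qN_transpose] at this
    have t2 : mᵀ * I17 = mᵀ := by
      have := congrArg Matrix.transpose hmI
      rwa [Matrix.transpose_mul, I17_transpose] at this
    have t3 : mᵀ * Aᵀ * qV = 0 := by
      have := congrArg Matrix.transpose hkill
      rwa [Matrix.transpose_mul (qV * A), Matrix.transpose_mul qV, qV_transpose,
        Matrix.transpose_zero, ← Matrix.mul_assoc] at this
    have t4 : I17 * A = -(Aᵀ * I17) := eq_neg_of_add_eq_zero_right hskA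
    calc mᵀ * U = (mᵀ * qN) * A * qV * C := by rw [hU]; simp only [Matrix.mul_assoc]
      _ = (mᵀ * I17) * A * qV * C := by rw [t1, t2]
      _ = mᵀ * (I17 * A) * qV * C := by simp only [Matrix.mul_assoc]
      _ = -(mᵀ * Aᵀ * (I17 * qV) * C) := by
          rw [t4]; simp only [Matrix.mul_assoc, Matrix.mul_neg, Matrix.neg_mul]
      _ = -((mᵀ * Aᵀ * qV) * I17 * C) := by rw [I17_mul_qV]; simp only [Matrix.mul_assoc]
      _ = 0 := by rw [t3, Matrix.zero_mul, Matrix.zero_mul, neg_zero]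
  have hXN : qN * (K⁻¹ * U) = K⁻¹ * U := by
    rw [← Matrix.mul_assoc, hKinv, Matrix.mul_assoc, hUN]
  have hwI : isoMatᵀ * I17 = isoMatᵀ := by
    have h1 : isoMatᵀ * qN = isoMatᵀ := by
      have := congrArg Matrix.transpose qN_mul_isoMat
      rwa [Matrix.transpose_mul, qN_transpose] at this
    rw [← h1, Matrix.mul_assoc, qN_mul_I17]
  have hX : isoMatᵀ * (K⁻¹ * U) = 0 := by
    rw [groupC_inv hK]
    calc isoMatᵀ * (I17 * Kᵀ * I17 * U) = (isoMatᵀ * I17) * Kᵀ * (I17 * U) := by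
          simp only [Matrix.mul_assoc]
      _ = mᵀ * (I17 * (qN * U)) := by rw [hwI, hUN, hm, Matrix.transpose_mul]
      _ = 0 := by rw [← Matrix.mul_assoc I17, I17_mul_qN, hUN, hmU]
  set Y := Matrix.of ![(K⁻¹ * U) 4, (K⁻¹ * U) 6]
  have hUY : U = m * Y := by
    have h1 : K⁻¹ * U = isoMat * Y := eq_isoMat_mul hXN hX
    rw [hm, Matrix.mul_assoc, ← h1, ← Matrix.mul_assoc, groupC_mul_inv hK, Matrix.one_mul]
  have hiso : mᵀ * m = 0 := by
    calc mᵀ * m = mᵀ * (I17 * m) := by rw [hmI]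
      _ = isoMatᵀ * (Kᵀ * I17 * K) * isoMat := by
          rw [hm, Matrix.transpose_mul]; simp only [Matrix.mul_assoc]
      _ = 0 := by rw [hK.1, hwI, isoMat_transpose_mul]
  have hinj : Function.Injective m.mulVec := by
    intro v w hvw
    have h1 := congrArg (fun x => K⁻¹ *ᵥ x) hvw
    simp only [hm, Matrix.mulVec_mulVec, ← Matrix.mul_assoc, groupC_inv_mul hK,
      Matrix.one_mul] at h1
    exact isoMat_mulVec_injective h1
  have hdet : (mᴴ * m).det ≠ 0 := open scoped ComplexOrder in
    (Matrix.PosDef.conjTranspose_mul_self m hinj).det_pos.ne'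
  refine isParallelProjector_colProj (Y := -Y) (hFr.mc_conj hD hz.1) hskA hskB hdet hmN hiso hkill ?_
  rw [Matrix.mul_neg, ← hKdef, ← hm, ← hUY, ← sub_eq_add_neg]
  exact hd1

end Birkhoff

/-! ### Extension of parallel projectors across isolated points -/

section Removable

variable {f : ℂ → ℂ} {f' : ℂ → ℂ →L[ℝ] ℂ} {z₀ : ℂ} {r C : ℝ}

/-- On a punctured disk, a bound for the derivative gives a Lipschitz bound: a segment through the
centre is replaced by the two legs of a right isosceles triangle. -/
lemma norm_sub_le_of_punctured
    (hf : ∀ w ∈ Metric.ball z₀ r, w ≠ z₀ → HasFDerivAt f (f' w) w ∧ ‖f' w‖ ≤ C)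
    {a b : ℂ} (ha : a ∈ Metric.ball z₀ (r / 4)) (hb : b ∈ Metric.ball z₀ (r / 4))
    (ha0 : a ≠ z₀) (hb0 : b ≠ z₀) : ‖f b - f a‖ ≤ 2 * C * ‖b - a‖ := by
  have hr : 0 < r := by linarith [Metric.pos_of_mem_ball ha]
  have hsub : Metric.ball z₀ (r / 4) ⊆ Metric.ball z₀ r := Metric.ball_subset_ball (by linarith)
  have hC : 0 ≤ C := (norm_nonneg _).trans (hf a (hsub ha) ha0).2
  have hseg : ∀ a b : ℂ, a ∈ Metric.ball z₀ r → b ∈ Metric.ball z₀ r → z₀ ∉ segment ℝ a b →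
      ‖f b - f a‖ ≤ C * ‖b - a‖ := by
    intro a b ha hb hn
    have hmem : ∀ x ∈ segment ℝ a b, x ∈ Metric.ball z₀ r ∧ x ≠ z₀ := fun x hx =>
      ⟨(convex_ball z₀ r).segment_subset ha hb hx, fun e => hn (e ▸ hx)⟩
    exact (convex_segment a b).norm_image_sub_le_of_norm_hasFDerivWithin_le
      (fun x hx => (hf x (hmem x hx).1 (hmem x hx).2).1.hasFDerivWithinAt)
      (fun x hx => (hf x (hmem x hx).1 (hmem x hx).2).2) (left_mem_segment ℝ a b)
      (right_mem_segment ℝ a b)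
  by_cases hn : z₀ ∈ segment ℝ a b
  · obtain ⟨t, ht, rfl⟩ := segment_eq_image' ℝ a b ▸ hn
    simp only [Complex.real_smul] at *
    have hab : b - a ≠ 0 := by
      intro e; rw [e] at ha0; simp at ha0
    have ht0 : t ≠ 0 := by
      rintro rfl; simp at ha0
    have ht1 : t ≠ 1 := by
      rintro rfl; simp at hb0
    set c := a + (1 + Complex.I) / 2 * (b - a) with hc
    have hn1 : ‖(1 + Complex.I) / 2‖ ≤ 1 := by
      rw [norm_div]
      have := norm_add_le (1 : ℂ) Complex.I
      simp at this ⊢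
      linarith
    have hn2 : ‖(1 - Complex.I) / 2‖ ≤ 1 := by
      rw [norm_div]
      have := norm_sub_le (1 : ℂ) Complex.I
      simp at this ⊢
      linarith
    have hca : ‖c - a‖ ≤ ‖b - a‖ := by
      rw [hc, add_sub_cancel_left, norm_mul]
      exact mul_le_of_le_one_left (norm_nonneg _) hn1
    have hbc : ‖b - c‖ ≤ ‖b - a‖ := by
      rw [hc, show b - (a + (1 + Complex.I) / 2 * (b - a)) = (1 - Complex.I) / 2 * (b - a) by ring,
        norm_mul]
      exact mul_le_of_le_one_left (norm_nonneg _) hn2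
    have hcb : c ∈ Metric.ball (a + t * (b - a)) r := by
      rw [Metric.mem_ball, dist_eq_norm] at ha hb ⊢
      have h1 : ‖b - a‖ < r / 4 + r / 4 := by
        calc ‖b - a‖ = ‖(b - (a + t * (b - a))) - (a - (a + t * (b - a)))‖ := by congr 1; ring
          _ ≤ _ := norm_sub_le _ _
          _ < _ := add_lt_add hb ha
      calc _ = ‖(c - a) + (a - (a + t * (b - a)))‖ := by congr 1; ring
        _ ≤ _ := norm_add_le _ _
        _ < r := by linarith
    have h1 := hseg a c (hsub ha) hcb (by
      rw [segment_eq_image']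
      rintro ⟨s, -, hs⟩
      simp only [Complex.real_smul, hc] at hs
      have e : ((s : ℂ) * ((1 + Complex.I) / 2) - t) * (b - a) = 0 := by linear_combination hs
      have e1 := (mul_eq_zero.1 e).resolve_right hab
      have eim := congrArg Complex.im e1
      have ere := congrArg Complex.re e1
      simp at eim ere
      exact ht0 (by rw [eim] at ere; simpa using ere))
    have h2 := hseg c b hcb (hsub hb) (by
      rw [segment_eq_image']
      rintro ⟨s, -, hs⟩
      simp only [Complex.real_smul, hc] at hs
      have e : ((1 - s : ℂ) * ((1 + Complex.I) / 2) + s - t) * (b - a) = 0 := by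
        linear_combination hs
      have e1 := (mul_eq_zero.1 e).resolve_right hab
      have eim := congrArg Complex.im e1
      have ere := congrArg Complex.re e1
      simp at eim ere
      exact ht1 (by linarith))
    calc ‖f b - f a‖ = ‖(f b - f c) + (f c - f a)‖ := by congr 1; ring
      _ ≤ ‖f b - f c‖ + ‖f c - f a‖ := norm_add_le _ _
      _ ≤ C * ‖b - c‖ + C * ‖c - a‖ := add_le_add h2 h1
      _ ≤ C * ‖b - a‖ + C * ‖b - a‖ := by gcongr
      _ = 2 * C * ‖b - a‖ := by ring
  · refine (hseg a b (hsub ha) (hsub hb) hn).trans ?_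
    nlinarith [norm_nonneg (b - a), mul_nonneg hC (norm_nonneg (b - a))]

/-- A map with bounded derivative on a punctured disk has a limit at the centre. -/
lemma exists_tendsto_of_punctured (hr : 0 < r)
    (hf : ∀ w ∈ Metric.ball z₀ r, w ≠ z₀ → HasFDerivAt f (f' w) w ∧ ‖f' w‖ ≤ C) :
    ∃ L, Filter.Tendsto f (𝓝[≠] z₀) (𝓝 L) := by
  refine cauchy_map_iff_exists_tendsto.1 ?_
  rw [Metric.cauchy_iff]
  refine ⟨inferInstance, fun ε hε => ?_⟩
  set δ := min (r / 4) (ε / (4 * (|C| + 1))) with hδ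
  have hδ0 : 0 < δ := by positivity
  refine ⟨f '' (Metric.ball z₀ δ \ {z₀}), Filter.image_mem_map
    (sdiff_mem_nhdsWithin_compl (Metric.ball_mem_nhds z₀ hδ0) _), ?_⟩
  rintro _ ⟨a, ⟨ha, ha0⟩, rfl⟩ _ ⟨b, ⟨hb, hb0⟩, rfl⟩
  have hs : Metric.ball z₀ δ ⊆ Metric.ball z₀ (r / 4) := Metric.ball_subset_ball (min_le_left _ _)
  have h1 := norm_sub_le_of_punctured hf (hs hb) (hs ha) hb0 ha0
  rw [dist_eq_norm]
  have h2 : ‖a - b‖ < 2 * δ := by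
    rw [← dist_eq_norm]
    calc dist a b ≤ dist a z₀ + dist b z₀ := dist_triangle_right _ _ _
      _ < 2 * δ := by rw [two_mul]; exact add_lt_add ha hb
  have h3 : δ * (4 * (|C| + 1)) ≤ ε := by
    rw [← le_div_iff₀ (by positivity)]; exact min_le_right _ _
  have h4 : C ≤ |C| := le_abs_self C
  have h5 : C * ‖a - b‖ ≤ |C| * (2 * δ) :=
    mul_le_mul h4 h2.le (norm_nonneg _) (abs_nonneg _)
  nlinarith

/-- A map that is continuous at `z₀` and whose derivative exists off `z₀` and extends continuously
to `z₀` is differentiable at `z₀`. -/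
lemma hasFDerivAt_of_punctured (hr : 0 < r)
    (hf : ∀ w ∈ Metric.ball z₀ r, w ≠ z₀ → HasFDerivAt f (f' w) w)
    (hc : ContinuousAt f z₀) (hc' : ContinuousAt f' z₀) : HasFDerivAt f (f' z₀) z₀ := by
  rw [hasFDerivAt_iff_isLittleO, Asymptotics.isLittleO_iff]
  intro ε hε
  obtain ⟨δ, hδ, hδε⟩ := Metric.continuousAt_iff.1 hc' ε hε
  filter_upwards [Metric.ball_mem_nhds z₀ (lt_min hδ hr)] with z hz
  rcases eq_or_ne z z₀ with rfl | hne
  · simp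
  have hz' : ‖z - z₀‖ < min δ r := by rw [← dist_eq_norm]; exact hz
  have hγd : ∀ t : ℝ, HasDerivAt (fun t : ℝ => z + (t : ℂ) * (z₀ - z)) (z₀ - z) t := by
    intro t
    simpa using ((Complex.ofRealCLM.hasDerivAt (x := t)).mul_const (z₀ - z)).const_add z
  have hγ : ∀ t ∈ Set.Ico (0 : ℝ) 1, dist (z + (t : ℂ) * (z₀ - z)) z₀ < min δ r ∧
      z + (t : ℂ) * (z₀ - z) ≠ z₀ := by
    intro t ht
    have e : z + (t : ℂ) * (z₀ - z) - z₀ = ((1 - t : ℝ) : ℂ) * (z - z₀) := by push_cast; ring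
    constructor
    · rw [dist_eq_norm, e, norm_mul, Complex.norm_real, Real.norm_of_nonneg (by linarith [ht.2])]
      refine lt_of_le_of_lt ?_ hz'
      exact mul_le_of_le_one_left (norm_nonneg _) (by linarith [ht.1])
    · rw [← sub_ne_zero, e]
      refine mul_ne_zero ?_ (sub_ne_zero.2 hne)
      exact_mod_cast (by linarith [ht.2] : (1 - t) ≠ 0)
  have hd : ∀ t ∈ Set.Ico (0 : ℝ) 1, HasDerivAt
      (fun t : ℝ => f (z + (t : ℂ) * (z₀ - z)) - f' z₀ (z + (t : ℂ) * (z₀ - z)))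
      (f' (z + (t : ℂ) * (z₀ - z)) (z₀ - z) - f' z₀ (z₀ - z)) t := fun t ht =>
    ((hf _ ((hγ t ht).1.trans_le (min_le_right _ _)) (hγ t ht).2).comp_hasDerivAt t (hγd t)).sub
      ((f' z₀).hasFDerivAt.comp_hasDerivAt t (hγd t))
  have hcont : ContinuousOn
      (fun t : ℝ => f (z + (t : ℂ) * (z₀ - z)) - f' z₀ (z + (t : ℂ) * (z₀ - z)))
      (Set.Icc 0 1) := by
    intro t ht
    rcases eq_or_lt_of_le ht.2 with rfl | hlt
    · refine ContinuousAt.continuousWithinAt (ContinuousAt.sub ?_ ?_)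
      · refine ContinuousAt.comp (f := fun t : ℝ => z + (t : ℂ) * (z₀ - z)) ?_
          (hγd 1).continuousAt
        simpa using hc
      · exact (f' z₀).continuous.continuousAt.comp (hγd 1).continuousAt
    · exact (hd t ⟨ht.1, hlt⟩).continuousAt.continuousWithinAt
  have h := norm_image_sub_le_of_norm_deriv_right_le_segment (C := ε * ‖z - z₀‖) hcont
    (fun t ht => (hd t ht).hasDerivWithinAt) (fun t ht => by
      rw [← sub_apply, norm_sub_rev z z₀]
      refine (ContinuousLinearMap.le_opNorm _ _).trans ?_
      gcongr
      rw [← dist_eq_norm]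
      exact (hδε ((hγ t ht).1.trans_le (min_le_left _ _))).le) 1 (by simp)
  have e : f z - f z₀ - f' z₀ (z - z₀) = -((f (z + (1 : ℝ) * (z₀ - z))
      - f' z₀ (z + (1 : ℝ) * (z₀ - z))) - (f (z + (0 : ℝ) * (z₀ - z))
      - f' z₀ (z + (0 : ℝ) * (z₀ - z)))) := by
    simp only [Complex.ofReal_one, one_mul, add_sub_cancel, Complex.ofReal_zero, zero_mul, add_zero,
      map_sub]
    ring
  rw [e, norm_neg]
  simpa using h

end Removable

section EntrySum

lemma norm_entry_le (X : Mat) (i j : Fin 8) : ‖X i j‖ ≤ entrySum X :=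
  (Finset.single_le_sum (f := fun j => ‖X i j‖) (fun _ _ => norm_nonneg _)
    (Finset.mem_univ j)).trans
  (Finset.single_le_sum (f := fun i => ∑ j, ‖X i j‖)
    (fun _ _ => by positivity) (Finset.mem_univ i))

lemma entrySum_nonneg (X : Mat) : 0 ≤ entrySum X := by unfold entrySum; positivity

lemma entrySum_mul_le (X Y : Mat) : entrySum (X * Y) ≤ entrySum X * entrySum Y := by
  calc entrySum (X * Y) ≤ ∑ i, ∑ j, ∑ k, ‖X i k‖ * ‖Y k j‖ := by
        refine Finset.sum_le_sum fun i _ => Finset.sum_le_sum fun j _ => ?_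
        rw [Matrix.mul_apply]
        refine (norm_sum_le _ _).trans (Finset.sum_le_sum fun k _ => (norm_mul _ _).le)
    _ = ∑ i, ∑ k, ‖X i k‖ * ∑ j, ‖Y k j‖ := by
        refine Finset.sum_congr rfl fun i _ => ?_
        rw [Finset.sum_comm]
        simp only [Finset.mul_sum]
    _ ≤ ∑ i, ∑ k, ‖X i k‖ * entrySum Y := by
        gcongr with i _ k _
        exact Finset.single_le_sum (f := fun i => ∑ j, ‖Y i j‖)
          (fun _ _ => by positivity) (Finset.mem_univ k)
    _ = entrySum X * entrySum Y := by simp only [entrySum, Finset.sum_mul]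

lemma entrySum_sub_le (X Y : Mat) : entrySum (X - Y) ≤ entrySum X + entrySum Y := by
  simp only [entrySum, ← Finset.sum_add_distrib]
  exact Finset.sum_le_sum fun i _ => Finset.sum_le_sum fun j _ => norm_sub_le _ _

/-- The entries of a Hermitian projector of trace two are bounded. -/
lemma entrySum_projector_le {Q : Mat} (h1 : Qᴴ = Q) (h2 : Q * Q = Q) (h3 : Q.trace = 2) :
    entrySum Q ≤ 128 := by
  have h4 : (Q * Qᴴ).trace = 2 := by rw [h1, h2, h3]
  have h5 : ∑ i, ∑ j, ‖Q i j‖ ^ 2 = 2 := by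
    have : (((∑ i, ∑ j, ‖Q i j‖ ^ 2 : ℝ)) : ℂ) = 2 := by
      rw [← h4]
      simp only [Matrix.trace, Matrix.diag, Matrix.mul_apply, Matrix.conjTranspose_apply]
      push_cast
      refine Finset.sum_congr rfl fun i _ => Finset.sum_congr rfl fun j _ => ?_
      rw [← Complex.mul_conj']; rfl
    exact_mod_cast this
  have h6 : ∀ i j, ‖Q i j‖ ≤ 2 := by
    intro i j
    have h7 : ‖Q i j‖ ^ 2 ≤ 2 := by
      rw [← h5]
      exact (Finset.single_le_sum (f := fun j => ‖Q i j‖ ^ 2) (fun _ _ => by positivity)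
        (Finset.mem_univ j)).trans (Finset.single_le_sum (f := fun i => ∑ j, ‖Q i j‖ ^ 2)
        (fun _ _ => by positivity) (Finset.mem_univ i))
    nlinarith [norm_nonneg (Q i j)]
  calc entrySum Q ≤ ∑ i : Fin 8, ∑ j : Fin 8, (2 : ℝ) :=
        Finset.sum_le_sum fun i _ => Finset.sum_le_sum fun j _ => h6 i j
    _ = 128 := by norm_num

end EntrySum

section Extension

variable {D : Set ℂ} {y : ℂ → EuclideanSpace ℝ (Fin 7)} {F : ℂ → Mat} {Q : ℂ → Mat} {z₀ : ℂ}

lemma IsParallelProjector.congr {Q' : ℂ → Mat} {z : ℂ} (h : IsParallelProjector F Q z)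
    (e : Q' =ᶠ[𝓝 z] Q) : IsParallelProjector F Q' z := by
  have hz := e.self_of_nhds
  obtain ⟨h1, h2, h3, h4, h5, h6, h7⟩ := h
  constructor <;> rw [hz]
  exacts [h1, h2, h3, h4, h5, h6, h7.congr e]

lemma continuousAt_wirt {a b : ℂ → ℂ} {z : ℂ} (ha : ContinuousAt a z) (hb : ContinuousAt b z) :
    ContinuousAt (fun w => wirt (a w) (b w)) z :=
  ContinuousAt.comp (g := fun p : ℂ × ℂ => wirt p.1 p.2) (f := fun w => (a w, b w))
    (isBoundedLinearMap_wirt (E := ℂ)).continuous.continuousAt (ha.prodMk hb)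

lemma continuousAt_bracket {X Y : ℂ → Mat} {z : ℂ} (hX : ContinuousAt X z)
    (hY : ContinuousAt Y z) (i j : Fin 8) :
    ContinuousAt (fun w => (X w * Y w * qN - qN * Y w * X w) i j) z := by
  have h1 : Continuous fun p : Mat × Mat => (p.1 * p.2 * qN - qN * p.2 * p.1) i j := by
    fun_prop
  exact ContinuousAt.comp (g := fun p : Mat × Mat => (p.1 * p.2 * qN - qN * p.2 * p.1) i j)
    (f := fun w => (X w, Y w)) h1.continuousAt (hX.prodMk hY)

/-- A parallel projector extends across an isolated point: its derivative is bounded by the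
linear equation `dQ = [Q, α₀]`. -/
lemma exists_parallelProjector_extension (hD : IsOpen D) (hFr : IsFrame D y F) (hz₀ : z₀ ∈ D)
    (h : ∀ᶠ w in 𝓝[≠] z₀, IsParallelProjector F Q w) :
    ∃ Q' : ℂ → Mat, ∀ᶠ w in 𝓝 z₀, IsParallelProjector F Q' w := by
  have hZc := fun i j => (hFr.contDiffOn_mcZ hD i j).continuousOn
  have hBc := fun i j => (hFr.contDiffOn_mcB hD i j).continuousOn
  rw [eventually_nhdsWithin_iff] at h
  obtain ⟨r, hr, hball⟩ := Metric.nhds_basis_closedBall.mem_iff.1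
    (Filter.inter_mem h (hD.mem_nhds hz₀))
  have hsub : Metric.closedBall z₀ r ⊆ D := fun w hw => (hball hw).2
  have hQ : ∀ w ∈ Metric.ball z₀ r, w ≠ z₀ → IsParallelProjector F Q w := fun w hw hne =>
    (hball (Metric.ball_subset_closedBall hw)).1 hne
  obtain ⟨CA, hCA0, hCA⟩ := entrySum_bounded (isCompact_closedBall z₀ r)
    fun i j => (hZc i j).mono hsub
  obtain ⟨CB, hCB0, hCB⟩ := entrySum_bounded (isCompact_closedBall z₀ r)
    fun i j => (hBc i j).mono hsub
  -- a bound for the derivative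
  have hbd : ∀ (X Y : Mat) (c : ℝ), 0 ≤ c → entrySum X ≤ 128 → entrySum Y ≤ c →
      entrySum (X * Y * qN - qN * Y * X) ≤ 2 * (128 * c * entrySum qN) := by
    intro X Y c hc hX hY
    have h0 := entrySum_nonneg
    refine (entrySum_sub_le _ _).trans ?_
    have h1 : entrySum (X * Y * qN) ≤ 128 * c * entrySum qN := by
      refine (entrySum_mul_le _ _).trans ?_
      exact mul_le_mul_of_nonneg_right ((entrySum_mul_le _ _).trans
        (mul_le_mul hX hY (h0 _) (by norm_num))) (h0 _)
    have h2 : entrySum (qN * Y * X) ≤ entrySum qN * c * 128 := by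
      refine (entrySum_mul_le _ _).trans ?_
      refine mul_le_mul ((entrySum_mul_le _ _).trans ?_) hX (h0 _) (mul_nonneg (h0 _) hc)
      exact mul_le_mul_of_nonneg_left hY (h0 _)
    linarith
  have hlim : ∀ i j, ∃ L, Filter.Tendsto (fun w => Q w i j) (𝓝[≠] z₀) (𝓝 L) := by
    intro i j
    refine exists_tendsto_of_punctured (r := r)
      (C := 2 * (128 * CA * entrySum qN) + 2 * (128 * CB * entrySum qN))
      (f' := fun w => wirt ((Q w * mcZ F w * qN - qN * mcZ F w * Q w) i j)
        ((Q w * mcB F w * qN - qN * mcB F w * Q w) i j)) hr fun w hw hne => ?_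
    have hp := hQ w hw hne
    have hs := entrySum_projector_le hp.herm hp.idem hp.trace
    have hw' := Metric.ball_subset_closedBall hw
    exact ⟨hp.deriv i j, (norm_wirt_le _ _).trans (add_le_add
      ((norm_entry_le _ _ _).trans (hbd _ _ _ hCA0 hs (hCA w hw')))
      ((norm_entry_le _ _ _).trans (hbd _ _ _ hCB0 hs (hCB w hw'))))⟩
  choose L hL using hlim
  set Lm : Mat := Matrix.of L
  set Q' : ℂ → Mat := Function.update Q z₀ Lm with hQ'
  have hLm : Filter.Tendsto Q (𝓝[≠] z₀) (𝓝 Lm) :=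
    tendsto_pi_nhds.2 fun i => tendsto_pi_nhds.2 fun j => hL i j
  have hAlim : Filter.Tendsto (mcZ F) (𝓝[≠] z₀) (𝓝 (mcZ F z₀)) :=
    tendsto_pi_nhds.2 fun i => tendsto_pi_nhds.2 fun j =>
      ((hZc i j).continuousAt (hD.mem_nhds hz₀)).tendsto.mono_left nhdsWithin_le_nhds
  have hQ'z : Q' z₀ = Lm := Function.update_self _ _ _
  have hne : ∀ w, w ≠ z₀ → Q' =ᶠ[𝓝 w] Q := fun w hw => by
    filter_upwards [isOpen_ne.mem_nhds hw] with v hv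
    exact Function.update_of_ne hv _ _
  have hev : ∀ᶠ w in 𝓝[≠] z₀, IsParallelProjector F Q w := by
    rw [eventually_nhdsWithin_iff]; exact h
  have hlimeq : ∀ φ ψ : Mat × Mat → Mat, Continuous φ → Continuous ψ →
      (∀ w, IsParallelProjector F Q w → φ (Q w, mcZ F w) = ψ (Q w, mcZ F w)) →
      φ (Lm, mcZ F z₀) = ψ (Lm, mcZ F z₀) := by
    intro φ ψ hφ hψ he
    have h1 := hLm.prodMk_nhds hAlim
    refine tendsto_nhds_unique ((hφ.tendsto _).comp h1) ((hψ.tendsto _).comp h1 |>.congr' ?_)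
    exact hev.mono fun w hw => (he w hw).symm
  have hcont : ∀ i j, ContinuousAt (fun w => Q' w i j) z₀ := by
    intro i j
    rw [continuousAt_iff_punctured_nhds]
    simp only [hQ'z]
    refine (hL i j).congr' ?_
    filter_upwards [self_mem_nhdsWithin] with w hw
    rw [(hne w hw).self_of_nhds]
  have hcontM : ContinuousAt Q' z₀ := continuousAt_pi.2 fun i => continuousAt_pi.2 (hcont i)
  have hZ0 : ContinuousAt (mcZ F) z₀ := continuousAt_pi.2 fun i => continuousAt_pi.2 fun j =>
    (hZc i j).continuousAt (hD.mem_nhds hz₀)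
  have hB0 : ContinuousAt (mcB F) z₀ := continuousAt_pi.2 fun i => continuousAt_pi.2 fun j =>
    (hBc i j).continuousAt (hD.mem_nhds hz₀)
  refine ⟨Q', Filter.eventually_of_mem (Metric.ball_mem_nhds z₀ hr) fun w hw => ?_⟩
  rcases eq_or_ne w z₀ with rfl | hw0
  · constructor
    · rw [hQ'z]
      exact hlimeq (fun p => p.1ᴴ) (fun p => p.1) (by fun_prop) (by fun_prop) fun w hw => hw.herm
    · rw [hQ'z]
      exact hlimeq (fun p => p.1 * p.1) (fun p => p.1) (by fun_prop) (by fun_prop)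
        fun w hw => hw.idem
    · rw [hQ'z]
      have h1 : Filter.Tendsto (fun v => (Q v).trace) (𝓝[≠] w) (𝓝 Lm.trace) :=
        (continuous_id.matrix_trace.tendsto Lm).comp hLm
      exact tendsto_nhds_unique h1 (tendsto_const_nhds.congr' (hev.mono fun v hv => hv.trace.symm))
    · rw [hQ'z]
      exact hlimeq (fun p => p.1 * p.1ᵀ) (fun p => 0) (by fun_prop) (by fun_prop)
        fun w hw => hw.iso
    · rw [hQ'z]
      exact hlimeq (fun p => qN * p.1) (fun p => p.1) (by fun_prop) (by fun_prop)
        fun w hw => hw.normal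
    · rw [hQ'z]
      exact hlimeq (fun p => qV * p.2 * p.1) (fun p => 0) (by fun_prop) (by fun_prop)
        fun w hw => hw.kill
    · intro i j
      refine hasFDerivAt_of_punctured (r := r) (f := fun v => Q' v i j)
        (f' := fun v => wirt ((Q' v * mcZ F v * qN - qN * mcZ F v * Q' v) i j)
        ((Q' v * mcB F v * qN - qN * mcB F v * Q' v) i j)) hr (fun v hv hv0 => ?_) (hcont i j) ?_
      · exact ((hQ v hv hv0).congr (hne v hv0)).deriv i j
      · exact continuousAt_wirt (continuousAt_bracket hcontM hZ0 i j)
          (continuousAt_bracket hcontM hB0 i j)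
  · exact (hQ w hw hw0).congr (hne w hw0)

/-- Solutions of the linear equation `dQ = [Q, α₀]` are smooth. -/
lemma contDiffOn_parallelProjector {U : Set ℂ} (hU : IsOpen U)
    (hA : ∀ i j, ContDiffOn ℝ ∞ (fun w => mcZ F w i j) U)
    (hB : ∀ i j, ContDiffOn ℝ ∞ (fun w => mcB F w i j) U)
    (h : ∀ w ∈ U, IsParallelProjector F Q w) (i j : Fin 8) :
    ContDiffOn ℝ ∞ (fun w => Q w i j) U := by
  have key : ∀ k : ℕ, ∀ i j, ContDiffOn ℝ k (fun w => Q w i j) U := by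
    intro k
    induction k with
    | zero =>
      intro i j
      exact contDiffOn_zero.2 fun w hw => ((h w hw).deriv i j).continuousAt.continuousWithinAt
    | succ k ih =>
      intro i j
      rw [Nat.cast_succ, contDiffOn_succ_iff_fderiv_of_isOpen hU]
      refine ⟨fun w hw => ((h w hw).deriv i j).differentiableAt.differentiableWithinAt,
        by simp, ?_⟩
      have hc : ∀ {X : ℂ → Mat}, (∀ i j, ContDiffOn ℝ ∞ (fun w => X w i j) U) →
          ContDiffOn ℝ k (fun w => (Q w * X w * qN - qN * X w * Q w) i j) U := by
        intro X hX
        have hX' : ∀ i j, ContDiffOn ℝ k (fun w => X w i j) U := fun i j =>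
          (hX i j).of_le (by exact_mod_cast le_top)
        have hq : ∀ i j, ContDiffOn ℝ k (fun _ : ℂ => qN i j) U := fun i j => contDiffOn_const
        exact (contDiffOn_mul (contDiffOn_mul ih hX') hq i j).sub
          (contDiffOn_mul (contDiffOn_mul hq hX') ih i j)
      refine (isBoundedLinearMap_wirt.contDiff.comp_contDiffOn
        ((hc hA).prodMk (hc hB))).congr fun w hw => ?_
      exact ((h w hw).deriv i j).fderiv
  exact contDiffOn_infty.2 fun k => key k i j

end Extension

section Algebra

variable {F Q : ℂ → Mat} {z : ℂ}

lemma eq_zero_of_projector_trace_zero {R : Mat} (h1 : Rᴴ = R) (h2 : R * R = R)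
    (h3 : R.trace = 0) : R = 0 := by
  open scoped ComplexOrder in
  refine Matrix.trace_conjTranspose_mul_self_eq_zero_iff.1 ?_
  rw [h1, h2, h3]

/-- An isotropic plane and its conjugate span the four-dimensional normal space. -/
lemma IsParallelProjector.add_transpose (h : IsParallelProjector F Q z) :
    Q z + (Q z)ᵀ = qN := by
  have h1 : (Q z)ᵀᴴ = (Q z)ᵀ := by
    conv_rhs => rw [← h.herm]
    rfl
  have h2 : (Q z)ᵀ * (Q z)ᵀ = (Q z)ᵀ := by rw [← Matrix.transpose_mul, h.idem]
  have h3 : (Q z)ᵀ * Q z = 0 := by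
    have e3 : ((Q z * (Q z)ᵀ).map star) = 0 := by rw [h.iso]; ext; simp
    rw [map_star_mul] at e3
    have e4 : (Q z).map star = (Q z)ᵀ := by
      conv_rhs => rw [← h.herm]
      rfl
    have e5 : (Q z)ᵀ.map star = Q z := by
      rw [← e4]; ext; simp
    rwa [e4, e5] at e3
  have h5 : Q z * qN = Q z := by
    have := congrArg Matrix.conjTranspose h.normal
    rwa [Matrix.conjTranspose_mul, qN_conjTranspose, h.herm] at this
  have h6 : qN * (Q z)ᵀ = (Q z)ᵀ := by
    have := congrArg Matrix.transpose h5
    rwa [Matrix.transpose_mul, qN_transpose] at this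
  have h7 : (Q z)ᵀ * qN = (Q z)ᵀ := by
    have := congrArg Matrix.transpose h.normal
    rwa [Matrix.transpose_mul, qN_transpose] at this
  have h8 : qN - Q z - (Q z)ᵀ = 0 := by
    refine eq_zero_of_projector_trace_zero ?_ ?_ ?_
    · rw [Matrix.conjTranspose_sub, Matrix.conjTranspose_sub, qN_conjTranspose, h.herm, h1]
    · simp only [mul_sub, sub_mul, qN_mul_qN, h.normal, h5, h6, h7, h.idem, h2, h.iso, h3]
      abel
    · rw [Matrix.trace_sub, Matrix.trace_sub, Matrix.trace_transpose, trace_qN, h.trace]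
      norm_num
  rw [sub_sub, sub_eq_zero] at h8
  exact h8.symm

lemma IsParallelProjector.transpose_mul_self (h : IsParallelProjector F Q z) :
    (Q z)ᵀ * Q z = 0 := by
  have e : (Q z)ᵀ = qN - Q z := by rw [← h.add_transpose, add_sub_cancel_left]
  rw [e, sub_mul, h.normal, h.idem, sub_self]

/-- The normal components of the derivatives of sections of `V` lie in the isotropic plane. -/
lemma IsParallelProjector.normal_block (h : IsParallelProjector F Q z)
    (hA : (mcZ F z)ᵀ * I17 + I17 * mcZ F z = 0) :
    qN * mcZ F z * qV = Q z * mcZ F z * qV := by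
  have h1 : (Q z)ᵀ * mcZ F z * qV = 0 := by
    have t1 : (Q z)ᵀ * (mcZ F z)ᵀ * qV = 0 := by
      have := congrArg Matrix.transpose h.kill
      rwa [Matrix.transpose_mul, Matrix.transpose_mul, qV_transpose, Matrix.transpose_zero,
        ← mul_assoc] at this
    have t2 : (Q z)ᵀ * I17 = (Q z)ᵀ := by
      have := congrArg Matrix.transpose h.normal
      rw [Matrix.transpose_mul, qN_transpose] at this
      rw [← this, mul_assoc, qN_mul_I17]
    have t3 : I17 * mcZ F z = -((mcZ F z)ᵀ * I17) := eq_neg_of_add_eq_zero_right hA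
    calc (Q z)ᵀ * mcZ F z * qV = (Q z)ᵀ * (I17 * mcZ F z) * qV := by rw [← mul_assoc, t2]
      _ = -((Q z)ᵀ * (mcZ F z)ᵀ * (I17 * qV)) := by
          rw [t3]; simp only [mul_neg, neg_mul, mul_assoc]
      _ = -(((Q z)ᵀ * (mcZ F z)ᵀ * qV) * I17) := by rw [I17_mul_qV]; simp only [mul_assoc]
      _ = 0 := by rw [t1, zero_mul, neg_zero]
  rw [← h.add_transpose, add_mul, add_mul, h1, add_zero]

end Algebra

/-! ### The isotropic normal frame -/

section Sections

variable {D : Set ℂ} {y : ℂ → EuclideanSpace ℝ (Fin 7)} {F Q : ℂ → Mat} {z : ℂ}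

/-- The normal connection preserves the sections of the isotropic plane bundle. -/
lemma IsParallelProjector.normal_derivatives (hD : IsOpen D) (hI : IsConformalImmersion D y)
    (hFr : IsFrame D y F) (hz : z ∈ D) (h : IsParallelProjector F Q z) {ψ k : ℂ → Vec}
    {ka kb : Vec} (hψ : ψ =ᶠ[𝓝 z] fun w => F w *ᵥ k w) (hk : k =ᶠ[𝓝 z] fun w => Q w *ᵥ k w)
    (hd : HasFDerivAt k (wirt ka kb) z) :
    (∃ x, Dz y ψ z = F z *ᵥ (Q z *ᵥ x)) ∧ ∃ x, Dzbar y ψ z = F z *ᵥ (Q z *ᵥ x) := by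
  have hL := liftProducts hD hI hz
  have h1 := ((hFr.hasWirt hD hz).mulVec hd).congr_of_eventuallyEq hψ
  obtain ⟨h2, h3⟩ := wirt_injective (hd.unique ((h.deriv.mulVec hd).congr_of_eventuallyEq hk))
  have hkz : k z = Q z *ᵥ k z := hk.self_of_nhds
  have hkN : qN *ᵥ k z = k z := by rw [hkz, Matrix.mulVec_mulVec, h.normal]
  have key : ∀ (A : Mat) (a : Vec), a = (Q z * A * qN - qN * A * Q z) *ᵥ k z + Q z *ᵥ a →
      normalPart y z ((F z * A) *ᵥ k z + F z *ᵥ a) = F z *ᵥ (Q z *ᵥ (A *ᵥ k z + a)) := by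
    intro A a ha
    have e1 : (F z * A) *ᵥ k z + F z *ᵥ a = F z *ᵥ (A *ᵥ k z + a) := by
      rw [Matrix.mulVec_add, Matrix.mulVec_mulVec]
    rw [e1, hFr.normalPart_mulVec hL hz]
    congr 1
    have e2 : qN *ᵥ a = Q z *ᵥ (A *ᵥ k z) - qN *ᵥ (A *ᵥ k z) + Q z *ᵥ a := by
      conv_lhs => rw [ha]
      rw [Matrix.mulVec_add, Matrix.sub_mulVec, Matrix.mulVec_sub]
      simp only [← Matrix.mulVec_mulVec, hkN, ← hkz]
      simp only [Matrix.mulVec_mulVec, ← mul_assoc, h.normal, qN_mul_qN]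
    rw [Matrix.mulVec_add, Matrix.mulVec_add, e2]
    abel
  refine ⟨⟨mcZ F z *ᵥ k z + ka, ?_⟩, ⟨mcB F z *ᵥ k z + kb, ?_⟩⟩
  · rw [Dz, dz_of_hasFDerivAt h1]; exact key _ _ h2
  · rw [Dzbar, dzbar_of_hasFDerivAt h1]; exact key _ _ h3

/-- The coordinates of a smooth map in a frame are differentiable. -/
lemma hasFDerivAt_frame_coordinates (hD : IsOpen D) (hFr : IsFrame D y F) (hz : z ∈ D)
    {ψ : ℂ → Vec} (hψ : ContDiffOn ℝ ∞ ψ D) :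
    ∃ a b, HasFDerivAt (fun w => (F w)⁻¹ *ᵥ ψ w) (wirt a b) z :=
  ⟨_, _, (hasWirt_of_contDiffOn hD hFr.contDiffOn_inv hz).mulVec
    (ContDiffOn.hasFDerivAt_wirt hD hψ hz)⟩

/-- The Hopf differential is a section of the isotropic plane bundle. -/
lemma IsParallelProjector.kappa_eq (hD : IsOpen D) (hI : IsConformalImmersion D y)
    (hFr : IsFrame D y F) (hz : z ∈ D) (h : IsParallelProjector F Q z) :
    ∃ x, kappa y z = F z *ᵥ (Q z *ᵥ x) := by
  have hc := contDiffOn_dz hD (contDiffOn_lift hD hI)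
  obtain ⟨a, b, hd⟩ := hasFDerivAt_frame_coordinates hD hFr hz hc
  obtain ⟨x, hx⟩ : ∃ x : ℂ → Vec, x = fun w => (F w)⁻¹ *ᵥ dz (lift y) w := ⟨_, rfl⟩
  rw [← hx] at hd
  have hN : ∀ w ∈ D, qN *ᵥ x w = 0 := fun w hw => by
    rw [hx]
    exact mem_frame_of_mem_bundleV hFr (liftProducts hD hI hw) hw dz_lift_mem_bundleV
  have hY : dz (lift y) =ᶠ[𝓝 z] fun w => F w *ᵥ x w := by
    filter_upwards [hD.mem_nhds hz] with w hw
    rw [hx, Matrix.mulVec_mulVec, groupC_mul_inv (hFr.groupC hw), Matrix.one_mulVec]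
  have h1 := ((hFr.hasWirt hD hz).mulVec hd).congr_of_eventuallyEq hY
  have h2 : qN *ᵥ a = 0 := by
    have e1 := (HasWirt.const qN z).mulVec hd
    have e2 : (fun w => qN *ᵥ x w) =ᶠ[𝓝 z] fun _ => (0 : Vec) :=
      Filter.eventually_of_mem (hD.mem_nhds hz) hN
    have e3 := (wirt_injective
      (e1.unique ((wirt_const (0 : Vec) z).congr_of_eventuallyEq e2))).1
    simpa using e3
  have hV : x z = qV *ᵥ x z := by
    have : x z = (qN + qV) *ᵥ x z := by rw [qN_add_qV, Matrix.one_mulVec]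
    rwa [Matrix.add_mulVec, hN z hz, zero_add] at this
  refine ⟨mcZ F z *ᵥ x z, ?_⟩
  have e : (F z * mcZ F z) *ᵥ x z + F z *ᵥ a = F z *ᵥ (mcZ F z *ᵥ x z + a) := by
    rw [Matrix.mulVec_add, Matrix.mulVec_mulVec]
  rw [kappa, dz_of_hasFDerivAt h1, e, hFr.normalPart_mulVec (liftProducts hD hI hz) hz,
    Matrix.mulVec_add, h2, add_zero]
  congr 1
  calc qN *ᵥ (mcZ F z *ᵥ x z) = (qN * mcZ F z * qV) *ᵥ x z := by
        conv_lhs => rw [hV]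
        simp only [Matrix.mulVec_mulVec, mul_assoc]
    _ = Q z *ᵥ (mcZ F z *ᵥ x z) := by
        rw [h.normal_block (hFr.mc_skew hD hz).1]
        conv_rhs => rw [hV]
        simp only [Matrix.mulVec_mulVec, mul_assoc]

end Sections

section GramSchmidt

variable {F Q : ℂ → Mat} {z : ℂ}

/-- The squared norm of the component of the column `j` of `Q` that is orthogonal to column `4`, for a
projector `Q` with `Q 4 4 = Q j j = 1 / 2`. -/
def gsNorm (Q : ℂ → Mat) (j : Fin 8) (z : ℂ) : ℝ := 1 / 2 - 2 * ‖Q z 4 j‖ ^ 2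

/-- Coefficients of an orthonormal basis of the column space of `Q` obtained from the columns `4`
and `j` by the Gram-Schmidt process. -/
def gsCoeff (Q : ℂ → Mat) (j : Fin 8) (z : ℂ) : Fin 2 → Vec :=
  ![Pi.single 4 ((Real.sqrt 2 : ℝ) : ℂ),
    (((Real.sqrt (gsNorm Q j z))⁻¹ : ℝ) : ℂ) • (Pi.single j 1 - Pi.single 4 (2 * Q z 4 j))]

lemma mulVec_gsCoeff (Q : ℂ → Mat) (j : Fin 8) (z : ℂ) (i : Fin 2) (l : Fin 8) :
    (Q z *ᵥ gsCoeff Q j z i) l = ![Q z l 4 * ((Real.sqrt 2 : ℝ) : ℂ),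
      (((Real.sqrt (gsNorm Q j z))⁻¹ : ℝ) : ℂ) * (Q z l j - Q z l 4 * (2 * Q z 4 j))] i := by
  fin_cases i
  · simp [gsCoeff]
  · simp [gsCoeff, Matrix.mulVec_smul, Matrix.mulVec_sub]

lemma star_gsCoeff_dotProduct (Q : ℂ → Mat) (j : Fin 8) (z : ℂ) (i : Fin 2) (x : Vec) :
    x ⬝ᵥ star (gsCoeff Q j z i) = ![((Real.sqrt 2 : ℝ) : ℂ) * x 4,
      (((Real.sqrt (gsNorm Q j z))⁻¹ : ℝ) : ℂ) * (x j - star (2 * Q z 4 j) * x 4)] i := by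
  have h : ∀ (a : Fin 8) (c : ℂ), star (Pi.single a c : Vec) = Pi.single a (star c) := by
    intro a c; ext l
    by_cases hl : l = a
    · subst hl; simp
    · simp [hl]
  fin_cases i
  · simp [gsCoeff, h, mul_comm]
  · simp [gsCoeff, h, mul_comm]

/-- The diagonal entries of `Q` in the normal directions, from `Q + Qᵀ = qN`. -/
lemma IsParallelProjector.diag (h : IsParallelProjector F Q z) {j : Fin 8} (hj : 4 ≤ (j : ℕ)) :
    Q z j j = 1 / 2 := by
  have := congrFun (congrFun h.add_transpose j) j
  simp only [Matrix.add_apply, Matrix.transpose_apply, qN, Matrix.diagonal_apply_eq] at this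
  rw [if_neg (by omega), ← two_mul] at this
  linear_combination this / 2

/-- Column `5` or column `6` is linearly independent of column `4`: the row `4` has squared norm
`Q 4 4 = 1 / 2`, to which the entry `Q 4 4` contributes `1 / 4`, so that the next two entries cannot
both have squared absolute value `1 / 4`. -/
lemma IsParallelProjector.exists_gsNorm_pos (h : IsParallelProjector F Q z) :
    ∃ j : Fin 8, 4 ≤ (j : ℕ) ∧ 0 < gsNorm Q j z := by
  have h44 : Q z 4 4 = 1 / 2 := h.diag (by decide)
  have hsum : ∑ j, ‖Q z 4 j‖ ^ 2 = 1 / 2 := by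
    have h1 : (Q z * (Q z)ᴴ) 4 4 = 1 / 2 := by rw [h.herm, h.idem, h44]
    have h2 : ((∑ j, ‖Q z 4 j‖ ^ 2 : ℝ) : ℂ) = 1 / 2 := by
      rw [← h1, Matrix.mul_apply]
      push_cast
      refine Finset.sum_congr rfl fun j _ => ?_
      rw [← Complex.mul_conj']; rfl
    have h3 : ((∑ j, ‖Q z 4 j‖ ^ 2 : ℝ) : ℂ) = ((1 / 2 : ℝ) : ℂ) := by rw [h2]; norm_num
    exact_mod_cast h3
  have h4 : ‖Q z 4 4‖ ^ 2 = 1 / 4 := by rw [h44]; norm_num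
  have h5 : ‖Q z 4 4‖ ^ 2 + ‖Q z 4 5‖ ^ 2 + ‖Q z 4 6‖ ^ 2 ≤ 1 / 2 := by
    rw [← hsum]
    have := Finset.sum_le_sum_of_subset_of_nonneg (Finset.subset_univ ({4, 5, 6} : Finset (Fin 8)))
      (f := fun j => ‖Q z 4 j‖ ^ 2) (fun _ _ _ => by positivity)
    rw [Finset.sum_insert (by decide), Finset.sum_insert (by decide), Finset.sum_singleton] at this
    linarith
  by_cases h6 : ‖Q z 4 5‖ ^ 2 < 1 / 4
  · exact ⟨5, by decide, by unfold gsNorm; linarith⟩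
  · exact ⟨6, by decide, by unfold gsNorm; linarith⟩

/-- The images under `Q` of the Gram-Schmidt coefficients are orthonormal. -/
lemma IsParallelProjector.gs_orthonormal (h : IsParallelProjector F Q z) {j : Fin 8}
    (hj : 4 ≤ (j : ℕ)) (hpos : 0 < gsNorm Q j z) (a b : Fin 2) :
    (Q z *ᵥ gsCoeff Q j z a) ⬝ᵥ star (Q z *ᵥ gsCoeff Q j z b) = if a = b then 1 else 0 := by
  have h4 : Q z 4 4 = 1 / 2 := h.diag (by decide)
  have hjj : Q z j j = 1 / 2 := h.diag hj
  have hsw : Q z j 4 = star (Q z 4 j) := by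
    conv_lhs => rw [← h.herm]
    rfl
  have e1 : (Q z *ᵥ gsCoeff Q j z a) ⬝ᵥ star (Q z *ᵥ gsCoeff Q j z b)
      = (Q z *ᵥ gsCoeff Q j z a) ⬝ᵥ star (gsCoeff Q j z b) := by
    rw [Matrix.star_mulVec, h.herm, dotProduct_comm, ← Matrix.dotProduct_mulVec,
      Matrix.mulVec_mulVec, h.idem, dotProduct_comm]
  have hs2 : ((Real.sqrt 2 : ℝ) : ℂ) * ((Real.sqrt 2 : ℝ) : ℂ) = 2 := by
    rw [← Complex.ofReal_mul, Real.mul_self_sqrt (by norm_num)]; norm_num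
  have hν : (((Real.sqrt (gsNorm Q j z))⁻¹ : ℝ) : ℂ) * (((Real.sqrt (gsNorm Q j z))⁻¹ : ℝ) : ℂ)
      * (1 / 2 - 2 * (Q z 4 j * star (Q z 4 j))) = 1 := by
    have : (1 / 2 - 2 * (Q z 4 j * star (Q z 4 j)) : ℂ) = ((gsNorm Q j z : ℝ) : ℂ) := by
      have e := Complex.mul_conj' (Q z 4 j)
      rw [gsNorm]; push_cast; rw [← e]; rfl
    rw [this, ← Complex.ofReal_mul, ← Complex.ofReal_mul, ← mul_inv,
      Real.mul_self_sqrt hpos.le, inv_mul_cancel₀ hpos.ne', Complex.ofReal_one]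
  rw [e1, star_gsCoeff_dotProduct]
  simp only [mulVec_gsCoeff]
  generalize (((Real.sqrt (gsNorm Q j z))⁻¹ : ℝ) : ℂ) = ν at hν
  generalize ((Real.sqrt 2 : ℝ) : ℂ) = s at hs2
  have st : star (2 * Q z 4 j) = 2 * star (Q z 4 j) := by simp
  fin_cases a <;> fin_cases b <;>
    simp only [Fin.zero_eta, Fin.mk_one, Fin.isValue, Matrix.cons_val_zero, Matrix.cons_val_one,
      Matrix.cons_val_fin_one, h4, hjj, hsw, st, if_true, zero_ne_one, one_ne_zero, if_false]
  · linear_combination hs2 / 2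
  · ring
  · ring
  · linear_combination hν

/-- The Gram-Schmidt basis spans the column space of the projector. -/
lemma IsParallelProjector.mulVec_mem_span (h : IsParallelProjector F Q z) {j : Fin 8}
    (hj : 4 ≤ (j : ℕ)) (hpos : 0 < gsNorm Q j z) (x : Vec) :
    F z *ᵥ (Q z *ᵥ x) ∈ Submodule.span ℂ
      {F z *ᵥ (Q z *ᵥ gsCoeff Q j z 0), F z *ᵥ (Q z *ᵥ gsCoeff Q j z 1)} := by
  set N : Matrix (Fin 8) (Fin 2) ℂ := Matrix.of fun i a => (Q z *ᵥ gsCoeff Q j z a) i with hN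
  have h1 : Nᴴ * N = 1 := by
    ext a b
    have := h.gs_orthonormal hj hpos b a
    rw [dotProduct_comm] at this
    rw [Matrix.one_apply, Matrix.mul_apply, eq_comm]
    simp only [eq_comm (a := a)]
    exact this.symm
  have h2 : Q z * N = N := by
    ext i a
    have : (Q z *ᵥ (Q z *ᵥ gsCoeff Q j z a)) i = (Q z *ᵥ gsCoeff Q j z a) i := by
      rw [Matrix.mulVec_mulVec, h.idem]
    exact this
  have h3 : Nᴴ * Q z = Nᴴ := by
    have := congrArg Matrix.conjTranspose h2
    rwa [Matrix.conjTranspose_mul, h.herm] at this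
  have h4 : Q z - N * Nᴴ = 0 := by
    refine eq_zero_of_projector_trace_zero ?_ ?_ ?_
    · rw [Matrix.conjTranspose_sub, h.herm, Matrix.conjTranspose_mul,
        Matrix.conjTranspose_conjTranspose]
    · rw [sub_mul, mul_sub, mul_sub, h.idem, ← Matrix.mul_assoc (Q z), h2,
        Matrix.mul_assoc N, h3, Matrix.mul_assoc N, ← Matrix.mul_assoc Nᴴ, h1, Matrix.one_mul]
      abel
    · rw [Matrix.trace_sub, Matrix.trace_mul_comm, h1, h.trace, Matrix.trace_one]
      simp
  have h5 : Q z *ᵥ x = (Nᴴ *ᵥ x) 0 • (Q z *ᵥ gsCoeff Q j z 0)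
      + (Nᴴ *ᵥ x) 1 • (Q z *ᵥ gsCoeff Q j z 1) := by
    conv_lhs => rw [sub_eq_zero.1 h4, ← Matrix.mulVec_mulVec]
    ext i
    rw [Matrix.mulVec, dotProduct, Fin.sum_univ_two]
    simp [hN, mul_comm]
  rw [h5, Matrix.mulVec_add, Matrix.mulVec_smul, Matrix.mulVec_smul]
  exact Submodule.add_mem _ (Submodule.smul_mem _ _ (Submodule.subset_span (by simp)))
    (Submodule.smul_mem _ _ (Submodule.subset_span (by simp)))

end GramSchmidt

section Frame

variable {D U : Set ℂ} {y : ℂ → EuclideanSpace ℝ (Fin 7)} {F Q : ℂ → Mat}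

lemma star_mulVec_of_real {A : Mat} (hA : A.map star = A) (x : Vec) :
    star (A *ᵥ x) = A *ᵥ star x := by
  conv_rhs => rw [← hA]
  ext i
  simp [Matrix.mulVec, dotProduct]

/-- The Gram-Schmidt basis of a parallel projector is an isotropic frame of the normal bundle. -/
lemma isIsotropicNormalFrame_of_projector (hD : IsOpen D) (hI : IsConformalImmersion D y)
    (hFr : IsFrame D y F) (hU : IsOpen U) (hUD : U ⊆ D)
    (h : ∀ w ∈ U, IsParallelProjector F Q w) {j : Fin 8} (hj : 4 ≤ (j : ℕ))
    (hpos : ∀ w ∈ U, 0 < gsNorm Q j w) :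
    IsIsotropicNormalFrame U y fun i w => F w *ᵥ (Q w *ᵥ gsCoeff Q j w i) := by
  have hQs := contDiffOn_parallelProjector hU
    (fun i j => (hFr.contDiffOn_mcZ hD i j).mono hUD)
    (fun i j => (hFr.contDiffOn_mcB hD i j).mono hUD) h
  have hFs : ∀ i j, ContDiffOn ℝ ∞ (fun w => F w i j) U := fun i j => (hFr.smooth i j).mono hUD
  have hνs : ContDiffOn ℝ ∞ (fun w => (((Real.sqrt (gsNorm Q j w))⁻¹ : ℝ) : ℂ)) U := by
    have h1 : ContDiffOn ℝ ∞ (gsNorm Q j) U :=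
      contDiffOn_const.sub (contDiffOn_const.mul ((hQs 4 j).norm_sq ℝ))
    have h2 : ContDiffOn ℝ ∞ (fun w => (Real.sqrt (gsNorm Q j w))⁻¹) U :=
      (h1.sqrt fun w hw => (hpos w hw).ne').inv fun w hw => (Real.sqrt_pos.2 (hpos w hw)).ne'
    exact Complex.ofRealCLM.contDiff.comp_contDiffOn h2
  have hks : ∀ i, ContDiffOn ℝ ∞ (fun w => Q w *ᵥ gsCoeff Q j w i) U := by
    intro i
    rw [contDiffOn_pi]
    intro l
    simp only [mulVec_gsCoeff]
    fin_cases i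
    · exact (hQs l 4).mul contDiffOn_const
    · exact hνs.mul ((hQs l j).sub ((hQs l 4).mul (contDiffOn_const.mul (hQs 4 j))))
  have hpar : ∀ w ∈ U, ∀ i, (∃ x, Dz y (fun v => F v *ᵥ (Q v *ᵥ gsCoeff Q j v i)) w
      = F w *ᵥ (Q w *ᵥ x)) ∧ ∃ x, Dzbar y (fun v => F v *ᵥ (Q v *ᵥ gsCoeff Q j v i)) w
      = F w *ᵥ (Q w *ᵥ x) := fun w hw i =>
    (h w hw).normal_derivatives hD hI hFr (hUD hw) (Filter.EventuallyEq.refl _ _)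
      (Filter.eventually_of_mem (hU.mem_nhds hw) fun v hv => by
        change Q v *ᵥ _ = Q v *ᵥ (Q v *ᵥ _)
        rw [Matrix.mulVec_mulVec, (h v hv).idem])
      (ContDiffOn.hasFDerivAt_wirt hU (hks i) hw)
  have hκ : ∀ w ∈ U, (∃ x, Dz y (kappa y) w = F w *ᵥ (Q w *ᵥ x)) ∧
      ∃ x, Dzbar y (kappa y) w = F w *ᵥ (Q w *ᵥ x) := by
    intro w hw
    obtain ⟨a, b, hd⟩ := hasFDerivAt_frame_coordinates hD hFr (hUD hw) (contDiffOn_kappa hD hI)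
    refine (h w hw).normal_derivatives hD hI hFr (hUD hw)
      (Filter.eventually_of_mem (hU.mem_nhds hw) fun v hv => ?_)
      (Filter.eventually_of_mem (hU.mem_nhds hw) fun v hv => ?_) hd
    · simp only [Matrix.mulVec_mulVec, groupC_mul_inv (hFr.groupC (hUD hv)), Matrix.one_mulVec]
    · obtain ⟨x, hx⟩ := (h v hv).kappa_eq hD hI hFr (hUD hv)
      have e : (F v)⁻¹ *ᵥ kappa y v = Q v *ᵥ x := by
        rw [hx, Matrix.mulVec_mulVec, groupC_inv_mul (hFr.groupC (hUD hv)), Matrix.one_mulVec]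
      simp only [e]
      rw [Matrix.mulVec_mulVec, (h v hv).idem]
  have hI17 : ∀ w ∈ U, ∀ x, I17 *ᵥ (Q w *ᵥ x) = Q w *ᵥ x := by
    intro w hw x
    rw [Matrix.mulVec_mulVec, ← (h w hw).normal, ← mul_assoc, I17_mul_qN]
  constructor
  · intro i
    rw [contDiffOn_pi]
    intro l
    change ContDiffOn ℝ ∞ (fun w => ∑ m, F w l m * (Q w *ᵥ gsCoeff Q j w i) m) U
    exact ContDiffOn.sum fun m _ => (hFs l m).mul (contDiffOn_pi.1 (hks i) m)
  · intro w hw i X hX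
    have e : Q w *ᵥ gsCoeff Q j w i = qN *ᵥ (Q w *ᵥ gsCoeff Q j w i) := by
      rw [Matrix.mulVec_mulVec, (h w hw).normal]
    rw [e]
    exact hFr.lor_qN_bundleV (hUD hw) _ hX
  · intro w hw
    obtain ⟨x, hx⟩ := (h w hw).kappa_eq hD hI hFr (hUD hw)
    rw [hx]; exact (h w hw).mulVec_mem_span hj (hpos w hw) x
  · intro w hw
    obtain ⟨x, hx⟩ := (hκ w hw).1
    rw [hx]; exact (h w hw).mulVec_mem_span hj (hpos w hw) x
  · intro w hw
    obtain ⟨x, hx⟩ := (hκ w hw).2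
    rw [hx]; exact (h w hw).mulVec_mem_span hj (hpos w hw) x
  · intro w hw a b
    rw [lor_mulVec (hFr.groupC (hUD hw)), lor_eq_dotProduct, hI17 w hw, ← Matrix.vecMul_transpose,
      ← Matrix.dotProduct_mulVec, Matrix.mulVec_mulVec, (h w hw).transpose_mul_self,
      Matrix.zero_mulVec, dotProduct_zero]
  · intro w hw a b
    have e : I17 *ᵥ star (Q w *ᵥ gsCoeff Q j w b) = star (Q w *ᵥ gsCoeff Q j w b) := by
      rw [← star_mulVec_of_real I17_map_star, hI17 w hw]
    rw [star_mulVec_of_real (hFr.mem_group w (hUD hw)).2.1, lor_mulVec (hFr.groupC (hUD hw)),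
      lor_eq_dotProduct, e]
    exact (h w hw).gs_orthonormal hj (hpos w hw) a b
  · intro w hw i
    obtain ⟨x, hx⟩ := (hpar w hw i).1
    rw [hx]; exact (h w hw).mulVec_mem_span hj (hpos w hw) x
  · intro w hw i
    obtain ⟨x, hx⟩ := (hpar w hw i).2
    rw [hx]; exact (h w hw).mulVec_mem_span hj (hpos w hw) x

end Frame

/-! ### Total isotropy -/

section Isotropy

variable {D U : Set ℂ} {y : ℂ → EuclideanSpace ℝ (Fin 7)} {E : Fin 2 → ℂ → Vec} {z : ℂ}

lemma lor_eq_zero_of_mem_span {f a b v : Vec} (ha : lor f a = 0) (hb : lor f b = 0)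
    (hv : v ∈ Submodule.span ℂ {a, b}) : lor f v = 0 := by
  obtain ⟨c, d, rfl⟩ := Submodule.mem_span_pair.1 hv
  rw [lor_add_right, lor_smul_right, lor_smul_right, ha, hb]
  ring

/-- `f` is a smooth map on `U` into the orthogonal complement of `Y, Y_z, E₁, E₂`. -/
structure IsOrthogonalSection (U : Set ℂ) (y : ℂ → EuclideanSpace ℝ (Fin 7))
    (E : Fin 2 → ℂ → Vec) (f : ℂ → Vec) : Prop where
  smooth : ContDiffOn ℝ ∞ f U
  lor_lift : ∀ z ∈ U, lor (f z) (lift y z) = 0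
  lor_dz_lift : ∀ z ∈ U, lor (f z) (dz (lift y) z) = 0
  lor_frame : ∀ z ∈ U, ∀ i, lor (f z) (E i z) = 0

/-- The bundle spanned by `Y, Y_z, E₁, E₂` is invariant under `∂_z`, hence so is its orthogonal
complement. -/
lemma IsOrthogonalSection.dz_section (hU : IsOpen U) (hI : IsConformalImmersion U y)
    (hE : IsIsotropicNormalFrame U y E) {f : ℂ → Vec} (hf : IsOrthogonalSection U y E f) :
    IsOrthogonalSection U y E (dz f) := by
  have c0 := contDiffOn_lift hU hI
  have c1 := contDiffOn_dz hU c0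
  have hκ : ∀ {g : ℂ → Vec}, (∀ z ∈ U, ∀ i, lor (g z) (E i z) = 0) → ∀ z ∈ U,
      lor (g z) (lift y z) = 0 → lor (g z) (dz (dz (lift y)) z) = 0 := by
    intro g hg z hz hgY
    rw [dz_dz_lift (liftProducts hU hI hz), lor_add_right, lor_smul_right, hgY,
      lor_eq_zero_of_mem_span (hg z hz 0) (hg z hz 1) (hE.kappa_mem z hz)]
    ring
  refine ⟨contDiffOn_dz hU hf.smooth, fun z hz => ?_, fun z hz => ?_, fun z hz i => ?_⟩
  · have := (lor_const_deriv hU hf.smooth c0 hf.lor_lift hz).1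
    rwa [hf.lor_dz_lift z hz, add_zero] at this
  · have := (lor_const_deriv hU hf.smooth c1 hf.lor_dz_lift hz).1
    rwa [hκ hf.lor_frame z hz (hf.lor_lift z hz), add_zero] at this
  · have h1 := (lor_const_deriv hU hf.smooth (hE.smooth i) (fun w hw => hf.lor_frame w hw i) hz).1
    have h2 := (lor_const_deriv hU (hE.smooth i) c0
      (fun w hw => hE.normal w hw i _ lift_mem_bundleV) hz).1
    have h3 := (lor_const_deriv hU (hE.smooth i) c1
      (fun w hw => hE.normal w hw i _ dz_lift_mem_bundleV) hz).1
    rw [hE.normal z hz i _ dz_lift_mem_bundleV, add_zero] at h2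
    rw [hκ (fun w hw => hE.isotropic w hw i) z hz (hE.normal z hz i _ lift_mem_bundleV),
      add_zero] at h3
    have h4 := lor_eq_zero_of_mem_span (hf.lor_frame z hz 0) (hf.lor_frame z hz 1) (hE.Dz_mem z hz i)
    rw [Dz, normalPart, h2, h3] at h4
    simp only [lor_add_right, lor_sub_right, lor_smul_right, hf.lor_lift z hz, hf.lor_dz_lift z hz] at h4
    linear_combination h1 - h4

/-- All derivatives `∂_z^m Y`, `m ≥ 1`, are orthogonal to `Y_z` by the invariance of the bundle, and
an induction on `n` that moves derivatives from one factor to the other gives the rest. -/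
lemma isTotallyIsotropic_of_frame (hU : IsOpen U) (hI : IsConformalImmersion U y)
    (hE : IsIsotropicNormalFrame U y E) : IsTotallyIsotropic U y := by
  have c0 := contDiffOn_lift hU hI
  have horth : ∀ m, IsOrthogonalSection U y E (dz^[m + 1] (lift y)) := by
    intro m
    induction m with
    | zero =>
      refine ⟨contDiffOn_dz hU c0, fun z hz => ?_, fun z hz => (liftProducts hU hI hz).YzYz,
        fun z hz i => ?_⟩
      · rw [lor_comm]; exact (liftProducts hU hI hz).YYz
      · rw [lor_comm]; exact hE.normal z hz i _ dz_lift_mem_bundleV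
    | succ m ih =>
      rw [Function.iterate_succ_apply']
      exact ih.dz_section hU hI hE
  have key : ∀ n m, ∀ z ∈ U, lor (dz^[m + 1] (lift y) z) (dz^[n + 1] (lift y) z) = 0 := by
    intro n
    induction n with
    | zero => exact fun m z hz => (horth m).lor_dz_lift z hz
    | succ n ih =>
      intro m z hz
      have h1 := (lor_const_deriv hU (horth m).smooth (horth n).smooth (ih m) hz).1
      rw [← Function.iterate_succ_apply' dz, ← Function.iterate_succ_apply' dz,
        ih (m + 1) z hz, zero_add] at h1
      exact h1
  intro m n hm hn z hz
  obtain ⟨m, rfl⟩ := Nat.exists_eq_succ_of_ne_zero (by omega : m ≠ 0)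
  obtain ⟨n, rfl⟩ := Nat.exists_eq_succ_of_ne_zero (by omega : n ≠ 0)
  exact key n m z hz

end Isotropy

end Willmore

end

theorem theorem3p1 (D : Set ℂ) (hD : IsOpen D) (hDc : IsConnected D) (h0 : (0 : ℂ) ∈ D)
    (y : ℂ → EuclideanSpace ℝ (Fin 7)) (hy : Willmore.IsWillmore D y)
    (h : Fin 4 → Fin 2 → ℂ → ℂ) (hh : ∀ j k, MeromorphicOn (h j k) D)
    (hη : Willmore.IsNormalizedPotential D y (Willmore.isoPotential h)) :
    Willmore.IsTotallyIsotropic D y ∧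
      ∀ z₀ ∈ D, ∃ U : Set ℂ, IsOpen U ∧ z₀ ∈ U ∧ U ⊆ D ∧
        ∃ E : Fin 2 → ℂ → Willmore.Vec, Willmore.IsIsotropicNormalFrame U y E := by
  obtain ⟨F, Fl, Fm, Fp, P, hFr, hE, hB⟩ := hη
  have hI := hy.immersion
  have hloc : ∀ z₀ ∈ D, ∃ U : Set ℂ, IsOpen U ∧ z₀ ∈ U ∧ U ⊆ D ∧
      ∃ E : Fin 2 → ℂ → Willmore.Vec, Willmore.IsIsotropicNormalFrame U y E := by
    intro z₀ hz₀
    have h1 : ∀ᶠ w in 𝓝[≠] z₀,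
        Willmore.IsParallelProjector F (fun w => Willmore.colProj (Fp w 0 * Willmore.isoMat)) w := by
      filter_upwards [hB.discrete z₀ hz₀, mem_nhdsWithin_of_mem_nhds (hD.mem_nhds hz₀)] with w hw hwD
      exact hB.isParallelProjector hD hDc.isPreconnected h0 hFr hE ⟨hwD, hw⟩
    obtain ⟨Q, hQ⟩ := Willmore.exists_parallelProjector_extension hD hFr hz₀ h1
    obtain ⟨j, hj, hpos⟩ := hQ.self_of_nhds.exists_gsNorm_pos
    have hcont : ContinuousAt (Willmore.gsNorm Q j) z₀ :=
      continuousAt_const.sub (continuousAt_const.mul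
        ((hQ.self_of_nhds.deriv 4 j).continuousAt.norm.pow 2))
    obtain ⟨U, hU, hUo, hzU⟩ := eventually_nhds_iff.1
      (hQ.and ((hcont.eventually (lt_mem_nhds hpos)).and (hD.eventually_mem hz₀)))
    exact ⟨U, hUo, hzU, fun w hw => (hU w hw).2.2, _,
      Willmore.isIsotropicNormalFrame_of_projector hD hI hFr hUo (fun w hw => (hU w hw).2.2)
        (fun w hw => (hU w hw).1) hj fun w hw => (hU w hw).2.1⟩
  refine ⟨fun m n hm hn z hz => ?_, hloc⟩
  obtain ⟨U, hUo, hzU, hUD, E, hEU⟩ := hloc z hz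
  have hIU : Willmore.IsConformalImmersion U y :=
    ⟨hI.smooth.mono hUD, fun w hw => hI.mem_sphere w (hUD hw), fun w hw => hI.conformal w (hUD hw)⟩
  exact Willmore.isTotallyIsotropic_of_frame hUo hIU hEU m n hm hn z hzU
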